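/- Let $n$ be a natural number and $\mathbf k$ a field, and let $\hat{\mathcal O}=\mathbf k[[x_1,\dots,x_n]]$. Let $h_{(0,1)}(\hat D)$ be the $\mathbf k$-algebra generated by $\hat{\mathcal O}$, $\partial_1,\dots,\partial_n$ and $h$, with only non-trivial commutation relations $\partial_i c-c\,\partial_i=\frac{\partial c}{\partial x_i}h$ ($c\in\hat{\mathcal O}$); its elements are uniquely finite sums $P=\sum_{\beta,j} c_{\beta,j}(x)\,\partial^\beta h^j=\sum_{\alpha,\beta,j} c_{\alpha,\beta,j}x^\alpha\partial^\beta h^j$. If $\mathbf k=\mathbb C$, let $h_{(0,1)}(\mathcal D_0)$ be the subring of those $P$ all of whose coefficients $c_{\beta,j}$ are convergent power series. Let $R$ be one of these two rings. An element is homogeneous if $|\beta|+j$ is constant on its monomials; a (left) ideal is homogeneous if it is generated by homogeneous elements. Let $W_{loc}=\{w=(u,v)\in\mathbb R^n\times\mathbb R^n : u_i\le 0,\ u_i+v_i\ge 0 \text{ for all } i\}$. For $w\in W_{loc}$ give $x^\alpha\partial^\beta h^j$ the weight $u\cdot\alpha+v\cdot\beta$, let $F_c^w(R)$ be the set of $P\in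 R$ all of whose monomials have weight $\le c$ ($c\in\mathbb R$), and let $\mathrm{gr}^w(R)=\bigoplus_c F^w_c(R)/F^w_{<c}(R)$ be the associated graded ring, the class of $P\in F^w_c(R)$ being identified with the part of $P$ of weight exactly $c$; so for different $w$ the underlying groups of the rings $\mathrm{gr}^w(R)$ are subgroups of one and the same group. For a left ideal $I$ of $R$ let $\mathrm{in}_w(I)=\bigoplus_c (I\cap F^w_c)/(I\cap F^w_{<c})\subset \mathrm{gr}^w(R)$. For $w\in W_{loc}$ let $$C_I[w]=\{w'\in W_{loc} : \mathrm{gr}^{w}(R)=\mathrm{gr}^{w'}(R)\text{ as rings and } \mathrm{in}_w(I)=\mathrm{in}_{w'}(I)\},$$ and let the closed Gröbner fan be $\bar{\mathcal E}(I,W_{loc})=\{\overline{C_I[w]} : w\in W_{loc}\}$. **Theorem.** Let $I$ be a homogeneous left ideal of $R=h_{(0,1)}(\hat D)$, or of $R=h_{(0,1)}(\mathcal D_0)$ (with $\mathbf k=\mathbb C$). Then $\bar{\mathcal E}(I,W_{loc})$ is a rational polyhedral fan: it is a finite collection of rational polyhedral cones, every face of a member is a member, and the intersection of any two members is a face of both.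 Moreover, for every linear subspace $L\subset\mathbb R^{2n}$ the restriction $\{C\cap L : C\in\bar{\mathcal E}(I,W_{loc})\}$ is a polyhedral fan (not necessarily rational), and the union of its members is $W_{loc}\cap L$. -/

import Mathlib

noncomputable section

/-- The homogenized ring `h_(0,1)(D̂)` of formal differential operators over a field `k`.
An element is a finite sum `∑ c_{β,j}(x) ∂^β h^j` with `c_{β,j} ∈ k[[x_1, …, x_n]]`; it is
stored as the finitely supported family of its coefficients `(β, j) ↦ c_{β,j}`.
The (noncommutative) product is defined below. -/
def HDiff (k : Type*) [Field k] (n : ℕ) : Type _ :=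
  ((Fin n →₀ ℕ) × ℕ) →₀ MvPowerSeries (Fin n) k

/-- The space of weight vectors `w = (u, v) ∈ ℝ^n × ℝ^n`. -/
abbrev WeightSpace (n : ℕ) : Type := (Fin n → ℝ) × (Fin n → ℝ)

namespace HDiff

variable {k : Type*} [Field k] {n : ℕ}

instance : AddCommGroup (HDiff k n) :=
  inferInstanceAs (AddCommGroup (((Fin n →₀ ℕ) × ℕ) →₀ MvPowerSeries (Fin n) k))

instance : Module (MvPowerSeries (Fin n) k) (HDiff k n) :=
  inferInstanceAs (Module (MvPowerSeries (Fin n) k)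
    (((Fin n →₀ ℕ) × ℕ) →₀ MvPowerSeries (Fin n) k))

/-- The finitely supported family of coefficients. -/
def coeffs (P : HDiff k n) : ((Fin n →₀ ℕ) × ℕ) →₀ MvPowerSeries (Fin n) k := P

/-- The coefficient `c_{β,j} ∈ k[[x]]` of `∂^β h^j`. -/
def coef (P : HDiff k n) (β : Fin n →₀ ℕ) (j : ℕ) : MvPowerSeries (Fin n) k :=
  P.coeffs (β, j)

/-- The element `c(x) ∂^β h^j`. -/
def mono (β : Fin n →₀ ℕ) (j : ℕ) (c : MvPowerSeries (Fin n) k) : HDiff k n :=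
  (Finsupp.single (β, j) c : ((Fin n →₀ ℕ) × ℕ) →₀ MvPowerSeries (Fin n) k)

@[ext] theorem ext {P Q : HDiff k n} (h : ∀ β j, P.coef β j = Q.coef β j) : P = Q :=
  Finsupp.ext fun m => h m.1 m.2

@[simp] theorem coef_add (P Q : HDiff k n) (β : Fin n →₀ ℕ) (j : ℕ) :
    (P + Q).coef β j = P.coef β j + Q.coef β j := rfl

@[simp] theorem coef_zero (β : Fin n →₀ ℕ) (j : ℕ) : (0 : HDiff k n).coef β j = 0 := rfl

@[simp] theorem coef_neg (P : HDiff k n) (β : Fin n →₀ ℕ) (j : ℕ) :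
    (-P).coef β j = -P.coef β j := rfl

@[simp] theorem coef_smul (c : MvPowerSeries (Fin n) k) (P : HDiff k n) (β : Fin n →₀ ℕ)
    (j : ℕ) : (c • P).coef β j = c * P.coef β j := rfl

theorem coef_mono (β γ : Fin n →₀ ℕ) (j l : ℕ) (c : MvPowerSeries (Fin n) k) :
    (mono β j c).coef γ l = if β = γ ∧ j = l then c else 0 := by
  classical
  refine (Finsupp.single_apply (a := (β, j)) (a' := (γ, l)) (b := c)).trans ?_
  simp only [Prod.mk.injEq]

@[simp] theorem mono_zero (β : Fin n →₀ ℕ) (j : ℕ) : (mono β j 0 : HDiff k n) = 0 :=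
  Finsupp.single_zero _

theorem mono_add (β : Fin n →₀ ℕ) (j : ℕ) (c d : MvPowerSeries (Fin n) k) :
    mono β j (c + d) = mono β j c + mono β j d := Finsupp.single_add _ _ _

theorem smul_mono (β : Fin n →₀ ℕ) (j : ℕ) (c d : MvPowerSeries (Fin n) k) :
    c • mono β j d = mono β j (c * d) := Finsupp.smul_single _ _ _

theorem induction {p : HDiff k n → Prop} (P : HDiff k n) (zero : p 0)
    (mono : ∀ β j c, p (mono β j c)) (add : ∀ P Q, p P → p Q → p (P + Q)) : p P :=
  Finsupp.induction_linear P zero (fun P Q => add P Q) (fun m c => mono m.1 m.2 c)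

/-! ### The product -/

@[simp] theorem end_mul_apply (E F : AddMonoid.End (HDiff k n)) (P : HDiff k n) :
    (E * F) P = E (F P) := rfl

@[simp] theorem end_add_apply (E F : AddMonoid.End (HDiff k n)) (P : HDiff k n) :
    (E + F) P = E P + F P := rfl

/-- Left multiplication by `c ∈ k[[x]]`. -/
def opC (c : MvPowerSeries (Fin n) k) : AddMonoid.End (HDiff k n) :=
  DistribSMul.toAddMonoidHom _ c

/-- Left multiplication by `h`, i.e. `c(x) ∂^β h^j ↦ c(x) ∂^β h^(j+1)`. -/
def opH : AddMonoid.End (HDiff k n) :=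
  Finsupp.liftAddHom (M := MvPowerSeries (Fin n) k) (N := HDiff k n) fun m =>
    { toFun := fun c => mono m.1 (m.2 + 1) c
      map_zero' := Finsupp.single_zero _
      map_add' := mono_add _ _ }

/-- Left multiplication by `∂_i`, dictated by `∂_i c(x) = c(x) ∂_i + (∂c/∂x_i) h`, i.e.
`c(x) ∂^β h^j ↦ c(x) ∂^(β+e_i) h^j + (∂c/∂x_i) ∂^β h^(j+1)`. -/
def opD (i : Fin n) : AddMonoid.End (HDiff k n) :=
  Finsupp.liftAddHom (M := MvPowerSeries (Fin n) k) (N := HDiff k n) fun m =>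
    { toFun := fun c => mono (m.1 + Finsupp.single i 1) m.2 c +
        mono m.1 (m.2 + 1) (MvPowerSeries.pderiv k i c)
      map_zero' := by simp
      map_add' := fun c d => by
        simp only [map_add, mono_add]; abel }

/-- Left multiplication by `∂_1^{β_1} ⋯ ∂_n^{β_n} h^j`. -/
def opMono (β : Fin n →₀ ℕ) (j : ℕ) : AddMonoid.End (HDiff k n) :=
  ((List.finRange n).map fun i => opD i ^ β i).prod * opH ^ j

/-- Left multiplication by `P = ∑ c_{β,j}(x) ∂^β h^j`. -/
def op : HDiff k n →+ AddMonoid.End (HDiff k n) :=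
  Finsupp.liftAddHom (M := MvPowerSeries (Fin n) k) fun m =>
    { toFun := fun c => opC c * opMono m.1 m.2
      map_zero' := by
        ext P : 1
        exact zero_smul (MvPowerSeries (Fin n) k) (opMono m.1 m.2 P)
      map_add' := fun c d => by
        ext P : 1
        exact add_smul c d (opMono m.1 m.2 P) }

instance : Mul (HDiff k n) := ⟨fun P Q => op P Q⟩

instance : One (HDiff k n) := ⟨mono 0 0 1⟩

theorem mul_def (P Q : HDiff k n) : P * Q = op P Q := rfl

theorem one_def : (1 : HDiff k n) = mono 0 0 1 := rfl

@[simp] theorem opC_apply (c : MvPowerSeries (Fin n) k) (P : HDiff k n) : opC c P = c • P := rfl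

@[simp] theorem opH_mono (β : Fin n →₀ ℕ) (j : ℕ) (c : MvPowerSeries (Fin n) k) :
    opH (mono β j c) = mono β (j + 1) c :=
  Finsupp.liftAddHom_apply_single _ _ _

@[simp] theorem opD_mono (i : Fin n) (β : Fin n →₀ ℕ) (j : ℕ) (c : MvPowerSeries (Fin n) k) :
    opD i (mono β j c) = mono (β + Finsupp.single i 1) j c +
      mono β (j + 1) (MvPowerSeries.pderiv k i c) :=
  Finsupp.liftAddHom_apply_single _ _ _

@[simp] theorem op_mono (β : Fin n →₀ ℕ) (j : ℕ) (c : MvPowerSeries (Fin n) k) :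
    op (mono β j c) = opC c * opMono β j :=
  Finsupp.liftAddHom_apply_single _ _ _

theorem end_ext {f g : AddMonoid.End (HDiff k n)}
    (h : ∀ β j c, f (mono β j c) = g (mono β j c)) : f = g := by
  ext P : 1
  induction P using induction with
  | zero => simp
  | mono β j c => exact h β j c
  | add P Q hP hQ => rw [map_add, map_add, hP, hQ]

theorem pderiv_comm (i j : Fin n) (c : MvPowerSeries (Fin n) k) :
    MvPowerSeries.pderiv k i (MvPowerSeries.pderiv k j c) =
      MvPowerSeries.pderiv k j (MvPowerSeries.pderiv k i c) := by
  classical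
  ext α
  simp only [MvPowerSeries.coeff_pderiv, add_right_comm α]
  by_cases h : i = j
  · subst h; rfl
  · simp [h, Ne.symm h]
    ring

theorem opH_opC (c : MvPowerSeries (Fin n) k) : opH * opC c = opC c * opH :=
  end_ext fun β j d => by simp [smul_mono]

theorem opD_opH (i : Fin n) : opD i * opH = opH * opD (k := k) i :=
  end_ext fun β j d => by simp

theorem opD_opC (i : Fin n) (c : MvPowerSeries (Fin n) k) :
    opD i * opC c = opC c * opD i + opC (MvPowerSeries.pderiv k i c) * opH :=
  end_ext fun β j d => by
    simp [smul_mono, add_assoc, mono_add, mul_comm d]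

theorem opD_opD (i j : Fin n) : opD i * opD j = opD j * opD (k := k) i :=
  end_ext fun β l d => by
    simp only [end_mul_apply, opD_mono, map_add, pderiv_comm i j]
    rw [add_right_comm β]
    abel

theorem opH_opMono (β : Fin n →₀ ℕ) (j : ℕ) :
    opH * opMono β j = opMono (k := k) β (j + 1) := by
  have h : Commute (opH (k := k) (n := n)) ((List.finRange n).map fun i => opD i ^ β i).prod :=
    Commute.list_prod_right _ _ fun x hx => by
      obtain ⟨i, -, rfl⟩ := List.mem_map.1 hx
      exact Commute.pow_right (opD_opH i).symm _
  rw [opMono, opMono, ← mul_assoc, h.eq, mul_assoc, pow_succ']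

theorem opD_list (i : Fin n) (β : Fin n →₀ ℕ) (l : List (Fin n)) (hl : l.Nodup) :
    (l.map fun r => opD (k := k) r ^ (β + Finsupp.single i 1 : Fin n →₀ ℕ) r).prod =
      if i ∈ l then opD i * (l.map fun r => opD r ^ β r).prod
      else (l.map fun r => opD r ^ β r).prod := by
  induction l with
  | nil => simp
  | cons a l ih =>
    rw [List.nodup_cons] at hl
    rw [List.map_cons, List.prod_cons, ih hl.2, List.map_cons, List.prod_cons]
    by_cases h : i = a
    · subst h
      simp [hl.1, pow_succ', mul_assoc]
    · have hc : Commute (opD (k := k) a ^ β a) (opD i) := Commute.pow_left (opD_opD a i) _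
      by_cases h' : i ∈ l
      · simp [h, h', ← mul_assoc, hc.eq]
      · simp [h, h']

theorem opD_opMono (i : Fin n) (β : Fin n →₀ ℕ) (j : ℕ) :
    opD i * opMono β j = opMono (k := k) (β + Finsupp.single i 1) j := by
  rw [opMono, opMono, opD_list i β _ (List.nodup_finRange n), if_pos (List.mem_finRange i),
    mul_assoc]

/-- `E` is a left multiplication. -/
def IsLeft (E : AddMonoid.End (HDiff k n)) : Prop := ∀ P, op (E P) = E * op P

theorem isLeft_iff (E : AddMonoid.End (HDiff k n))
    (h : ∀ β j c, op (E (mono β j c)) = E * (opC c * opMono β j)) : IsLeft E := by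
  intro P
  induction P using induction with
  | zero => simp
  | mono β j c => rw [h, op_mono]
  | add P Q hP hQ => rw [map_add, map_add, map_add, hP, hQ, mul_add]

theorem isLeft_mul {E F : AddMonoid.End (HDiff k n)} (hE : IsLeft E) (hF : IsLeft F) :
    IsLeft (E * F) := fun P => by
  rw [end_mul_apply, hE, hF, mul_assoc]

theorem isLeft_one : IsLeft (1 : AddMonoid.End (HDiff k n)) := fun P => by simp

theorem isLeft_pow {E : AddMonoid.End (HDiff k n)} (hE : IsLeft E) (m : ℕ) : IsLeft (E ^ m) := by
  induction m with
  | zero => rw [pow_zero]; exact isLeft_one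
  | succ m ih => rw [pow_succ]; exact isLeft_mul ih hE

theorem isLeft_opC (c : MvPowerSeries (Fin n) k) : IsLeft (opC c) :=
  isLeft_iff _ fun β j d => by
    ext P : 1
    simp [smul_mono, mul_smul]

theorem isLeft_opH : IsLeft (opH : AddMonoid.End (HDiff k n)) :=
  isLeft_iff _ fun β j d => by
    rw [opH_mono, op_mono, ← opH_opMono, ← mul_assoc, ← mul_assoc, opH_opC]

theorem isLeft_opD (i : Fin n) : IsLeft (opD i : AddMonoid.End (HDiff k n)) :=
  isLeft_iff _ fun β j d => by
    rw [opD_mono, map_add, op_mono, op_mono, ← opH_opMono, ← opD_opMono, ← mul_assoc, ← mul_assoc,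
      ← mul_assoc, opD_opC, add_mul]

theorem isLeft_opMono (β : Fin n →₀ ℕ) (j : ℕ) :
    IsLeft (opMono β j : AddMonoid.End (HDiff k n)) := by
  refine isLeft_mul ?_ (isLeft_pow isLeft_opH j)
  generalize List.finRange n = l
  induction l with
  | nil => simpa using isLeft_one
  | cons a l ih =>
    rw [List.map_cons, List.prod_cons]
    exact isLeft_mul (isLeft_pow (isLeft_opD a) _) ih

theorem isLeft_op (P : HDiff k n) : IsLeft (op P) := by
  induction P using induction with
  | zero => intro Q; simp
  | mono β j c => rw [op_mono]; exact isLeft_mul (isLeft_opC c) (isLeft_opMono β j)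
  | add P Q hP hQ => intro R; rw [map_add, end_add_apply, map_add, hP, hQ, add_mul]

theorem opMono_one (β : Fin n →₀ ℕ) (j : ℕ) : opMono β j (1 : HDiff k n) = mono β j 1 := by
  have hH : ∀ j : ℕ, opMono 0 j (1 : HDiff k n) = mono 0 j 1 := by
    intro j
    induction j with
    | zero => simp [opMono, one_def]
    | succ j ih => rw [← opH_opMono, end_mul_apply, ih, opH_mono]
  induction β using Finsupp.induction_linear generalizing j with
  | zero => exact hH j
  | add f g hf hg =>
    clear hf
    induction f using Finsupp.induction generalizing j with
    | zero => simpa using hg j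
    | single_add a b f _ _ ih =>
      rw [add_assoc]
      clear * - ih
      induction b generalizing j with
      | zero => simpa using ih j
      | succ b ihb =>
        have : Finsupp.single a (b + 1) + (f + g) =
            (Finsupp.single a b + (f + g)) + Finsupp.single a 1 := by
          rw [Finsupp.single_add]; abel
        rw [this, ← opD_opMono, end_mul_apply, ihb, opD_mono]
        have h1 : MvPowerSeries.pderiv k a 1 = 0 := Derivation.map_one_eq_zero _
        rw [h1, mono_zero, add_zero]
  | single a b =>
    induction b generalizing j with
    | zero => simpa using hH j
    | succ b ihb =>
      rw [Finsupp.single_add, ← opD_opMono, end_mul_apply, ihb, opD_mono]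
      have h1 : MvPowerSeries.pderiv k a 1 = 0 := Derivation.map_one_eq_zero _
      rw [h1, mono_zero, add_zero]

theorem mul_one' (P : HDiff k n) : P * 1 = P := by
  rw [mul_def]
  induction P using induction with
  | zero => simp
  | mono β j c => simp [opMono_one, smul_mono]
  | add P Q hP hQ => rw [map_add, end_add_apply, hP, hQ]

instance : Ring (HDiff k n) :=
  { (inferInstance : AddCommGroup (HDiff k n)) with
    mul := (· * ·)
    one := 1
    mul_assoc := fun P Q R => by
      simp only [mul_def, isLeft_op P Q, end_mul_apply]
    one_mul := fun P => by
      rw [mul_def, one_def, op_mono]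
      simp [opMono]
    mul_one := mul_one'
    left_distrib := fun P Q R => by simp only [mul_def, map_add]
    right_distrib := fun P Q R => by simp only [mul_def, map_add, end_add_apply]
    zero_mul := fun P => by simp [mul_def]
    mul_zero := fun P => by simp [mul_def] }

/-- The power series `c(x)` as an element of the ring. -/
def ofSeries (c : MvPowerSeries (Fin n) k) : HDiff k n := mono 0 0 c

/-- The derivation `∂_i` as an element of the ring. -/
def del (i : Fin n) : HDiff k n := mono (Finsupp.single i 1) 0 1

/-- The variable `h` as an element of the ring. -/
def hvar : HDiff k n := mono 0 1 1

theorem op_ofSeries (c : MvPowerSeries (Fin n) k) : op (ofSeries c) = opC c := by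
  simp [ofSeries, opMono]

theorem op_hvar : op (hvar : HDiff k n) = opH := by
  ext P : 1
  simp [hvar, opMono]

theorem op_del (i : Fin n) : op (del i : HDiff k n) = opD i := by
  have := opD_opMono (k := k) i 0 0
  rw [zero_add] at this
  ext P : 1
  simp only [del, op_mono, ← this]
  simp [opMono]

/-- The defining commutation relation `∂_i c(x) - c(x) ∂_i = (∂c/∂x_i) h`. -/
theorem del_mul_ofSeries (i : Fin n) (c : MvPowerSeries (Fin n) k) :
    del i * ofSeries c - ofSeries c * del i = ofSeries (MvPowerSeries.pderiv k i c) * hvar := by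
  rw [mul_def, mul_def, mul_def, op_del, op_ofSeries, op_ofSeries]
  simp [ofSeries, del, hvar, smul_mono]

theorem del_mul_del (i j : Fin n) : (del i * del j : HDiff k n) = del j * del i := by
  have h := congrArg (fun E => E (1 : HDiff k n)) (opD_opD (k := k) i j)
  simpa only [← op_del, end_mul_apply, ← mul_def, mul_one] using h

theorem ofSeries_mul (c d : MvPowerSeries (Fin n) k) :
    ofSeries (c * d) = ofSeries c * ofSeries d := by
  rw [mul_def, op_ofSeries]
  simp [ofSeries, smul_mono]

/-- `h` is central. -/
theorem hvar_mul (P : HDiff k n) : hvar * P = P * hvar := by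
  rw [mul_def, mul_def, op_hvar]
  induction P using induction with
  | zero => simp
  | mono β j c =>
    have : opMono (k := k) β j hvar = mono β (j + 1) 1 := by
      have h1 : (hvar : HDiff k n) = opH 1 := by simp [hvar, one_def]
      have h2 : opMono (k := k) β j * opH = opH * opMono β j := by
        rw [opH_opMono, opMono, opMono, mul_assoc, ← pow_succ]
      rw [h1, ← end_mul_apply, h2, opH_opMono, opMono_one]
    simp [this, smul_mono]
  | add P Q hP hQ => rw [map_add, map_add, end_add_apply, hP, hQ]

/-- `mono β j c` is the product `c(x) ∂_1^{β_1} ⋯ ∂_n^{β_n} h^j`. -/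
theorem mono_eq (β : Fin n →₀ ℕ) (j : ℕ) (c : MvPowerSeries (Fin n) k) :
    mono β j c = ofSeries c * (((List.finRange n).map fun i => del i ^ β i).prod * hvar ^ j) := by
  have key : ∀ P : HDiff k n, ∀ E, op P = E → ∀ m : ℕ, op (P ^ m) = E ^ m := by
    intro P E h m
    induction m with
    | zero => rw [pow_zero, pow_zero]; ext Q : 1; exact one_mul Q
    | succ m ih => rw [pow_succ, pow_succ, mul_def, isLeft_op, ih, h]
  have : op (((List.finRange n).map fun i => (del i : HDiff k n) ^ β i).prod * hvar ^ j) =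
      opMono β j := by
    rw [mul_def, isLeft_op, key _ _ op_hvar, opMono]
    congr 1
    generalize List.finRange n = l
    induction l with
    | nil => ext Q : 1; exact one_mul Q
    | cons a l ih =>
      rw [List.map_cons, List.prod_cons, mul_def, isLeft_op, ih, key _ _ (op_del a),
        List.map_cons, List.prod_cons]
  rw [← mul_one (((List.finRange n).map fun i => (del i : HDiff k n) ^ β i).prod * hvar ^ j),
    mul_def _ 1, this, opMono_one, mul_def, op_ofSeries, opC_apply, smul_mono, mul_one]

/-! ### The homogenized ring of analytic differential operators -/

/-- A complex power series is convergent if it converges absolutely on some polydisc. -/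
def IsConvergent (c : MvPowerSeries (Fin n) ℂ) : Prop :=
  ∃ r : ℝ, 0 < r ∧ Summable fun α : Fin n →₀ ℕ => ‖MvPowerSeries.coeff α c‖ * r ^ α.degree

theorem IsConvergent.mono_radius {c : MvPowerSeries (Fin n) ℂ} {r s : ℝ} (hs : 0 < s)
    (hsr : s ≤ r)
    (h : Summable fun α : Fin n →₀ ℕ => ‖MvPowerSeries.coeff α c‖ * r ^ α.degree) :
    Summable fun α : Fin n →₀ ℕ => ‖MvPowerSeries.coeff α c‖ * s ^ α.degree :=
  Summable.of_nonneg_of_le (fun α => by positivity) (fun α => by gcongr) h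

theorem isConvergent_zero : IsConvergent (0 : MvPowerSeries (Fin n) ℂ) :=
  ⟨1, one_pos, by simp⟩

theorem isConvergent_one : IsConvergent (1 : MvPowerSeries (Fin n) ℂ) := by
  classical
  refine ⟨1, one_pos, summable_of_ne_finset_zero (s := {0}) fun α hα => ?_⟩
  have : α ≠ 0 := by simpa using hα
  simp [MvPowerSeries.coeff_one, this]

theorem IsConvergent.neg {c : MvPowerSeries (Fin n) ℂ} (hc : IsConvergent c) :
    IsConvergent (-c) := by
  obtain ⟨r, hr, h⟩ := hc
  exact ⟨r, hr, by simpa using h⟩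

theorem IsConvergent.add {c d : MvPowerSeries (Fin n) ℂ} (hc : IsConvergent c)
    (hd : IsConvergent d) : IsConvergent (c + d) := by
  obtain ⟨r, hr, h⟩ := hc
  obtain ⟨s, hs, h'⟩ := hd
  have ht : 0 < min r s := lt_min hr hs
  refine ⟨min r s, ht, Summable.of_nonneg_of_le (fun α => by positivity) (fun α => ?_)
    ((mono_radius ht (min_le_left r s) h).add (mono_radius ht (min_le_right r s) h'))⟩
  rw [← add_mul, map_add]
  gcongr
  exact norm_add_le _ _

theorem summable_antidiagonal {f g : (Fin n →₀ ℕ) → ℝ} (hf : Summable f) (hg : Summable g)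
    (hf0 : ∀ α, 0 ≤ f α) (hg0 : ∀ α, 0 ≤ g α) :
    Summable fun α => ∑ p ∈ Finset.HasAntidiagonal.antidiagonal α, f p.1 * g p.2 :=
  summable_sum_mul_antidiagonal_of_summable_mul
    (Summable.mul_of_nonneg hf hg (Pi.le_def.2 hf0) (Pi.le_def.2 hg0))

theorem IsConvergent.mul {c d : MvPowerSeries (Fin n) ℂ} (hc : IsConvergent c)
    (hd : IsConvergent d) : IsConvergent (c * d) := by
  obtain ⟨t, ht, h1, h2⟩ : ∃ t : ℝ, 0 < t ∧
      (Summable fun α : Fin n →₀ ℕ => ‖MvPowerSeries.coeff α c‖ * t ^ α.degree) ∧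
      Summable fun α : Fin n →₀ ℕ => ‖MvPowerSeries.coeff α d‖ * t ^ α.degree := by
    obtain ⟨r, hr, h⟩ := hc
    obtain ⟨s, hs, h'⟩ := hd
    have ht : 0 < min r s := lt_min hr hs
    exact ⟨min r s, ht, mono_radius ht (min_le_left r s) h, mono_radius ht (min_le_right r s) h'⟩
  have hnn : ∀ (e : MvPowerSeries (Fin n) ℂ) (α : Fin n →₀ ℕ),
      0 ≤ ‖MvPowerSeries.coeff α e‖ * t ^ α.degree :=
    fun e α => mul_nonneg (norm_nonneg _) (pow_nonneg ht.le _)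
  have h3 := summable_antidiagonal h1 h2 (hnn c) (hnn d)
  refine ⟨t, ht, Summable.of_nonneg_of_le
    (fun α => mul_nonneg (norm_nonneg _) (pow_nonneg ht.le _)) (fun α => ?_) h3⟩
  rw [MvPowerSeries.coeff_mul]
  calc ‖∑ p ∈ Finset.HasAntidiagonal.antidiagonal α,
        MvPowerSeries.coeff p.1 c * MvPowerSeries.coeff p.2 d‖ * t ^ α.degree
      ≤ (∑ p ∈ Finset.HasAntidiagonal.antidiagonal α,
        ‖MvPowerSeries.coeff p.1 c * MvPowerSeries.coeff p.2 d‖) * t ^ α.degree :=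
        mul_le_mul_of_nonneg_right (norm_sum_le _ _) (pow_nonneg ht.le _)
    _ = ∑ p ∈ Finset.HasAntidiagonal.antidiagonal α,
      (‖MvPowerSeries.coeff p.1 c‖ * t ^ p.1.degree) *
        (‖MvPowerSeries.coeff p.2 d‖ * t ^ p.2.degree) := by
      rw [Finset.sum_mul]
      refine Finset.sum_congr rfl fun p hp => ?_
      have hp' : α = p.1 + p.2 := (Finset.HasAntidiagonal.mem_antidiagonal.1 hp).symm
      have hd : α.degree = p.1.degree + p.2.degree := by rw [hp', map_add]
      rw [hd, pow_add, norm_mul]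
      ring

theorem IsConvergent.pderiv {c : MvPowerSeries (Fin n) ℂ} (hc : IsConvergent c) (i : Fin n) :
    IsConvergent (MvPowerSeries.pderiv ℂ i c) := by
  obtain ⟨r, hr, h⟩ := hc
  have hinj : Function.Injective fun α : Fin n →₀ ℕ => α + Finsupp.single i 1 :=
    add_left_injective _
  refine ⟨r / 2, by positivity, Summable.of_nonneg_of_le (fun α => by positivity) (fun α => ?_)
    ((h.comp_injective hinj).mul_left r⁻¹)⟩
  have hdeg : (α + Finsupp.single i 1).degree = α.degree + 1 := by simp
  have hle : α i ≤ α.degree := Finsupp.le_degree i α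
  have h2 : ((α i : ℝ) + 1) ≤ 2 ^ α.degree := by
    have : α i + 1 ≤ 2 ^ α.degree :=
      (Nat.succ_le_succ hle).trans (Nat.succ_le_of_lt Nat.lt_two_pow_self)
    exact_mod_cast this
  have h3 : ‖(α i : ℂ) + 1‖ = (α i : ℝ) + 1 := by
    rw [← Nat.cast_add_one, Complex.norm_natCast, Nat.cast_add_one]
  simp only [Function.comp_apply]
  rw [MvPowerSeries.coeff_pderiv, norm_mul, h3, hdeg, pow_succ, div_pow]
  have h4 : ((α i : ℝ) + 1) * (r ^ α.degree / 2 ^ α.degree) ≤ r ^ α.degree := by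
    rw [mul_div_assoc', div_le_iff₀ (by positivity), mul_comm]
    gcongr
  calc _ = ‖MvPowerSeries.coeff (α + Finsupp.single i 1) c‖ *
        (((α i : ℝ) + 1) * (r ^ α.degree / 2 ^ α.degree)) := by ring
    _ ≤ ‖MvPowerSeries.coeff (α + Finsupp.single i 1) c‖ * r ^ α.degree := by gcongr
    _ = _ := by field_simp

/-- All coefficients are convergent power series. -/
def IsAnalytic (P : HDiff ℂ n) : Prop := ∀ β j, IsConvergent (P.coef β j)

theorem isAnalytic_mono (β : Fin n →₀ ℕ) (j : ℕ) {c : MvPowerSeries (Fin n) ℂ}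
    (hc : IsConvergent c) : IsAnalytic (mono β j c) := fun γ l => by
  rw [coef_mono]
  split_ifs
  · exact hc
  · exact isConvergent_zero

theorem IsAnalytic.add {P Q : HDiff ℂ n} (hP : IsAnalytic P) (hQ : IsAnalytic Q) :
    IsAnalytic (P + Q) := fun β j => (hP β j).add (hQ β j)

theorem IsAnalytic.induction {p : HDiff ℂ n → Prop} {P : HDiff ℂ n} (hP : IsAnalytic P)
    (zero : p 0) (mono : ∀ β j c, IsConvergent c → p (mono β j c))
    (add : ∀ P Q, p P → p Q → p (P + Q)) : p P := by
  classical
  have : P = ∑ m ∈ P.coeffs.support,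
      HDiff.mono m.1 m.2 (P.coef m.1 m.2) :=
    (Finsupp.sum_single (M := MvPowerSeries (Fin n) ℂ) P).symm
  rw [this]
  exact Finset.sum_induction _ p (fun P Q => add P Q) zero fun m _ => mono _ _ _ (hP _ _)

theorem IsAnalytic.op_apply {P Q : HDiff ℂ n} (hP : IsAnalytic P) (hQ : IsAnalytic Q) :
    IsAnalytic (op P Q) := by
  have z : IsAnalytic (0 : HDiff ℂ n) := fun _ _ => isConvergent_zero
  have hH : ∀ Q : HDiff ℂ n, IsAnalytic Q → IsAnalytic (opH Q) := fun Q hQ =>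
    hQ.induction (p := fun Q => IsAnalytic (opH Q)) (by simpa using z)
      (fun β j c hc => by rw [opH_mono]; exact isAnalytic_mono _ _ hc)
      (fun P Q hP hQ => by rw [map_add]; exact hP.add hQ)
  have hD : ∀ (i : Fin n) (Q : HDiff ℂ n), IsAnalytic Q → IsAnalytic (opD i Q) := fun i Q hQ =>
    hQ.induction (p := fun Q => IsAnalytic (opD i Q)) (by simpa using z)
      (fun β j c hc => by
        rw [opD_mono]; exact (isAnalytic_mono _ _ hc).add (isAnalytic_mono _ _ (hc.pderiv i)))
      (fun P Q hP hQ => by rw [map_add]; exact hP.add hQ)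
  have hpow : ∀ (E : AddMonoid.End (HDiff ℂ n)), (∀ Q, IsAnalytic Q → IsAnalytic (E Q)) →
      ∀ (m : ℕ) Q, IsAnalytic Q → IsAnalytic ((E ^ m) Q) := by
    intro E hE m
    induction m with
    | zero => intro Q hQ; simpa using hQ
    | succ m ih => intro Q hQ; rw [pow_succ, end_mul_apply]; exact ih _ (hE _ hQ)
  refine hP.induction (p := fun P => IsAnalytic (op P Q)) (by simpa using z)
    (fun β j c hc => ?_) (fun P Q hP hQ => by rw [map_add, end_add_apply]; exact hP.add hQ)
  rw [op_mono, end_mul_apply, opC_apply]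
  suffices h : IsAnalytic (opMono β j Q) from fun γ l => by
    rw [coef_smul]; exact hc.mul (h γ l)
  rw [opMono, end_mul_apply]
  generalize (opH ^ j) Q = R, hpow opH hH j Q hQ = hR
  generalize List.finRange n = l
  induction l with
  | nil => simpa using hR
  | cons a l ih =>
    rw [List.map_cons, List.prod_cons, end_mul_apply]
    exact hpow _ (hD a) _ _ ih

variable (n) in
/-- The homogenized ring `h_(0,1)(D_0)` of analytic differential operators: the subring of the
`P = ∑ c_{β,j}(x) ∂^β h^j` all of whose coefficients are in `ℂ{x_1, …, x_n}`. -/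
def analytic : Subring (HDiff ℂ n) where
  carrier := {P | IsAnalytic P}
  mul_mem' := fun hP hQ => hP.op_apply hQ
  one_mem' := isAnalytic_mono _ _ isConvergent_one
  add_mem' := fun hP hQ => hP.add hQ
  zero_mem' := fun _ _ => isConvergent_zero
  neg_mem' := fun hP β j => (hP β j).neg

/-! ### Homogeneous elements and ideals -/

/-- `P` is homogeneous: `|β| + j` is constant on the exponents `(α, β, j)` of `P`. -/
def IsHomogeneous (P : HDiff k n) : Prop :=
  ∃ d : ℕ, ∀ β j, P.coef β j ≠ 0 → β.degree + j = d

/-! ### Filtration and graded ring of a weight vector -/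

/-- The weight `(u, v) · (α, β)` of `x^α ∂^β h^j`; the variable `h` has weight `0`. -/
def weight (w : WeightSpace n) (α β : Fin n →₀ ℕ) : ℝ :=
  ∑ i, w.1 i * α i + ∑ i, w.2 i * β i

/-- `ord^w(P) ≤ c`, i.e. `P` lies in the piece `F_c` of the filtration defined by `w`. -/
def OrdLE (w : WeightSpace n) (c : ℝ) (P : HDiff k n) : Prop :=
  ∀ α β j, MvPowerSeries.coeff α (P.coef β j) ≠ 0 → weight w α β ≤ c

/-- The part of `P` of weight exactly `c`. For `P ∈ F_c`, it is the canonical representative of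
the class of `P` in `F_c / F_{<c}`. -/
def part (w : WeightSpace n) (c : ℝ) (P : HDiff k n) : HDiff k n :=
  open scoped Classical in
  (Finsupp.onFinset P.coeffs.support
    (fun m α => if weight w α m.1 = c then MvPowerSeries.coeff α (P.coef m.1 m.2) else 0)
    (fun m hm => by
      rw [Finsupp.mem_support_iff]
      intro h0
      refine hm (funext fun α => ?_)
      have : P.coef m.1 m.2 = 0 := h0
      simp only [this, map_zero, ite_self]
      rfl) : ((Fin n →₀ ℕ) × ℕ) →₀ MvPowerSeries (Fin n) k)

open scoped Classical in
theorem coeff_part (w : WeightSpace n) (c : ℝ) (P : HDiff k n) (α β : Fin n →₀ ℕ) (j : ℕ) :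
    MvPowerSeries.coeff α ((part w c P).coef β j) =
      if weight w α β = c then MvPowerSeries.coeff α (P.coef β j) else 0 := rfl

/-- For a subset `A` of the ring (a subring or an ideal), the graded group
`⨁_c (A ∩ F_c) / (A ∩ F_{<c})` attached to `w`, its classes being represented by their parts of
weight `c`. For `A` a subring this is the underlying group of the graded ring `gr^w(A)`;
for `A = I` an ideal it is the graded ideal `in_w(I)` of the graded ring, generated as a group by
the initial forms `in_w(P)`, `P ∈ I`. -/
def gr (w : WeightSpace n) (A : Set (HDiff k n)) : AddSubgroup (HDiff k n) :=
  AddSubgroup.closure {S | ∃ P ∈ A, ∃ c, OrdLE w c P ∧ S = part w c P}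

/-- The product of the graded ring `gr^w`: it is biadditive, and the product of the class of `P`
in `F_c / F_{<c}` and the class of `Q` in `F_d / F_{<d}` is the class of `P * Q` in
`F_{c+d} / F_{<c+d}`. (Elements of `gr^w` have finitely many nonzero parts.) -/
def grMul (w : WeightSpace n) (S T : HDiff k n) : HDiff k n :=
  ∑ᶠ p : ℝ × ℝ, part w (p.1 + p.2) (part w p.1 S * part w p.2 T)

/-- The rings `gr^w(R)` and `gr^{w'}(R)` are equal: same elements and same product. -/
def SameGr (R : Set (HDiff k n)) (w w' : WeightSpace n) : Prop :=
  gr w R = gr w' R ∧ ∀ S ∈ gr w R, ∀ T ∈ gr w R, grMul w S T = grMul w' S T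

end HDiff

open HDiff

/-- The local weight vectors `w = (u, v)`: `u_i ≤ 0` and `u_i + v_i ≥ 0` for all `i`. -/
def Wloc (n : ℕ) : Set (WeightSpace n) := {w | ∀ i, w.1 i ≤ 0 ∧ 0 ≤ w.1 i + w.2 i}

/-- The (open) Gröbner cone `C_I[w]` of an ideal `I` of the ring `R`. -/
def groebnerCone {k : Type*} [Field k] {n : ℕ} (R I : Set (HDiff k n)) (w : WeightSpace n) :
    Set (WeightSpace n) :=
  {w' | w' ∈ Wloc n ∧ SameGr R w w' ∧ gr w I = gr w' I}

/-- The closed Gröbner fan of the ideal `I` of the ring `R` over the local weight vectors. -/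
def closedGroebnerFan {k : Type*} [Field k] {n : ℕ} (R I : Set (HDiff k n)) :
    Set (Set (WeightSpace n)) :=
  {C | ∃ w ∈ Wloc n, C = closure (groebnerCone R I w)}

/-- A left ideal of a (sub)ring is homogeneous if it can be generated by homogeneous elements;
`f` is the inclusion of the ring into the homogenized ring of formal differential operators. -/
def IsHomogeneousIdeal {k : Type*} [Field k] {n : ℕ} {R : Type*} [Ring R]
    (f : R → HDiff k n) (I : Ideal R) : Prop :=
  ∃ G : Set R, (∀ P ∈ G, IsHomogeneous (f P)) ∧ I = Ideal.span G

/-! ### Polyhedral fans -/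

section Fans

variable {V : Type*} [AddCommGroup V] [Module ℝ V]

/-- A polyhedral cone: a finite intersection of closed linear half-spaces. -/
def IsPolyhedralCone (C : Set V) : Prop :=
  ∃ s : Finset (V →ₗ[ℝ] ℝ), C = {x | ∀ l ∈ s, l x ≤ 0}

/-- The faces of a cone `C`: the intersections of `C` with its supporting hyperplanes through the
origin, including `C` itself. -/
def IsConeFace (F C : Set V) : Prop :=
  ∃ l : V →ₗ[ℝ] ℝ, (∀ x ∈ C, l x ≤ 0) ∧ F = {x | x ∈ C ∧ l x = 0}

/-- A polyhedral fan: a finite collection of polyhedral cones, containing every face of its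
members, such that the intersection of any two members is a face of both. -/
structure IsPolyhedralFan (𝓕 : Set (Set V)) : Prop where
  finite : 𝓕.Finite
  cone : ∀ C ∈ 𝓕, IsPolyhedralCone C
  face : ∀ C ∈ 𝓕, ∀ F, IsConeFace F C → F ∈ 𝓕
  inter : ∀ C ∈ 𝓕, ∀ C' ∈ 𝓕, IsConeFace (C ∩ C') C ∧ IsConeFace (C ∩ C') C'

/-- The restriction of a collection of cones to a linear subspace. -/
def restrictFan (𝓕 : Set (Set V)) (L : Submodule ℝ V) : Set (Set V) :=
  {C | ∃ C' ∈ 𝓕, C = C' ∩ L}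

end Fans

/-- A rational polyhedral cone in `ℝ^n × ℝ^n`: it is defined by finitely many homogeneous linear
inequalities with integer coefficients. -/
def IsRationalCone {n : ℕ} (C : Set (WeightSpace n)) : Prop :=
  ∃ s : Finset ((Fin n → ℤ) × (Fin n → ℤ)),
    C = {w | ∀ a ∈ s, ∑ i, (a.1 i : ℝ) * w.1 i + ∑ i, (a.2 i : ℝ) * w.2 i ≤ 0}

end

/-! ### Fans glued from polyhedral cones -/

/-! Call a weight `ω` generic if `u_i < 0 < u_i + v_i` for all `i` and no nonzero integral linear
functional vanishes on it. In a fixed degree `|β| + j`, only finitely many monomials lie above a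
given one for such an `ω` (`finite_above`). So nonzero homogeneous operators have leading monomials,
although the order admits infinite descending chains. Let `E = leadSet ω I`. In a fixed degree the
ring is a finite free module over the power series, and division by elements with leading monomials
in `E` is a recursion on coefficients (`exists_division`). It yields, for each `m ∈ E`, the unique
homogeneous `g_m ∈ I` in which `m` has coefficient one and no other monomial of `E` occurs.

The cell of `E` consists of the local weights that do not increase from `m` to the other monomials
of `g_m`, for any `m ∈ E`. On the cell, `in_w(I)` is described by the initial forms of the `g_m`
(`IsRedSystem.mem_gr_iff`). Hence, among weights with equal graded rings, it amounts to the pattern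
of equalities between the weights of `m` and of the monomials of `g_m` (`IsRedSystem.gr_eq_iff`).
The graded ring itself records exactly which `u_i` and `u_i + v_i` vanish (`Admissible.sameGr_iff`).
So the Gröbner cone of a point of the cell is the set of points of the cell where the same defining
inequalities are equalities. Finitely many integral inequalities suffice
(`IsRedSystem.exists_finset`): the division can be run with all exponent differences confined to a
finitely generated monoid `𝓜`. The cell is thus a rational polyhedral cone, and the Gröbner cones
that meet it are the relative interiors of its faces.

Only finitely many sets `E` occur (`finite_leadSets`) and generic weights are dense in `Wloc`, so
the closed cells cover `Wloc`. The Gröbner cone of `w` does not refer to a cell; hence two cells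
containing `w` have the same smallest face through `w`. This is the gluing condition of
`isPolyhedralFan_coneFaceOf`, which also handles restrictions to subspaces.

The two rings enter only through `Admissible` and `DivStable`. For convergent series the latter is a
contraction estimate: in the norm `∑ |c_m| exp (σ ω(m))` with `σ` large, the tail of each divisor
has at most half the norm of its leading term. -/

section Gluing

variable {V : Type*} [AddCommGroup V] [Module ℝ V]

/-- The polyhedral cone defined by a finite set of functionals. -/
def halfspaceCone (Λ : Finset (V →ₗ[ℝ] ℝ)) : Set V := {x | ∀ l ∈ Λ, l x ≤ 0}

/-- The smallest face of `halfspaceCone Λ` that contains `w`. -/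
def coneFaceOf (Λ : Finset (V →ₗ[ℝ] ℝ)) (w : V) : Set V :=
  {x | (∀ l ∈ Λ, l x ≤ 0) ∧ ∀ l ∈ Λ, l w = 0 → l x = 0}

/-- The relative interior of the smallest face of `halfspaceCone Λ` that contains `w`. -/
def openFaceOf (Λ : Finset (V →ₗ[ℝ] ℝ)) (w : V) : Set V :=
  {x | (∀ l ∈ Λ, l x ≤ 0) ∧ ∀ l ∈ Λ, (l w = 0 ↔ l x = 0)}

theorem coneFaceOf_subset {Λ : Finset (V →ₗ[ℝ] ℝ)} {w w' : V} (h : w' ∈ coneFaceOf Λ w) :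
    coneFaceOf Λ w' ⊆ coneFaceOf Λ w :=
  fun _ hx => ⟨hx.1, fun l hl h0 => hx.2 l hl (h.2 l hl h0)⟩

theorem mem_coneFaceOf_self {Λ : Finset (V →ₗ[ℝ] ℝ)} {w : V} (h : w ∈ halfspaceCone Λ) :
    w ∈ coneFaceOf Λ w := ⟨h, fun _ _ h => h⟩

theorem zero_mem_coneFaceOf (Λ : Finset (V →ₗ[ℝ] ℝ)) (w : V) : (0 : V) ∈ coneFaceOf Λ w :=
  ⟨fun l _ => by simp, fun l _ _ => by simp⟩

theorem add_mem_coneFaceOf {Λ : Finset (V →ₗ[ℝ] ℝ)} {w x y : V} (hx : x ∈ coneFaceOf Λ w)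
    (hy : y ∈ coneFaceOf Λ w) : x + y ∈ coneFaceOf Λ w :=
  ⟨fun l hl => by rw [map_add]; exact add_nonpos (hx.1 l hl) (hy.1 l hl),
    fun l hl h => by rw [map_add, hx.2 l hl h, hy.2 l hl h, add_zero]⟩

/-- A cone inside `halfspaceCone Λ` has a point on which only those functionals of `Λ` vanish that
vanish on the whole cone. -/
theorem exists_generic_point (Λ : Finset (V →ₗ[ℝ] ℝ)) (D : Set V) (h0 : (0 : V) ∈ D)
    (hadd : ∀ x ∈ D, ∀ y ∈ D, x + y ∈ D) (hD : D ⊆ halfspaceCone Λ) :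
    ∃ w ∈ D, ∀ l ∈ Λ, l w = 0 → ∀ x ∈ D, l x = 0 := by
  classical
  induction Λ using Finset.induction_on with
  | empty => exact ⟨0, h0, by simp⟩
  | insert a Λ _ ih =>
    obtain ⟨w, hw, h⟩ := ih fun x hx l hl => hD hx l (Finset.mem_insert_of_mem hl)
    by_cases ha : ∀ x ∈ D, a x = 0
    · refine ⟨w, hw, fun l hl h1 => ?_⟩
      rcases Finset.mem_insert.1 hl with rfl | hl
      · exact ha
      · exact h l hl h1
    · push Not at ha
      obtain ⟨x, hx, hax⟩ := ha
      have hle : ∀ y ∈ D, ∀ l ∈ insert a Λ, l y ≤ 0 := fun y hy l hl => hD hy l hl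
      -- All functionals are nonpositive on `D`, so `l (w + x) = 0` forces both `l w = 0` and `l x =
      -- 0`.
      refine ⟨w + x, hadd _ hw _ hx, fun l hl h1 => ?_⟩
      rw [map_add] at h1
      have h2 := hle w hw l hl
      have h3 := hle x hx l hl
      rcases Finset.mem_insert.1 hl with rfl | hl
      · exact absurd (by linarith) hax
      · exact h l hl (by linarith)

/-- A point is relatively interior to its smallest face: functionals that are negative at `w` leave
room, and those that vanish at `w` vanish at `x`. -/
theorem mem_of_small_sub {Λ : Finset (V →ₗ[ℝ] ℝ)} {w x : V} (hw : w ∈ halfspaceCone Λ)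
    (hx : x ∈ coneFaceOf Λ w) : ∃ ε : ℝ, 0 < ε ∧ w - ε • x ∈ halfspaceCone Λ := by
  classical
  suffices h : ∀ Λ' ⊆ Λ, ∃ ε : ℝ, 0 < ε ∧ ∀ l ∈ Λ', l w - ε * l x ≤ 0 by
    obtain ⟨ε, hε, h⟩ := h Λ subset_rfl
    exact ⟨ε, hε, fun l hl => by simpa using h l hl⟩
  intro Λ'
  induction Λ' using Finset.induction_on with
  | empty => exact fun _ => ⟨1, one_pos, by simp⟩
  | insert a Λ' _ ih =>
    intro hs
    obtain ⟨ε, hε, h⟩ := ih fun l hl => hs (Finset.mem_insert_of_mem hl)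
    have ha : a ∈ Λ := hs (Finset.mem_insert_self _ _)
    rcases (hw a ha).lt_or_eq with h1 | h1
    · have hx1 := hx.1 a ha
      have h2 : 0 < 1 - a x := by linarith
      have h3 : 0 < -a w / (1 - a x) := div_pos (by linarith) h2
      -- The denominator `1 - a x` is positive even when `a x = 0`, unlike `-a x`.
      refine ⟨min ε (-a w / (1 - a x)), lt_min hε h3, fun l hl => ?_⟩
      rcases Finset.mem_insert.1 hl with rfl | hl
      · have h4 : min ε (-l w / (1 - l x)) * (1 - l x) ≤ -l w := by
          rw [← le_div_iff₀ h2]; exact min_le_right _ _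
        have h5 : 0 < min ε (-l w / (1 - l x)) := lt_min hε h3
        nlinarith
      · have h4 := hx.1 l (hs (Finset.mem_insert_of_mem hl))
        have h5 := h l hl
        have h6 : min ε (-a w / (1 - a x)) ≤ ε := min_le_left _ _
        nlinarith
    · refine ⟨ε, hε, fun l hl => ?_⟩
      rcases Finset.mem_insert.1 hl with rfl | hl
      · rw [h1, hx.2 l ha h1]; simp
      · exact h l hl

/-- The sum of the functionals of `Λ` that vanish at `w'` supports the face: its terms are
nonpositive on the cone, so it vanishes only where each of them does. -/
theorem isConeFace_coneFaceOf {Λ : Finset (V →ₗ[ℝ] ℝ)} (L : Submodule ℝ V) {w w' : V}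
    (h : w' ∈ coneFaceOf Λ w) :
    IsConeFace (coneFaceOf Λ w' ∩ L) (coneFaceOf Λ w ∩ L) := by
  classical
  refine ⟨∑ l ∈ Λ with l w' = 0, l, fun x hx => ?_, ?_⟩
  · rw [LinearMap.sum_apply]
    exact Finset.sum_nonpos fun l hl => hx.1.1 l (Finset.mem_filter.1 hl).1
  · ext x
    constructor
    · intro hx
      refine ⟨⟨coneFaceOf_subset h hx.1, hx.2⟩, ?_⟩
      rw [LinearMap.sum_apply]
      refine Finset.sum_eq_zero fun l hl => ?_
      rw [Finset.mem_filter] at hl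
      exact hx.1.2 l hl.1 hl.2
    · rintro ⟨hx, h0⟩
      refine ⟨⟨hx.1.1, fun l hl h1 => ?_⟩, hx.2⟩
      rw [LinearMap.sum_apply, Finset.sum_eq_zero_iff_of_nonpos
        (fun l hl => hx.1.1 l (Finset.mem_filter.1 hl).1)] at h0
      exact h0 l (Finset.mem_filter.2 ⟨hl, h1⟩)

/-- Equations are pairs of opposite inequalities, and `L` is cut out by a finite generating set of
its annihilator. -/
theorem isPolyhedralCone_coneFaceOf [FiniteDimensional ℝ V] (Λ : Finset (V →ₗ[ℝ] ℝ))
    (L : Submodule ℝ V) (w : V) : IsPolyhedralCone (coneFaceOf Λ w ∩ L) := by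
  classical
  obtain ⟨A, hA⟩ : ∃ A : Finset (V →ₗ[ℝ] ℝ), ∀ x, x ∈ L ↔ ∀ l ∈ A, l x = 0 := by
    obtain ⟨A, hA⟩ := (IsNoetherian.noetherian L.dualAnnihilator)
    refine ⟨A, fun x => ⟨fun hx l hl => ?_, fun h => ?_⟩⟩
    · have : l ∈ L.dualAnnihilator := hA ▸ Submodule.subset_span hl
      exact (Submodule.mem_dualAnnihilator l).1 this x hx
    · rw [← Subspace.forall_mem_dualAnnihilator_apply_eq_zero_iff]
      intro l hl
      rw [← hA] at hl
      induction hl using Submodule.span_induction with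
      | mem l hl => exact h l hl
      | zero => rfl
      | add l l' _ _ h1 h2 => rw [LinearMap.add_apply, h1, h2, add_zero]
      | smul c l _ h1 => rw [LinearMap.smul_apply, h1, smul_zero]
  refine ⟨Λ ∪ ((Λ.filter fun l => l w = 0).image fun l => -l) ∪ A ∪ A.image fun l => -l, ?_⟩
  ext x
  simp only [coneFaceOf, Set.mem_inter_iff, Set.mem_ofPred_eq, SetLike.mem_coe, hA,
    Finset.mem_union, Finset.mem_image, Finset.mem_filter]
  constructor
  · rintro ⟨⟨h1, h2⟩, h3⟩ l (((hl | ⟨l, hl, rfl⟩) | hl) | ⟨l, hl, rfl⟩)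
    · exact h1 l hl
    · simp [h2 l hl.1 hl.2]
    · simp [h3 l hl]
    · simp [h3 l hl]
  · intro h
    refine ⟨⟨fun l hl => h l (by tauto), fun l hl h0 => ?_⟩, fun l hl => ?_⟩
    · have h1 := h l (by tauto)
      have h2 := h (-l) (Or.inl (Or.inl (Or.inr ⟨l, ⟨hl, h0⟩, rfl⟩)))
      rw [LinearMap.neg_apply] at h2
      linarith
    · have h1 := h l (by tauto)
      have h2 := h (-l) (Or.inr ⟨l, hl, rfl⟩)
      rw [LinearMap.neg_apply] at h2
      linarith

/-- Replacing a point `x` of the closed face by `x + ε • w` with `ε > 0` makes every inequality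
strict that is strict at `w`; then `ε` tends to `0`. -/
theorem closure_openFaceOf [TopologicalSpace V] [IsTopologicalAddGroup V] [ContinuousSMul ℝ V]
    [T2Space V] [FiniteDimensional ℝ V] {Λ : Finset (V →ₗ[ℝ] ℝ)} {w : V}
    (hw : w ∈ halfspaceCone Λ) : closure (openFaceOf Λ w) = coneFaceOf Λ w := by
  apply subset_antisymm
  · refine closure_minimal (fun x hx => ⟨hx.1, fun l hl h => (hx.2 l hl).1 h⟩) ?_
    have : coneFaceOf Λ w = (⋂ l ∈ Λ, {x | l x ≤ 0}) ∩ ⋂ l ∈ Λ, ⋂ (_ : l w = 0), {x | l x = 0} := by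
      ext x; simp [coneFaceOf]
    rw [this]
    refine IsClosed.inter (isClosed_biInter fun l _ => ?_)
      (isClosed_biInter fun l _ => isClosed_iInter fun _ => ?_)
    · exact isClosed_le l.continuous_of_finiteDimensional continuous_const
    · exact isClosed_eq l.continuous_of_finiteDimensional continuous_const
  · intro x hx
    have ht : Filter.Tendsto (fun ε : ℝ => x + ε • w) (nhdsWithin 0 (Set.Ioi 0)) (nhds x) := by
      have : ContinuousAt (fun ε : ℝ => x + ε • w) 0 := by fun_prop
      have h2 := this.tendsto
      simp only [zero_smul, add_zero] at h2
      exact h2.mono_left nhdsWithin_le_nhds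
    refine mem_closure_of_tendsto ht ?_
    filter_upwards [self_mem_nhdsWithin] with ε hε
    have hε : 0 < ε := hε
    refine ⟨fun l hl => ?_, fun l hl => ⟨fun h => ?_, fun h => ?_⟩⟩
    · have h1 := hx.1 l hl
      have h2 := hw l hl
      simp only [map_add, map_smul, smul_eq_mul]
      nlinarith
    · simp [h, hx.2 l hl h]
    · have h1 := hx.1 l hl
      have h2 := hw l hl
      simp only [map_add, map_smul, smul_eq_mul] at h
      nlinarith

/-- If finitely many polyhedral cones are such that the relative interiors of their faces are
equal or disjoint, then their faces restrict to a fan on every subspace. -/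
theorem isPolyhedralFan_coneFaceOf [FiniteDimensional ℝ V] (𝓛 : Set (Finset (V →ₗ[ℝ] ℝ)))
    (hfin : 𝓛.Finite) (L : Submodule ℝ V)
    (H : ∀ Λ ∈ 𝓛, ∀ Λ' ∈ 𝓛, ∀ w ∈ halfspaceCone Λ, w ∈ halfspaceCone Λ' →
      coneFaceOf Λ w = coneFaceOf Λ' w) :
    IsPolyhedralFan {C | ∃ Λ ∈ 𝓛, ∃ w ∈ halfspaceCone Λ, C = coneFaceOf Λ w ∩ L} := by
  classical
  constructor
  · refine Set.Finite.subset (hfin.biUnion fun Λ _ => (Λ.powerset.finite_toSet).image fun s =>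
      {x | (∀ l ∈ Λ, l x ≤ 0) ∧ ∀ l ∈ s, l x = 0} ∩ (L : Set V)) ?_
    rintro C ⟨Λ, hΛ, w, hw, rfl⟩
    refine Set.mem_biUnion hΛ ⟨Λ.filter fun l => l w = 0,
      Finset.mem_coe.2 (Finset.mem_powerset.2 (Finset.filter_subset _ _)), ?_⟩
    ext x; simp [coneFaceOf]
  · rintro C ⟨Λ, hΛ, w, hw, rfl⟩
    exact isPolyhedralCone_coneFaceOf Λ L w
  · rintro C ⟨Λ, hΛ, w, hw, rfl⟩ F ⟨l₀, hl₀, rfl⟩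
    -- The exposed face will be the smallest face through a generic point `w'` of it.
    obtain ⟨w', hw', h⟩ := exists_generic_point Λ {x | x ∈ coneFaceOf Λ w ∩ L ∧ l₀ x = 0}
      ⟨⟨zero_mem_coneFaceOf Λ w, L.zero_mem⟩, map_zero _⟩
      (fun x hx y hy => ⟨⟨add_mem_coneFaceOf hx.1.1 hy.1.1, L.add_mem hx.1.2 hy.1.2⟩, by
        rw [map_add, hx.2, hy.2, add_zero]⟩) (fun x hx => hx.1.1.1)
    refine ⟨Λ, hΛ, w', hw'.1.1.1, ?_⟩
    ext x
    constructor
    · intro hx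
      exact ⟨⟨hx.1.1.1, fun l hl h0 => h l hl h0 x hx⟩, hx.1.2⟩
    · intro hx
      have hx' : x ∈ coneFaceOf Λ w := coneFaceOf_subset hw'.1.1 hx.1
      refine ⟨⟨hx', hx.2⟩, le_antisymm (hl₀ x ⟨hx', hx.2⟩) ?_⟩
      -- The segment from `x` to `w'` extends a little beyond `w'`. There `l₀ ≤ 0`, and `l₀ w' = 0`,
      -- so `l₀ x ≥ 0`.
      obtain ⟨ε, hε, h1⟩ := mem_of_small_sub hw'.1.1.1 hx.1
      have h2 := hl₀ (w' - ε • x) ⟨⟨h1, fun l hl h0 => by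
        rw [map_sub, map_smul, hw'.1.1.2 l hl h0, hx'.2 l hl h0, smul_zero, sub_zero]⟩,
        L.sub_mem hw'.1.2 (L.smul_mem _ hx.2)⟩
      rw [map_sub, hw'.2, map_smul, smul_eq_mul] at h2
      nlinarith
  · rintro C ⟨Λ, hΛ, w, hw, rfl⟩ C' ⟨Λ', hΛ', w', hw', rfl⟩
    -- Choose `z` in the intersection generic for both sets of functionals. By `H` its smallest
    -- faces in the two cones agree, and this common face cuts out the intersection.
    obtain ⟨z, hz, h⟩ := exists_generic_point (Λ ∪ Λ')
      ((coneFaceOf Λ w ∩ L) ∩ (coneFaceOf Λ' w' ∩ L))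
      ⟨⟨zero_mem_coneFaceOf Λ w, L.zero_mem⟩, ⟨zero_mem_coneFaceOf Λ' w', L.zero_mem⟩⟩
      (fun x hx y hy => ⟨⟨add_mem_coneFaceOf hx.1.1 hy.1.1, L.add_mem hx.1.2 hy.1.2⟩,
        ⟨add_mem_coneFaceOf hx.2.1 hy.2.1, L.add_mem hx.1.2 hy.1.2⟩⟩)
      (fun x hx l hl => by
        rcases Finset.mem_union.1 hl with hl | hl
        · exact hx.1.1.1 l hl
        · exact hx.2.1.1 l hl)
    have e := H Λ hΛ Λ' hΛ' z hz.1.1.1 hz.2.1.1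
    have key : (coneFaceOf Λ w ∩ L) ∩ (coneFaceOf Λ' w' ∩ L) = coneFaceOf Λ z ∩ L := by
      ext x
      constructor
      · intro hx
        exact ⟨⟨hx.1.1.1, fun l hl h0 => h l (Finset.mem_union_left _ hl) h0 x hx⟩, hx.1.2⟩
      · intro hx
        exact ⟨⟨coneFaceOf_subset hz.1.1 hx.1, hx.2⟩,
          ⟨coneFaceOf_subset hz.2.1 (e ▸ hx.1), hx.2⟩⟩
    rw [key]
    refine ⟨isConeFace_coneFaceOf L hz.1.1, ?_⟩
    rw [e]
    exact isConeFace_coneFaceOf L hz.2.1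

end Gluing

/-! ### Monomials and their coefficients -/

namespace HDiff

/-- The exponents `(α, β, j)` of the monomials `x^α ∂^β h^j`. -/
abbrev Mon (n : ℕ) : Type := (Fin n →₀ ℕ) × (Fin n →₀ ℕ) × ℕ

namespace Mon

variable {n : ℕ}

/-- The exponent of `x_i`. -/
noncomputable def ex (i : Fin n) : Mon n := (Finsupp.single i 1, 0, 0)

/-- The exponent of `∂_i`. -/
noncomputable def ed (i : Fin n) : Mon n := (0, Finsupp.single i 1, 0)

/-- The exponent of `h`. -/
def eh : Mon n := (0, 0, 1)

/-- The degree `|β| + j`. -/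
noncomputable def deg (m : Mon n) : ℕ := m.2.1.degree + m.2.2

/-- The weight of a monomial. -/
noncomputable def wt (w : WeightSpace n) (m : Mon n) : ℝ := weight w m.1 m.2.1

theorem deg_add (m m' : Mon n) : (m + m').deg = m.deg + m'.deg := by
  simp only [deg, Prod.snd_add, Prod.fst_add, map_add]; omega

theorem wt_add (w : WeightSpace n) (m m' : Mon n) : wt w (m + m') = wt w m + wt w m' := by
  simp only [wt, weight, Prod.snd_add, Prod.fst_add, Finsupp.add_apply, Nat.cast_add, mul_add,
    Finset.sum_add_distrib]
  ring

end Mon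

open Mon

variable {k : Type*} [Field k] {n : ℕ}

/-- The coefficient in `k` of a monomial. -/
def cf (P : HDiff k n) (m : Mon n) : k := MvPowerSeries.coeff m.1 (P.coef m.2.1 m.2.2)

theorem ext_cf {P Q : HDiff k n} (h : ∀ m, P.cf m = Q.cf m) : P = Q :=
  ext fun β j => MvPowerSeries.ext fun α => h (α, β, j)

@[simp] theorem cf_add (P Q : HDiff k n) (m : Mon n) : (P + Q).cf m = P.cf m + Q.cf m := by
  simp [cf]

@[simp] theorem cf_zero (m : Mon n) : (0 : HDiff k n).cf m = 0 := by simp [cf]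

@[simp] theorem cf_neg (P : HDiff k n) (m : Mon n) : (-P).cf m = -P.cf m := by simp [cf]

@[simp] theorem cf_sub (P Q : HDiff k n) (m : Mon n) : (P - Q).cf m = P.cf m - Q.cf m := by
  rw [sub_eq_add_neg, cf_add, cf_neg, sub_eq_add_neg]

@[simp] theorem cf_sum {ι : Type*} (s : Finset ι) (P : ι → HDiff k n) (m : Mon n) :
    (∑ i ∈ s, P i).cf m = ∑ i ∈ s, (P i).cf m := by
  classical
  induction s using Finset.induction_on with
  | empty => simp
  | insert a s ha ih => rw [Finset.sum_insert ha, Finset.sum_insert ha, cf_add, ih]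

theorem exists_cf_ne_zero {P : HDiff k n} (h : P ≠ 0) : ∃ m, P.cf m ≠ 0 := by
  by_contra! h'
  exact h (ext_cf fun m => by rw [h', cf_zero])

theorem cf_smul (c : MvPowerSeries (Fin n) k) (P : HDiff k n) (m : Mon n) :
    (c • P).cf m = ∑ p ∈ Finset.HasAntidiagonal.antidiagonal m.1,
      MvPowerSeries.coeff p.1 c * P.cf (p.2, m.2) := by
  simp only [cf, coef_smul, MvPowerSeries.coeff_mul]

theorem finite_support_snd (P : HDiff k n) : {q : (Fin n →₀ ℕ) × ℕ | ∃ α, P.cf (α, q) ≠ 0}.Finite := by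
  refine P.coeffs.support.finite_toSet.subset ?_
  rintro q ⟨α, h⟩
  rw [Finset.mem_coe, Finsupp.mem_support_iff]
  intro h0
  have : P.coef q.1 q.2 = 0 := h0
  exact h (by simp [cf, this])

theorem eq_sum_mono (P : HDiff k n) :
    P = ∑ m ∈ P.coeffs.support, mono m.1 m.2 (P.coef m.1 m.2) :=
  (Finsupp.sum_single (M := MvPowerSeries (Fin n) k) P).symm

/-! ### Supports of products -/

theorem coef_opH (Q : HDiff k n) (β : Fin n →₀ ℕ) (j : ℕ) :
    (opH Q).coef β j = if 1 ≤ j then Q.coef β (j - 1) else 0 := by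
  induction Q using induction with
  | zero => simp
  | mono γ l c =>
    rw [opH_mono, coef_mono, coef_mono]
    by_cases h : 1 ≤ j
    · have : l + 1 = j ↔ l = j - 1 := by omega
      simp [h, this]
    · have : l + 1 ≠ j := by omega
      simp [h, this]
  | add P Q hP hQ => rw [map_add, coef_add, hP, hQ, coef_add]; split_ifs <;> simp

theorem coef_opD (i : Fin n) (Q : HDiff k n) (β : Fin n →₀ ℕ) (j : ℕ) :
    (opD i Q).coef β j =
      (if Finsupp.single i 1 ≤ β then Q.coef (β - Finsupp.single i 1) j else 0) +
      if 1 ≤ j then MvPowerSeries.pderiv k i (Q.coef β (j - 1)) else 0 := by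
  induction Q using induction with
  | zero => simp
  | mono γ l c =>
    rw [opD_mono, coef_add, coef_mono, coef_mono, coef_mono, coef_mono]
    congr 1
    · by_cases h : Finsupp.single i 1 ≤ β
      · have : γ + Finsupp.single i 1 = β ↔ γ = β - Finsupp.single i 1 :=
          (eq_tsub_iff_add_eq_of_le h).symm
        simp [h, this]
      · have : γ + Finsupp.single i 1 ≠ β := by
          rintro rfl
          exact h le_add_self
        simp [h, this]
    · by_cases h : 1 ≤ j
      · have : l + 1 = j ↔ l = j - 1 := by omega
        by_cases h' : γ = β ∧ l = j - 1 <;> simp [h, this, h']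
      · have : l + 1 ≠ j := by omega
        simp [h, this]
  | add P Q hP hQ =>
    rw [map_add, coef_add, hP, hQ, coef_add, coef_add]
    split_ifs <;> (simp [map_add]; try ring)

theorem cf_opH_add (Q : HDiff k n) (m : Mon n) : (opH Q).cf (eh + m) = Q.cf m := by
  simp [cf, coef_opH, eh]

theorem cf_opD (i : Fin n) (Q : HDiff k n) (m : Mon n) :
    (opD i Q).cf m =
      (if Finsupp.single i 1 ≤ m.2.1 then Q.cf (m.1, m.2.1 - Finsupp.single i 1, m.2.2) else 0) +
      if 1 ≤ m.2.2 then Q.cf (m.1 + Finsupp.single i 1, m.2.1, m.2.2 - 1) * (m.1 i + 1) else 0 := by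
  simp only [cf, coef_opD, map_add]
  congr 1
  · split_ifs <;> simp
  · split_ifs <;> simp [MvPowerSeries.coeff_pderiv]

/-- The exponent `κ` arises from `e` by contracting pairs `x_i ∂_i` to `h`. -/
def Contracts (e κ : Mon n) : Prop := ∃ γ : Fin n →₀ ℕ, κ + (γ, γ, 0) = e + (0, 0, γ.degree)

theorem Contracts.trans_add {e f κ ν : Mon n} (h1 : Contracts (e + ν) κ) (h2 : Contracts f ν) :
    Contracts (e + f) κ := by
  obtain ⟨γ, hγ⟩ := h1
  obtain ⟨δ, hδ⟩ := h2
  refine ⟨γ + δ, ?_⟩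
  have e1 : ((γ + δ, γ + δ, 0) : Mon n) = (γ, γ, 0) + (δ, δ, 0) := rfl
  have e2 : ((0, 0, (γ + δ).degree) : Mon n) = (0, 0, γ.degree) + (0, 0, δ.degree) := by
    simp [map_add]
  rw [e1, e2, ← add_assoc, hγ, add_right_comm, add_assoc e, hδ]
  abel

theorem Contracts.refl (e : Mon n) : Contracts e e := ⟨0, by simp⟩

/-- The operator `E` multiplies monomials by `e`, up to contractions. -/
def Shifts (E : AddMonoid.End (HDiff k n)) (e : Mon n) : Prop :=
  ∀ Q κ, (E Q).cf κ ≠ 0 → ∃ ν, Q.cf ν ≠ 0 ∧ Contracts (e + ν) κ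

theorem Shifts.one : Shifts (1 : AddMonoid.End (HDiff k n)) 0 := fun Q κ h =>
  ⟨κ, h, by rw [zero_add]; exact Contracts.refl κ⟩

theorem Shifts.mul {E F : AddMonoid.End (HDiff k n)} {e f : Mon n} (hE : Shifts E e)
    (hF : Shifts F f) : Shifts (E * F) (e + f) := fun Q κ h => by
  obtain ⟨ν, h1, h2⟩ := hE (F Q) κ h
  obtain ⟨μ, h3, h4⟩ := hF Q ν h1
  refine ⟨μ, h3, ?_⟩
  rw [add_assoc]
  exact h2.trans_add h4

theorem Shifts.pow {E : AddMonoid.End (HDiff k n)} {e : Mon n} (hE : Shifts E e) (m : ℕ) :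
    Shifts (E ^ m) (m • e) := by
  induction m with
  | zero => rw [pow_zero, zero_nsmul]; exact Shifts.one
  | succ m ih => rw [pow_succ, succ_nsmul]; exact ih.mul hE

theorem Shifts.list_prod {ι : Type*} (l : List ι) (E : ι → AddMonoid.End (HDiff k n))
    (e : ι → Mon n) (h : ∀ i, Shifts (E i) (e i)) : Shifts (l.map E).prod (l.map e).sum := by
  induction l with
  | nil => exact Shifts.one
  | cons a l ih => rw [List.map_cons, List.prod_cons, List.map_cons, List.sum_cons]
                   exact (h a).mul ih

theorem shifts_opH : Shifts (opH : AddMonoid.End (HDiff k n)) eh := fun Q κ hκ => by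
  simp only [cf, coef_opH] at hκ
  by_cases h1 : 1 ≤ κ.2.2
  · refine ⟨(κ.1, κ.2.1, κ.2.2 - 1), by simpa [cf, h1] using hκ, ?_⟩
    have : (eh : Mon n) + (κ.1, κ.2.1, κ.2.2 - 1) = κ := by
      refine Prod.ext (by simp [eh]) (Prod.ext (by simp [eh]) ?_)
      simp only [eh, Prod.snd_add]
      omega
    rw [this]
    exact Contracts.refl κ
  · simp [h1] at hκ

/-- In `∂_i c = c ∂_i + (∂c/∂x_i) h` the first term only adds `∂_i`; the second removes one `x_i`
and supplies an `h`, which is a contraction with `γ = e_i`. -/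
theorem shifts_opD (i : Fin n) : Shifts (opD i : AddMonoid.End (HDiff k n)) (ed i) :=
  fun Q κ hκ => by
  rw [cf_opD] at hκ
  by_cases h0 : (if Finsupp.single i 1 ≤ κ.2.1 then
      Q.cf (κ.1, κ.2.1 - Finsupp.single i 1, κ.2.2) else 0) = 0
  · rw [h0, zero_add] at hκ
    by_cases h1 : 1 ≤ κ.2.2
    · rw [if_pos h1] at hκ
      refine ⟨_, left_ne_zero_of_mul hκ, Finsupp.single i 1, ?_⟩
      refine Prod.ext ?_ (Prod.ext ?_ ?_)
      · simp [ed]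
      · simp [ed, add_comm]
      · simp only [ed, Prod.snd_add, Finsupp.degree_single]
        omega
    · simp [h1] at hκ
  · by_cases h1 : Finsupp.single i 1 ≤ κ.2.1
    · rw [if_pos h1] at h0
      refine ⟨_, h0, ?_⟩
      have : ed i + (κ.1, κ.2.1 - Finsupp.single i 1, κ.2.2) = κ := by
        refine Prod.ext (by simp [ed]) (Prod.ext ?_ (by simp [ed]))
        simp only [ed, Prod.snd_add, Prod.fst_add]
        exact add_tsub_cancel_of_le h1
      rw [this]
      exact Contracts.refl κ
    · simp [h1] at h0

theorem shifts_opMono (β : Fin n →₀ ℕ) (j : ℕ) :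
    Shifts (opMono β j : AddMonoid.End (HDiff k n)) (0, β, j) := by
  have h1 := (Shifts.list_prod (List.finRange n) (fun i => (opD i : AddMonoid.End (HDiff k n)) ^ β i)
    (fun i => β i • ed i) fun i => (shifts_opD i).pow (β i)).mul ((shifts_opH (k := k)).pow j)
  have h2 : ((List.finRange n).map fun i => β i • ed i).sum + j • eh = ((0, β, j) : Mon n) := by
    rw [← List.ofFn_eq_map, List.sum_ofFn]
    refine Prod.ext ?_ (Prod.ext ?_ ?_)
    · simp [Prod.fst_sum, ed, eh]
    · simp only [Prod.snd_add, Prod.fst_add, Prod.snd_sum, Prod.fst_sum, ed, eh, Prod.smul_snd,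
        Prod.smul_fst, smul_zero, add_zero, Finsupp.smul_single, smul_eq_mul, mul_one]
      exact Finsupp.univ_sum_single β
    · simp [Prod.snd_sum, ed, eh]
  rw [← h2]
  exact h1

/-- The monomials of a product. -/
theorem exists_contracts_of_cf_mul_ne_zero {P Q : HDiff k n} {κ : Mon n} (hκ : (P * Q).cf κ ≠ 0) :
    ∃ μ ν, P.cf μ ≠ 0 ∧ Q.cf ν ≠ 0 ∧ Contracts (μ + ν) κ := by
  rw [eq_sum_mono P, Finset.sum_mul, cf_sum] at hκ
  obtain ⟨q, -, hq⟩ := Finset.exists_ne_zero_of_sum_ne_zero hκ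
  rw [mul_def, op_mono, end_mul_apply, opC_apply, cf_smul] at hq
  obtain ⟨p, hp, h1⟩ := Finset.exists_ne_zero_of_sum_ne_zero hq
  obtain ⟨ν, h2, h3⟩ := shifts_opMono _ _ _ _ (right_ne_zero_of_mul h1)
  refine ⟨(p.1, q), ν, left_ne_zero_of_mul h1, h2, ?_⟩
  -- The power `x^p.1` stands on the left and is merely added to the exponents, so the same `γ`
  -- works.
  obtain ⟨γ, hγ⟩ := h3
  refine ⟨γ, ?_⟩
  rw [Finset.HasAntidiagonal.mem_antidiagonal] at hp
  have e1 : κ = (p.1, 0) + (p.2, κ.2) := Prod.ext (by simp [hp]) (by simp)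
  have e2 : ((p.1, q) : Mon n) = (p.1, 0) + (0, q.1, q.2) := by simp
  rw [e1, e2, add_assoc, hγ]
  abel

/-- This is the purpose of `h`: a contraction trades `|γ|` derivations for `|γ|` factors `h`, so the
product respects degrees. -/
theorem Contracts.deg_eq {e κ : Mon n} (h : Contracts e κ) : κ.deg = e.deg := by
  obtain ⟨γ, hγ⟩ := h
  have := congrArg deg hγ
  simp only [deg_add] at this
  simp only [deg, map_zero] at this ⊢
  omega

end HDiff

namespace HDiff

open Mon

variable {k : Type*} [Field k] {n : ℕ}

/-! ### Restriction to a set of monomials -/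

open scoped Classical in
/-- The part of `P` supported on the set `T` of monomials. -/
noncomputable def restr (T : Set (Mon n)) : HDiff k n →+ HDiff k n where
  toFun P := (Finsupp.onFinset P.coeffs.support
    (fun m α => if ((α, m) : Mon n) ∈ T then MvPowerSeries.coeff α (P.coef m.1 m.2) else 0)
    (fun m hm => by
      rw [Finsupp.mem_support_iff]
      intro h0
      refine hm (funext fun α => ?_)
      have : P.coef m.1 m.2 = 0 := h0
      simp only [this, map_zero, ite_self]
      rfl) : ((Fin n →₀ ℕ) × ℕ) →₀ MvPowerSeries (Fin n) k)
  map_zero' := ext_cf fun m => by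
    change (if m ∈ T then (0 : HDiff k n).cf m else 0) = _
    simp
  map_add' P Q := ext_cf fun m => by
    change (if m ∈ T then (P + Q).cf m else 0) =
      (if m ∈ T then P.cf m else 0) + (if m ∈ T then Q.cf m else 0)
    split_ifs <;> simp

open scoped Classical in
theorem cf_restr (T : Set (Mon n)) (P : HDiff k n) (m : Mon n) :
    (restr T P).cf m = if m ∈ T then P.cf m else 0 := rfl

theorem restr_inter (T T' : Set (Mon n)) (P : HDiff k n) :
    restr T (restr T' P) = restr (T ∩ T') P :=
  ext_cf fun m => by
    by_cases h1 : m ∈ T <;> by_cases h2 : m ∈ T' <;> simp [cf_restr, h1, h2]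

theorem restr_eq_self {T : Set (Mon n)} {P : HDiff k n} (h : ∀ m, P.cf m ≠ 0 → m ∈ T) :
    restr T P = P :=
  ext_cf fun m => by
    rw [cf_restr]
    split_ifs with h1
    · rfl
    · by_contra h2
      exact h1 (h m (Ne.symm h2))

theorem part_eq_restr (w : WeightSpace n) (c : ℝ) (P : HDiff k n) :
    part w c P = restr {m | wt w m = c} P := rfl

theorem cf_part (w : WeightSpace n) (c : ℝ) (P : HDiff k n) (m : Mon n) [Decidable (wt w m = c)] :
    (part w c P).cf m = if wt w m = c then P.cf m else 0 := by
  rw [part_eq_restr, cf_restr]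
  simp only [Set.mem_ofPred_eq]
  congr

/-- The homogeneous component of degree `d`. -/
noncomputable def comp (d : ℕ) : HDiff k n →+ HDiff k n := restr {m | deg m = d}

theorem cf_comp (d : ℕ) (P : HDiff k n) (m : Mon n) :
    (comp d P).cf m = if deg m = d then P.cf m else 0 := by
  rw [comp, cf_restr]
  simp only [Set.mem_ofPred_eq]
  congr

/-- `P` is the sum of its parts on the fibres of a function, if there are finitely many. -/
theorem sum_restr_fiber {ι : Type*} (f : Mon n → ι) (s : Finset ι) {P : HDiff k n}
    (h : ∀ m, P.cf m ≠ 0 → f m ∈ s) : ∑ i ∈ s, restr {m | f m = i} P = P := by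
  classical
  refine ext_cf fun m => ?_
  rw [cf_sum]
  simp only [cf_restr, Set.mem_ofPred_eq]
  rw [Finset.sum_ite_eq]
  split_ifs with h1
  · rfl
  · by_contra h2
    exact h1 (h m (Ne.symm h2))

theorem finite_deg (P : HDiff k n) : {d | ∃ m, P.cf m ≠ 0 ∧ deg m = d}.Finite := by
  refine ((finite_support_snd P).image fun q => q.1.degree + q.2).subset ?_
  rintro _ ⟨m, hm, rfl⟩
  exact ⟨m.2, ⟨m.1, hm⟩, rfl⟩

/-- The elements of degree `d`. -/
def IsHomog (d : ℕ) (P : HDiff k n) : Prop := ∀ m, P.cf m ≠ 0 → deg m = d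

theorem isHomog_comp (d : ℕ) (P : HDiff k n) : IsHomog d (comp d P) := fun m hm => by
  by_contra h
  simp [cf_comp, h] at hm

theorem IsHomogeneous.isHomog {P : HDiff k n} (h : IsHomogeneous P) : ∃ d, IsHomog d P := by
  obtain ⟨d, h⟩ := h
  refine ⟨d, fun m hm => h _ _ fun h0 => hm ?_⟩
  simp [cf, h0]

/-- Degrees add under multiplication. It is used to show that an ideal generated by homogeneous
elements contains the components of its elements. -/
theorem comp_mul {d e : ℕ} (P Q : HDiff k n) (hQ : IsHomog e Q) :
    comp d (P * Q) = if e ≤ d then comp (d - e) P * Q else 0 := by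
  have h0 : ∀ c, IsHomog (c + e) (comp c P * Q) := fun c m hm => by
    obtain ⟨μ, ν, h1, h2, h3⟩ := exists_contracts_of_cf_mul_ne_zero hm
    rw [h3.deg_eq, deg_add, hQ ν h2, isHomog_comp c P μ h1]
  have h1 : P = ∑ c ∈ (finite_deg P).toFinset, comp c P :=
    (sum_restr_fiber deg _ fun m hm => by simpa using ⟨_, _, _, hm, rfl⟩).symm
  have h2 : P * Q = ∑ c ∈ (finite_deg P).toFinset, comp c P * Q := by
    rw [← Finset.sum_mul, ← h1]
  have h3 : ∀ c, comp d (comp c P * Q) = if c + e = d then comp c P * Q else 0 := fun c => by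
    refine ext_cf fun m => ?_
    rw [cf_comp]
    by_cases hm : (comp c P * Q).cf m = 0
    · split_ifs <;> simp [hm]
    · rw [h0 c m hm]
      split_ifs <;> simp
  rw [h2, map_sum]
  simp only [h3]
  split_ifs with he
  · have h4 : ∀ c, c + e = d ↔ c = d - e := fun c => by omega
    simp only [h4]
    rw [Finset.sum_ite_eq']
    split_ifs with h5
    · rfl
    · have : comp (d - e) P = 0 := ext_cf fun m => by
        rw [cf_comp, cf_zero]
        split_ifs with h6
        · by_contra h7
          exact h5 (by simpa using ⟨_, _, _, h7, h6⟩)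
        · rfl
      rw [this, zero_mul]
  · refine Finset.sum_eq_zero fun c _ => if_neg (by omega)

/-! ### Weights -/

theorem weight_nonpos {w : WeightSpace n} (hw : w ∈ Wloc n) (α : Fin n →₀ ℕ) :
    ∑ i, w.1 i * (α i : ℝ) ≤ 0 :=
  Finset.sum_nonpos fun i _ => mul_nonpos_of_nonpos_of_nonneg (hw i).1 (Nat.cast_nonneg _)

theorem weight_diag (w : WeightSpace n) (γ : Fin n →₀ ℕ) :
    weight w γ γ = ∑ i, (w.1 i + w.2 i) * γ i := by
  rw [weight, ← Finset.sum_add_distrib]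
  exact Finset.sum_congr rfl fun i _ => by ring

theorem Contracts.wt_eq {e κ : Mon n} (h : Contracts e κ) : ∃ γ : Fin n →₀ ℕ,
    ∀ w : WeightSpace n, wt w κ + ∑ i, (w.1 i + w.2 i) * γ i = wt w e := by
  obtain ⟨γ, hγ⟩ := h
  refine ⟨γ, fun w => ?_⟩
  have h1 := congrArg (wt w) hγ
  have h2 : wt w ((γ, γ, 0) : Mon n) = ∑ i, (w.1 i + w.2 i) * γ i := weight_diag w γ
  have h3 : wt w ((0, 0, γ.degree) : Mon n) = 0 := by simp [wt, weight]
  rw [wt_add, wt_add, h2, h3, add_zero] at h1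
  exact h1

/-- Two weights lie in the relative interior of the same face of `Wloc`. -/
def SameStratum (w w' : WeightSpace n) : Prop :=
  ∀ i, (w.1 i = 0 ↔ w'.1 i = 0) ∧ (w.1 i + w.2 i = 0 ↔ w'.1 i + w'.2 i = 0)

theorem sum_diag_eq_zero_iff {w : WeightSpace n} (hw : w ∈ Wloc n) (γ : Fin n →₀ ℕ) :
    ∑ i, (w.1 i + w.2 i) * γ i = 0 ↔ ∀ i, w.1 i + w.2 i = 0 ∨ γ i = 0 := by
  rw [Finset.sum_eq_zero_iff_of_nonneg fun i _ => mul_nonneg (hw i).2 (Nat.cast_nonneg _)]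
  simp

/-! ### The underlying group of the graded ring -/

/-- Finitely many weights occur in `S`. -/
def FinWeight (w : WeightSpace n) (S : HDiff k n) : Prop := {c | ∃ m, S.cf m ≠ 0 ∧ wt w m = c}.Finite

/-- Finitely many `(β, j)` occur, so only the exponents of `x` can produce infinitely many weights,
and only those with `u_i ≠ 0` are felt. The criterion depends on `w` only through the set of such
`i`. -/
theorem finWeight_iff {w : WeightSpace n} (hw : w ∈ Wloc n) (S : HDiff k n) :
    FinWeight w S ↔ ∃ N : ℕ, ∀ m, S.cf m ≠ 0 → ∀ i, w.1 i ≠ 0 → m.1 i ≤ N := by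
  classical
  constructor
  · intro h
    obtain ⟨a, ha⟩ := h.bddBelow
    obtain ⟨b, hb⟩ := ((finite_support_snd S).image fun q => ∑ i, w.2 i * (q.1 i : ℝ)).bddAbove
    -- From `a ≤ u_i α_i + b` and `u_i < 0` follows `α_i ≤ (b - a) / (-u_i)`. The sum bounds all `i`
    -- at once; its terms with `u_i = 0` are zero by the convention for division.
    obtain ⟨N, hN⟩ := exists_nat_ge (∑ i, |(b - a) / w.1 i|)
    refine ⟨N, fun m hm i hi => ?_⟩
    have h1 : a ≤ wt w m := ha ⟨m, hm, rfl⟩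
    have h2 : ∑ i, w.2 i * (m.2.1 i : ℝ) ≤ b := hb ⟨m.2, ⟨m.1, hm⟩, rfl⟩
    have h3 : ∑ j, w.1 j * (m.1 j : ℝ) ≤ w.1 i * m.1 i := by
      rw [← Finset.add_sum_erase _ _ (Finset.mem_univ i)]
      have := Finset.sum_nonpos (s := Finset.univ.erase i) (f := fun j => w.1 j * (m.1 j : ℝ))
        fun j _ => mul_nonpos_of_nonpos_of_nonneg (hw j).1 (Nat.cast_nonneg _)
      linarith
    have h4 : a ≤ w.1 i * m.1 i + b := by
      rw [wt, weight] at h1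
      linarith
    have hneg : w.1 i < 0 := lt_of_le_of_ne (hw i).1 hi
    have h5 : (m.1 i : ℝ) ≤ |(b - a) / w.1 i| := by
      refine le_trans ?_ (neg_le_abs _)
      rw [← div_neg, le_div_iff₀ (by linarith)]
      linarith
    have h6 : |(b - a) / w.1 i| ≤ ∑ i, |(b - a) / w.1 i| :=
      Finset.single_le_sum (f := fun i => |(b - a) / w.1 i|) (fun i _ => abs_nonneg _)
        (Finset.mem_univ i)
    exact_mod_cast h5.trans (h6.trans hN)
  · rintro ⟨N, hN⟩
    refine Set.Finite.subset (((Set.finite_univ (α := Fin n → Fin (N + 1))).prod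
      (finite_support_snd S)).image fun q => ∑ i, w.1 i * ((q.1 i : ℕ) : ℝ) +
        ∑ i, w.2 i * (q.2.1 i : ℝ)) ?_
    rintro _ ⟨m, hm, rfl⟩
    -- Exponents with `u_i = 0` are replaced by `0`, which does not change the weight.
    refine ⟨(fun i => if hi : w.1 i ≠ 0 then ⟨m.1 i, Nat.lt_succ_of_le (hN m hm i hi)⟩ else 0,
      m.2), ⟨trivial, ⟨m.1, hm⟩⟩, ?_⟩
    simp only [wt, weight]
    congr 1
    refine Finset.sum_congr rfl fun i _ => ?_
    split_ifs with hi
    · rfl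
    · rw [not_not.1 hi, zero_mul, zero_mul]

theorem FinWeight.add {w : WeightSpace n} {S T : HDiff k n} (hS : FinWeight w S)
    (hT : FinWeight w T) : FinWeight w (S + T) := by
  refine (Set.Finite.union hS hT).subset ?_
  rintro c ⟨m, hm, rfl⟩
  by_cases h : S.cf m = 0
  · exact Or.inr ⟨m, by simpa [h] using hm, rfl⟩
  · exact Or.inl ⟨m, h, rfl⟩

theorem finWeight_part (w : WeightSpace n) (c : ℝ) (S : HDiff k n) : FinWeight w (part w c S) := by
  classical
  refine (Set.finite_singleton c).subset ?_
  rintro _ ⟨m, hm, rfl⟩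
  by_contra h
  have h : wt w m ≠ c := h
  simp [cf_part, h] at hm

theorem FinWeight.exists_finset {w : WeightSpace n} {S : HDiff k n} (hS : FinWeight w S) :
    ∃ s : Finset ℝ, ∀ m, S.cf m ≠ 0 → wt w m ∈ s := by
  obtain ⟨s, hs⟩ := Set.Finite.exists_finset_coe hS
  exact ⟨s, fun m hm => by rw [← Finset.mem_coe, hs]; exact ⟨m, hm, rfl⟩⟩

theorem part_part (w : WeightSpace n) (c : ℝ) (S : HDiff k n) :
    part w c (part w c S) = part w c S := by
  rw [part_eq_restr, part_eq_restr, restr_inter, Set.inter_self]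

theorem ordLE_iff {w : WeightSpace n} {c : ℝ} {P : HDiff k n} :
    OrdLE w c P ↔ ∀ m, P.cf m ≠ 0 → wt w m ≤ c :=
  ⟨fun h _ hm => h _ _ _ hm, fun h α β j hm => h (α, β, j) hm⟩

theorem ordLE_part (w : WeightSpace n) (c : ℝ) (S : HDiff k n) : OrdLE w c (part w c S) := by
  classical
  refine ordLE_iff.2 fun m hm => ?_
  by_contra h
  have : wt w m ≠ c := fun h' => h h'.le
  simp [cf_part, this] at hm

/-- An element with finitely many weights lies in a subgroup if all its parts do. -/
theorem FinWeight.mem_of_part_mem {w : WeightSpace n} {S : HDiff k n} (hS : FinWeight w S)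
    {H : AddSubgroup (HDiff k n)} (h : ∀ c, part w c S ∈ H) : S ∈ H := by
  obtain ⟨s, hs⟩ := hS.exists_finset
  rw [← sum_restr_fiber (wt w) s hs]
  exact sum_mem fun c _ => h c

/-- The elements of the ring all of whose coefficients lie in `O`. -/
def coefsIn (O : Subring (MvPowerSeries (Fin n) k)) : AddSubgroup (HDiff k n) where
  carrier := {P | ∀ β j, P.coef β j ∈ O}
  zero_mem' := fun _ _ => O.zero_mem
  add_mem' := fun hP hQ β j => O.add_mem (hP β j) (hQ β j)
  neg_mem' := fun hP β j => O.neg_mem (hP β j)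

/-- A ring of power series that contains the polynomials and the geometric series, and is stable
under the restriction of series to sets of exponents. -/
structure Admissible (O : Subring (MvPowerSeries (Fin n) k)) : Prop where
  monomial_mem : ∀ α (a : k), MvPowerSeries.monomial α a ∈ O
  restr_mem : ∀ f ∈ O, ∀ (δ : Fin n →₀ ℕ) (T : Set (Fin n →₀ ℕ)) [DecidablePred (· ∈ T)],
    (fun α => if α ∈ T then MvPowerSeries.coeff (α + δ) f else 0 : MvPowerSeries (Fin n) k) ∈ O
  geom_mem : ∀ i, ∃ f ∈ O, ∀ α : Fin n →₀ ℕ,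
    MvPowerSeries.coeff α f ≠ 0 ↔ ∃ a : ℕ, α = Finsupp.single i a

theorem Admissible.restr_mem_coefsIn {O : Subring (MvPowerSeries (Fin n) k)} (hO : Admissible O)
    {P : HDiff k n} (hP : P ∈ coefsIn O) (T : Set (Mon n)) : restr T P ∈ coefsIn O := by
  classical
  intro β j
  have := hO.restr_mem _ (hP β j) 0 {α | (α, β, j) ∈ T}
  simp only [add_zero] at this
  have e : (restr T P).coef β j = _ := MvPowerSeries.ext fun α => cf_restr T P (α, β, j)
  rwa [e]

theorem mono_mem_coefsIn {O : Subring (MvPowerSeries (Fin n) k)} (β : Fin n →₀ ℕ) (j : ℕ)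
    {c : MvPowerSeries (Fin n) k} (hc : c ∈ O) : mono β j c ∈ coefsIn O := fun γ l => by
  rw [coef_mono]
  split_ifs
  · exact hc
  · exact O.zero_mem

theorem Admissible.part_mem_coefsIn {O : Subring (MvPowerSeries (Fin n) k)} (hO : Admissible O)
    {P : HDiff k n} (hP : P ∈ coefsIn O) (w : WeightSpace n) (c : ℝ) : part w c P ∈ coefsIn O := by
  rw [part_eq_restr]
  exact hO.restr_mem_coefsIn hP _

theorem part_mem_gr {w : WeightSpace n} {A : Set (HDiff k n)} {P : HDiff k n} (hP : P ∈ A) {c : ℝ}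
    (h : OrdLE w c P) : part w c P ∈ gr w A :=
  AddSubgroup.subset_closure ⟨P, hP, c, h, rfl⟩

theorem finWeight_of_mem_gr {w : WeightSpace n} {A : Set (HDiff k n)} {S : HDiff k n}
    (hS : S ∈ gr w A) : FinWeight w S := by
  induction hS using AddSubgroup.closure_induction with
  | mem S h => obtain ⟨P, -, c, -, rfl⟩ := h; exact finWeight_part w c P
  | zero => simp [FinWeight]
  | add S T _ _ h1 h2 => exact h1.add h2
  | neg S _ h => simpa [FinWeight] using h

/-- The ring contains the parts of its elements, so every part of `S` represents its own class. -/
theorem Admissible.mem_gr_iff {O : Subring (MvPowerSeries (Fin n) k)} (hO : Admissible O)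
    {w : WeightSpace n} {S : HDiff k n} :
    S ∈ gr w (coefsIn O : Set (HDiff k n)) ↔ S ∈ coefsIn O ∧ FinWeight w S := by
  refine ⟨fun h => ⟨?_, finWeight_of_mem_gr h⟩, fun h => h.2.mem_of_part_mem fun c => ?_⟩
  · refine (AddSubgroup.closure_le _).2 ?_ h
    rintro _ ⟨P, hP, c, -, rfl⟩
    exact hO.part_mem_coefsIn hP w c
  · rw [← part_part]
    exact part_mem_gr (hO.part_mem_coefsIn h.1 w c) (ordLE_part w c S)

/-! ### The graded ring determines the stratum -/

theorem grMul_eq_sum {w : WeightSpace n} {S T : HDiff k n} (s t : Finset ℝ)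
    (hs : ∀ m, S.cf m ≠ 0 → wt w m ∈ s) (ht : ∀ m, T.cf m ≠ 0 → wt w m ∈ t) :
    grMul w S T = ∑ c ∈ s, ∑ d ∈ t, part w (c + d) (part w c S * part w d T) := by
  classical
  have h0 : ∀ (P : HDiff k n) (s : Finset ℝ), (∀ m, P.cf m ≠ 0 → wt w m ∈ s) → ∀ c, c ∉ s →
      part w c P = 0 := fun P s hs c hc => ext_cf fun m => by
    rw [cf_part, cf_zero]
    split_ifs with h1
    · by_contra h2
      exact hc (h1 ▸ hs m h2)
    · rfl
  have hz : ∀ c, part w c (0 : HDiff k n) = 0 := fun c => by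
    rw [part_eq_restr, map_zero]
  rw [grMul, finsum_eq_sum_of_support_subset (s := s ×ˢ t), Finset.sum_product]
  intro p hp
  rw [Finset.coe_product, Set.mem_prod]
  constructor
  · by_contra h
    exact hp (by simp only [h0 S s hs p.1 h, zero_mul, hz])
  · by_contra h
    exact hp (by simp only [h0 T t ht p.2 h, mul_zero, hz])

/-- Contracting by `γ` lowers the weight by `∑ (u_i + v_i) γ_i`. A monomial of the product therefore
has top weight exactly when `γ_i = 0` wherever `u_i + v_i ≠ 0`, a condition that only sees the
stratum. -/
theorem part_mul_eq_of_sameStratum {w w' : WeightSpace n} (hw : w ∈ Wloc n) (hw' : w' ∈ Wloc n)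
    (h : SameStratum w w') {S T : HDiff k n} {c d c' d' : ℝ}
    (hS : ∀ m, S.cf m ≠ 0 → wt w m = c ∧ wt w' m = c')
    (hT : ∀ m, T.cf m ≠ 0 → wt w m = d ∧ wt w' m = d') :
    part w (c + d) (S * T) = part w' (c' + d') (S * T) := by
  classical
  refine ext_cf fun κ => ?_
  rw [cf_part, cf_part]
  by_cases hκ : (S * T).cf κ = 0
  · simp [hκ]
  obtain ⟨μ, ν, h1, h2, h3⟩ := exists_contracts_of_cf_mul_ne_zero hκ
  obtain ⟨γ, hγ⟩ := h3.wt_eq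
  have e : ∀ w : WeightSpace n, wt w κ = wt w μ + wt w ν ↔ ∑ i, (w.1 i + w.2 i) * γ i = 0 :=
    fun w => by
      have := hγ w
      rw [wt_add] at this
      rw [← this]
      simp
  have e1 : wt w κ = c + d ↔ wt w' κ = c' + d' := by
    rw [← (hS μ h1).1, ← (hS μ h1).2, ← (hT ν h2).1, ← (hT ν h2).2, e, e,
      sum_diag_eq_zero_iff hw, sum_diag_eq_zero_iff hw']
    simp only [(h _).2]
  simp only [e1]

/-- Both factors are split into pieces homogeneous for `w` and `w'` at once;
`part_mul_eq_of_sameStratum` compares the products of pieces. -/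
theorem grMul_eq_of_sameStratum {w w' : WeightSpace n} (hw : w ∈ Wloc n) (hw' : w' ∈ Wloc n)
    (h : SameStratum w w') {S T : HDiff k n} (hS : FinWeight w S) (hS' : FinWeight w' S)
    (hT : FinWeight w T) (hT' : FinWeight w' T) : grMul w S T = grMul w' S T := by
  classical
  obtain ⟨s, hs⟩ := hS.exists_finset
  obtain ⟨s', hs'⟩ := hS'.exists_finset
  obtain ⟨t, ht⟩ := hT.exists_finset
  obtain ⟨t', ht'⟩ := hT'.exists_finset
  have key : ∀ (v v' : WeightSpace n) (P : HDiff k n) (s : Finset ℝ),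
      (∀ m, P.cf m ≠ 0 → wt v' m ∈ s) → ∀ c, part v c P = ∑ c' ∈ s, part v c (part v' c' P) :=
    fun v v' P s hs c => by
      conv_lhs => rw [← sum_restr_fiber (wt v') s hs]
      rw [part_eq_restr, map_sum]
      rfl
  have comm : ∀ (P : HDiff k n) c c', part w' c' (part w c P) = part w c (part w' c' P) :=
    fun P c c' => by
      simp only [part_eq_restr, restr_inter, Set.inter_comm]
  have hpart : ∀ (v : WeightSpace n) (c : ℝ) {ι : Type} (s : Finset ι) (f : ι → HDiff k n),
      part v c (∑ i ∈ s, f i) = ∑ i ∈ s, part v c (f i) := fun v c ι s f => by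
    rw [part_eq_restr, map_sum]; rfl
  have e1 : grMul w S T = ∑ c ∈ s, ∑ d ∈ t, ∑ c' ∈ s',
      ∑ d' ∈ t',
        part w (c + d) (part w c (part w' c' S) * part w d (part w' d' T)) := by
    rw [grMul_eq_sum _ _ hs ht]
    refine Finset.sum_congr rfl fun c _ => Finset.sum_congr rfl fun d _ => ?_
    rw [key w w' S _ hs' c, key w w' T _ ht' d, Finset.sum_mul_sum, hpart]
    simp only [hpart]
  have e2 : grMul w' S T = ∑ c' ∈ s', ∑ d' ∈ t', ∑ c ∈ s,
      ∑ d ∈ t,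
        part w' (c' + d') (part w c (part w' c' S) * part w d (part w' d' T)) := by
    rw [grMul_eq_sum _ _ hs' ht']
    refine Finset.sum_congr rfl fun c _ => Finset.sum_congr rfl fun d _ => ?_
    conv_lhs => rw [key w' w S _ hs c, key w' w T _ ht d, Finset.sum_mul_sum, hpart]
    simp only [hpart, comm]
  have e3 : ∀ F : ℝ → ℝ → ℝ → ℝ → HDiff k n, ∑ c ∈ s, ∑ d ∈ t, ∑ c' ∈ s', ∑ d' ∈ t', F c d c' d' =
      ∑ c' ∈ s', ∑ d' ∈ t', ∑ c ∈ s, ∑ d ∈ t, F c d c' d' := fun F => by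
    rw [← Finset.sum_product' s t fun c d => ∑ c' ∈ s', ∑ d' ∈ t', F c d c' d',
      ← Finset.sum_product' s' t' fun c' d' => ∑ c ∈ s, ∑ d ∈ t, F c d c' d']
    have e4 : ∀ p : ℝ × ℝ, ∑ c' ∈ s', ∑ d' ∈ t', F p.1 p.2 c' d' =
        ∑ q ∈ s' ×ˢ t', F p.1 p.2 q.1 q.2 := fun p => (Finset.sum_product' s' t' (F p.1 p.2)).symm
    have e5 : ∀ q : ℝ × ℝ, ∑ c ∈ s, ∑ d ∈ t, F c d q.1 q.2 =
        ∑ p ∈ s ×ˢ t, F p.1 p.2 q.1 q.2 := fun q =>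
      (Finset.sum_product' s t fun c d => F c d q.1 q.2).symm
    simp only [e4, e5]
    exact Finset.sum_comm
  rw [e1, e2, e3]
  refine Finset.sum_congr rfl fun c' _ => Finset.sum_congr rfl fun d' _ =>
    Finset.sum_congr rfl fun c _ => Finset.sum_congr rfl fun d _ => ?_
  have hb : ∀ (P : HDiff k n) c c' m, (part w c (part w' c' P)).cf m ≠ 0 →
      wt w m = c ∧ wt w' m = c' := fun P c c' m hm => by
    rw [cf_part] at hm
    split_ifs at hm with h1
    · rw [cf_part] at hm
      split_ifs at hm with h2
      · exact ⟨h1, h2⟩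
      · exact absurd rfl hm
    · exact absurd rfl hm
  exact part_mul_eq_of_sameStratum hw hw' h (hb S _ _) (hb T _ _)

theorem cf_mono (β : Fin n →₀ ℕ) (j : ℕ) (c : MvPowerSeries (Fin n) k) (m : Mon n) :
    (mono β j c).cf m = if (β, j) = m.2 then MvPowerSeries.coeff m.1 c else 0 := by
  rw [cf, coef_mono]
  simp only [Prod.ext_iff]
  split_ifs <;> simp

/-- In `∂_i x_i = x_i ∂_i + h` the term `h` has weight `0`, so it survives in the graded ring
exactly when `u_i + v_i = 0`. This makes the product a test for that equation. -/
theorem grMul_del_ofSeries (w : WeightSpace n) (i : Fin n) :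
    grMul w (del i : HDiff k n) (ofSeries (MvPowerSeries.X i)) =
      part w (w.2 i + w.1 i) (ofSeries (MvPowerSeries.X i) * del i + hvar) := by
  classical
  have hs : ∀ m, (del i : HDiff k n).cf m ≠ 0 → wt w m = w.2 i := fun m hm => by
    rw [del, cf_mono] at hm
    have h1 : (Finsupp.single i 1, 0) = m.2 := by
      by_contra h
      simp [h] at hm
    rw [if_pos h1, MvPowerSeries.coeff_one] at hm
    have h2 : m.1 = 0 := by
      by_contra h
      simp [h] at hm
    rw [wt, weight, h2, ← h1]
    simp [Finsupp.single_apply]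
  have ht : ∀ m, (ofSeries (MvPowerSeries.X i) : HDiff k n).cf m ≠ 0 → wt w m = w.1 i :=
    fun m hm => by
    rw [ofSeries, cf_mono] at hm
    have h1 : (0, 0) = m.2 := by
      by_contra h
      simp [h] at hm
    rw [if_pos h1, MvPowerSeries.coeff_X] at hm
    have h2 : m.1 = Finsupp.single i 1 := by
      by_contra h
      simp [h] at hm
    rw [wt, weight, h2, ← h1]
    simp [Finsupp.single_apply]
  rw [grMul_eq_sum {w.2 i} {w.1 i} (fun m hm => by simp [hs m hm]) (fun m hm => by simp [ht m hm]),
    Finset.sum_singleton, Finset.sum_singleton]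
  have e1 : part w (w.2 i) (del i : HDiff k n) = del i := restr_eq_self fun m hm => hs m hm
  have e2 : part w (w.1 i) (ofSeries (MvPowerSeries.X i) : HDiff k n) =
      ofSeries (MvPowerSeries.X i) := restr_eq_self fun m hm => ht m hm
  have e3 := del_mul_ofSeries (k := k) i (MvPowerSeries.X i)
  rw [MvPowerSeries.pderiv_X_self] at e3
  have e4 : (ofSeries 1 : HDiff k n) = 1 := rfl
  rw [e4, one_mul, sub_eq_iff_eq_add] at e3
  rw [e1, e2, e3, add_comm hvar]

/-- Two tests recover the stratum. A geometric series in `x_i` belongs to the graded ring exactly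
when `u_i = 0`, and the graded product of `∂_i` and `x_i` contains `h` exactly when `u_i + v_i = 0`.
-/
theorem Admissible.sameGr_iff {O : Subring (MvPowerSeries (Fin n) k)} (hO : Admissible O)
    {w w' : WeightSpace n} (hw : w ∈ Wloc n) (hw' : w' ∈ Wloc n) :
    SameGr (coefsIn O : Set (HDiff k n)) w w' ↔ SameStratum w w' := by
  classical
  constructor
  · rintro ⟨h1, h2⟩ i
    have hmem : ∀ {v v' : WeightSpace n}, v ∈ Wloc n → v' ∈ Wloc n →
        gr v (coefsIn O : Set (HDiff k n)) = gr v' (coefsIn O : Set (HDiff k n)) → v.1 i = 0 →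
        v'.1 i = 0 := by
      intro v v' hv hv' h0 hi
      by_contra h'
      obtain ⟨f, hf, hf'⟩ := hO.geom_mem i
      have hcf : ∀ m : Mon n, (ofSeries f : HDiff k n).cf m ≠ 0 ↔
          m.2 = 0 ∧ ∃ a : ℕ, m.1 = Finsupp.single i a := fun m => by
        rw [ofSeries, cf_mono]
        by_cases h : (0, 0) = m.2
        · rw [if_pos h, hf', ← h]
          simp
        · rw [if_neg h]
          simp only [ne_eq, not_true_eq_false, false_iff, not_and]
          exact fun h3 => absurd h3.symm h
      have h3 : ofSeries f ∈ gr v (coefsIn O : Set (HDiff k n)) := by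
        refine hO.mem_gr_iff.2 ⟨mono_mem_coefsIn _ _ hf, (finWeight_iff hv _).2 ⟨0, ?_⟩⟩
        intro m hm l hl
        obtain ⟨-, a, ha⟩ := (hcf m).1 hm
        have : l ≠ i := by rintro rfl; exact hl hi
        rw [ha, Finsupp.single_eq_of_ne this]
      rw [h0, hO.mem_gr_iff, finWeight_iff hv'] at h3
      obtain ⟨-, N, hN⟩ := h3
      have := hN (Finsupp.single i (N + 1), 0) ((hcf _).2 ⟨rfl, N + 1, rfl⟩) i h'
      simp at this
    refine ⟨⟨hmem hw hw' h1, hmem hw' hw h1.symm⟩, ?_⟩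
    have hfin : ∀ (m : Mon n) (c : k), mono m.2.1 m.2.2 (MvPowerSeries.monomial m.1 c) ∈
        gr w (coefsIn O : Set (HDiff k n)) := by
      intro m c
      refine hO.mem_gr_iff.2 ⟨mono_mem_coefsIn _ _ (hO.monomial_mem _ _),
        (Set.finite_singleton (wt w m)).subset ?_⟩
      rintro _ ⟨m', hm', rfl⟩
      rw [cf_mono] at hm'
      split_ifs at hm' with h3
      · rw [MvPowerSeries.coeff_monomial] at hm'
        split_ifs at hm' with h4
        · rw [show m' = m from Prod.ext h4 h3.symm]; rfl
        · exact absurd rfl hm'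
      · exact absurd rfl hm'
    have h3 := h2 (del i) (hfin (ed i) 1) (ofSeries (MvPowerSeries.X i)) (hfin (ex i) 1)
    rw [grMul_del_ofSeries, grMul_del_ofSeries] at h3
    have h4 : ∀ v : WeightSpace n, (part v (v.2 i + v.1 i)
        (ofSeries (MvPowerSeries.X i) * del i + hvar : HDiff k n)).cf eh =
          if v.1 i + v.2 i = 0 then 1 else 0 := by
      intro v
      have e1 : wt v (eh : Mon n) = 0 := by simp [wt, weight, eh]
      have e2 : (hvar : HDiff k n).cf eh = 1 := by
        rw [hvar, cf_mono]
        simp [eh]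
      have e3 : (ofSeries (MvPowerSeries.X i) * del i : HDiff k n).cf eh = 0 := by
        rw [mul_def, op_ofSeries, opC_apply, del, smul_mono, cf_mono]
        simp [eh]
      rw [cf_part, cf_add, e1, e2, e3, zero_add, add_comm (v.2 i)]
      simp only [eq_comm]
    have h5 := congrArg (fun S => S.cf eh) h3
    simp only [h4] at h5
    split_ifs at h5 with h6 h7 h7
    · simp [h6, h7]
    · exact absurd h5 one_ne_zero
    · exact absurd h5.symm one_ne_zero
    · simp [h6, h7]
  · intro h
    have h0 : ∀ S : HDiff k n, FinWeight w S ↔ FinWeight w' S := fun S => by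
      rw [finWeight_iff hw, finWeight_iff hw']
      simp only [ne_eq, (h _).1]
    refine ⟨?_, fun S hS T hT => ?_⟩
    · ext S
      rw [hO.mem_gr_iff, hO.mem_gr_iff, h0]
    · have h1 := finWeight_of_mem_gr hS
      have h2 := finWeight_of_mem_gr hT
      exact grMul_eq_of_sameStratum hw hw' h h1 ((h0 S).1 h1) h2 ((h0 T).1 h2)

end HDiff

namespace HDiff

open Mon

/-! ### Dickson's lemma -/

theorem exists_finset_minimal {ι : Type*} [PartialOrder ι] [WellQuasiOrderedLE ι] (S : Set ι) :
    ∃ F : Finset ι, (F : Set ι) ⊆ S ∧ ∀ s ∈ S, ∃ f ∈ F, f ≤ s := by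
  have hfin : {x | Minimal (· ∈ S) x}.Finite :=
    WellQuasiOrderedLE.finite_of_isAntichain (setOfPred_minimal_antichain _)
  refine ⟨hfin.toFinset, fun x hx => ?_, fun s hs => ?_⟩
  · rw [Set.Finite.coe_toFinset] at hx
    exact hx.prop
  · obtain ⟨m, hm, h⟩ := exists_minimal_le_of_wellFoundedLT (· ∈ S) s hs
    exact ⟨m, by simpa using h, hm⟩

/-- In an ascending chain choose `m i ∈ f (i+1)` outside `f i`. Some `i < j` have `m i ≤ m j`, and
then `m j` already lies in the upper set `f j`. -/
theorem wellFounded_upperSet_lt (ι : Type*) [PartialOrder ι] [WellQuasiOrderedLE ι] :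
    WellFounded fun J J' : UpperSet ι => (J' : Set ι) ⊂ J := by
  rw [wellFounded_iff_isEmpty_descending_chain]
  refine ⟨fun ⟨f, hf⟩ => ?_⟩
  have hmono : ∀ i j, i ≤ j → (f i : Set ι) ⊆ f j := fun i j hij =>
    monotone_nat_of_le_succ (f := fun i => (f i : Set ι)) (fun i => (hf i).1) hij
  choose m hm using fun i => Set.exists_of_ssubset (hf i)
  obtain ⟨i, j, hij, h⟩ := wellQuasiOrdered_le m
  exact (hm j).2 ((f j).upper h (hmono _ _ (Nat.succ_le_of_lt hij) (hm i).1))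

variable {k : Type*} [Field k] {n : ℕ}

/-! ### Integral functionals on the weights -/

/-- The functional on weights with the given coefficients. -/
def ev (w : WeightSpace n) (a : (Fin n → ℤ) × (Fin n → ℤ)) : ℝ :=
  ∑ i, (a.1 i : ℝ) * w.1 i + ∑ i, (a.2 i : ℝ) * w.2 i

theorem ev_zero (w : WeightSpace n) : ev w 0 = 0 := by simp [ev]

theorem ev_add (w : WeightSpace n) (a b : (Fin n → ℤ) × (Fin n → ℤ)) :
    ev w (a + b) = ev w a + ev w b := by
  simp only [ev, Prod.fst_add, Prod.snd_add, Pi.add_apply, Int.cast_add, add_mul,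
    Finset.sum_add_distrib]
  ring

theorem ev_neg (w : WeightSpace n) (a : (Fin n → ℤ) × (Fin n → ℤ)) : ev w (-a) = -ev w a := by
  have := ev_add w (-a) a
  rw [neg_add_cancel, ev_zero] at this
  linarith

/-- The difference of the weights of two monomials. -/
def diff (ν m : Mon n) : (Fin n → ℤ) × (Fin n → ℤ) :=
  (fun i => (ν.1 i : ℤ) - m.1 i, fun i => (ν.2.1 i : ℤ) - m.2.1 i)

theorem ev_diff (w : WeightSpace n) (ν m : Mon n) : ev w (diff ν m) = wt w ν - wt w m := by
  simp only [ev, diff, wt, weight, Int.cast_sub, Int.cast_natCast, sub_mul,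
    Finset.sum_sub_distrib, mul_comm (w.1 _), mul_comm (w.2 _)]
  ring

theorem diff_self (m : Mon n) : diff m m = 0 := by
  simp only [diff, sub_self]; rfl

theorem diff_add_diff (a b c : Mon n) : diff a b + diff b c = diff a c := by
  refine Prod.ext (funext fun i => ?_) (funext fun i => ?_)
  · simp [diff]
  · simp [diff]

theorem diff_add_left (e ν m : Mon n) : diff (e + ν) (e + m) = diff ν m := by
  refine Prod.ext (funext fun i => ?_) (funext fun i => ?_)
  · simp [diff]
  · simp [diff]

/-- `diff` forgets the exponent of `h`, because `h` has weight zero; the degree recovers it. -/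
theorem eq_of_diff_eq_zero {ν m : Mon n} (h : diff ν m = 0) (hd : deg ν = deg m) : ν = m := by
  have h1 : ν.1 = m.1 := Finsupp.ext fun i => by
    have := congrFun (congrArg Prod.fst h) i
    simp only [diff, Prod.fst_zero, Pi.zero_apply] at this
    omega
  have h2 : ν.2.1 = m.2.1 := Finsupp.ext fun i => by
    have := congrFun (congrArg Prod.snd h) i
    simp only [diff, Prod.snd_zero, Pi.zero_apply] at this
    omega
  have h3 : ν.2.2 = m.2.2 := by
    simp only [deg, h2] at hd
    omega
  exact Prod.ext h1 (Prod.ext h2 h3)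

/-- The functional `u_i`. -/
def latX (i : Fin n) : (Fin n → ℤ) × (Fin n → ℤ) := (Pi.single i 1, 0)

/-- The functional `-(u_i + v_i)`. -/
def latXD (i : Fin n) : (Fin n → ℤ) × (Fin n → ℤ) := (-Pi.single i 1, -Pi.single i 1)

theorem ev_latX (w : WeightSpace n) (i : Fin n) : ev w (latX i) = w.1 i := by
  simp [ev, latX, Pi.single_apply]

theorem ev_latXD (w : WeightSpace n) (i : Fin n) : ev w (latXD i) = -(w.1 i + w.2 i) := by
  simp [ev, latXD, Pi.single_apply]
  ring

/-- The exponent vector of a monomial in `x` lies in every monoid that contains the `u_i`. -/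
theorem sum_latX_mem {𝓜 : AddSubmonoid ((Fin n → ℤ) × (Fin n → ℤ))} (h : ∀ i, latX i ∈ 𝓜)
    (α : Fin n →₀ ℕ) : ((fun i => (α i : ℤ), 0) : (Fin n → ℤ) × (Fin n → ℤ)) ∈ 𝓜 := by
  have : ((fun i => (α i : ℤ), 0) : (Fin n → ℤ) × (Fin n → ℤ)) = ∑ i, α i • latX i := by
    refine Prod.ext (funext fun j => ?_) (funext fun j => ?_)
    · simp [latX, Prod.fst_sum, Finset.sum_apply, Pi.single_apply]
    · simp [latX, Prod.snd_sum, Finset.sum_apply]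
  rw [this]
  exact sum_mem fun i _ => nsmul_mem (h i) _

theorem sum_latXD_mem {𝓜 : AddSubmonoid ((Fin n → ℤ) × (Fin n → ℤ))} (h : ∀ i, latXD i ∈ 𝓜)
    (γ : Fin n →₀ ℕ) :
    ((fun i => -(γ i : ℤ), fun i => -(γ i : ℤ)) : (Fin n → ℤ) × (Fin n → ℤ)) ∈ 𝓜 := by
  have : ((fun i => -(γ i : ℤ), fun i => -(γ i : ℤ)) : (Fin n → ℤ) × (Fin n → ℤ)) =
      ∑ i, γ i • latXD i := by
    refine Prod.ext (funext fun j => ?_) (funext fun j => ?_)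
    · simp [latXD, Prod.fst_sum, Finset.sum_apply, Pi.single_apply]
    · simp [latXD, Prod.snd_sum, Finset.sum_apply, Pi.single_apply]
  rw [this]
  exact sum_mem fun i _ => nsmul_mem (h i) _

/-- Contracting by `γ` subtracts `(γ, γ)`, which is the combination of the `latXD i` with
coefficients `γ_i`. -/
theorem diff_mem_of_contracts {𝓜 : AddSubmonoid ((Fin n → ℤ) × (Fin n → ℤ))}
    (h : ∀ i, latXD i ∈ 𝓜) {e κ : Mon n} (hc : Contracts e κ) : diff κ e ∈ 𝓜 := by
  obtain ⟨γ, hγ⟩ := hc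
  have e1 : diff κ e = (fun i => -(γ i : ℤ), fun i => -(γ i : ℤ)) := by
    refine Prod.ext (funext fun i => ?_) (funext fun i => ?_)
    · have := DFunLike.congr_fun (congrArg Prod.fst hγ) i
      simp only [Prod.fst_add, Finsupp.add_apply, Finsupp.zero_apply] at this
      simp only [diff]
      omega
    · have := DFunLike.congr_fun (congrArg (fun m : Mon n => m.2.1) hγ) i
      simp only [Prod.fst_add, Prod.snd_add, Finsupp.add_apply, Finsupp.zero_apply] at this
      simp only [diff]
      omega
  rw [e1]
  exact sum_latXD_mem h γ

/-! ### Generic weights -/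

/-- Weights in the interior of `Wloc` on which no integral functional vanishes. -/
structure Generic (ω : WeightSpace n) : Prop where
  neg : ∀ i, ω.1 i < 0
  pos : ∀ i, 0 < ω.1 i + ω.2 i
  inj : ∀ a, ev ω a = 0 → a = 0

theorem Generic.mem_Wloc {ω : WeightSpace n} (h : Generic ω) : ω ∈ Wloc n :=
  fun i => ⟨(h.neg i).le, (h.pos i).le⟩

theorem Generic.eq_of_wt_eq {ω : WeightSpace n} (h : Generic ω) {ν m : Mon n}
    (hd : deg ν = deg m) (hw : wt ω ν = wt ω m) : ν = m :=
  eq_of_diff_eq_zero (h.inj _ (by rw [ev_diff, hw, sub_self])) hd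

/-- The degree bounds `β` and `j`; since every `u_i` is negative, the lower bound on the weight then
bounds `α`. This substitutes for a well-order in the choice of leading monomials and in the
recursions. -/
theorem finite_above {ω : WeightSpace n} (hω : ∀ i, ω.1 i < 0) (d : ℕ) (c : ℝ) :
    {m : Mon n | deg m = d ∧ c ≤ wt ω m}.Finite := by
  obtain ⟨N, hN⟩ := exists_nat_ge (∑ i, |(d * ∑ j, |ω.2 j| - c) / ω.1 i|)
  refine (Set.finite_Iic ((Finsupp.equivFunOnFinite.symm fun _ => N,
    Finsupp.equivFunOnFinite.symm fun _ => d, d) : Mon n)).subset ?_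
  rintro m ⟨hm, hc⟩
  have hβ : ∀ i, m.2.1 i ≤ d := fun i => by
    have := Finsupp.le_degree i m.2.1
    simp only [deg] at hm
    omega
  refine ⟨fun i => ?_, fun i => hβ i, by simp only [deg] at hm; change m.2.2 ≤ d; omega⟩
  change m.1 i ≤ N
  have h2 : ∑ i, ω.2 i * (m.2.1 i : ℝ) ≤ d * ∑ j, |ω.2 j| := by
    rw [Finset.mul_sum]
    refine Finset.sum_le_sum fun j _ => ?_
    have h3 : (m.2.1 j : ℝ) ≤ d := by exact_mod_cast hβ j
    calc ω.2 j * (m.2.1 j : ℝ) ≤ |ω.2 j| * m.2.1 j := by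
          gcongr; exact le_abs_self _
      _ ≤ |ω.2 j| * d := by gcongr
      _ = d * |ω.2 j| := mul_comm _ _
  have h3 : ∑ j, ω.1 j * (m.1 j : ℝ) ≤ ω.1 i * m.1 i := by
    rw [← Finset.add_sum_erase _ _ (Finset.mem_univ i)]
    have := Finset.sum_nonpos (s := Finset.univ.erase i) (f := fun j => ω.1 j * (m.1 j : ℝ))
      fun j _ => mul_nonpos_of_nonpos_of_nonneg (hω j).le (Nat.cast_nonneg _)
    linarith
  rw [wt, weight] at hc
  have h5 : (m.1 i : ℝ) ≤ |(d * ∑ j, |ω.2 j| - c) / ω.1 i| := by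
    refine le_trans ?_ (neg_le_abs _)
    rw [← div_neg, le_div_iff₀ (by linarith [hω i])]
    linarith
  have h6 : |(d * ∑ j, |ω.2 j| - c) / ω.1 i| ≤ ∑ i, |(d * ∑ j, |ω.2 j| - c) / ω.1 i| :=
    Finset.single_le_sum (f := fun i => |(d * ∑ j, |ω.2 j| - c) / ω.1 i|) (fun i _ => abs_nonneg _)
      (Finset.mem_univ i)
  exact_mod_cast h5.trans (h6.trans hN)

/-- A monoid of functionals that contains those defining `Wloc` and is negative on `ω`. -/
structure Adapted (ω : WeightSpace n) (𝓜 : AddSubmonoid ((Fin n → ℤ) × (Fin n → ℤ))) : Prop where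
  neg : ∀ a ∈ 𝓜, a ≠ 0 → ev ω a < 0
  latX_mem : ∀ i, latX i ∈ 𝓜
  latXD_mem : ∀ i, latXD i ∈ 𝓜

/-- All functionals that are negative on `ω`, and zero. -/
def negMonoid (ω : WeightSpace n) : AddSubmonoid ((Fin n → ℤ) × (Fin n → ℤ)) where
  carrier := {a | a = 0 ∨ ev ω a < 0}
  zero_mem' := Or.inl rfl
  add_mem' := by
    rintro a b (rfl | ha) (rfl | hb)
    · simp
    · simpa using Or.inr hb
    · simpa using Or.inr ha
    · exact Or.inr (by rw [ev_add]; linarith)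

theorem Generic.adapted {ω : WeightSpace n} (h : Generic ω) : Adapted ω (negMonoid ω) where
  neg a ha h0 := ha.resolve_left h0
  latX_mem i := Or.inr (by rw [ev_latX]; exact h.neg i)
  latXD_mem i := Or.inr (by rw [ev_latXD]; linarith [h.pos i])

/-! ### Leading monomials of homogeneous ideals -/

/-- A left ideal of the ring of the elements with coefficients in `O` that contains the
homogeneous components of its elements. -/
structure IsHomIdeal (O : Subring (MvPowerSeries (Fin n) k)) (I : AddSubgroup (HDiff k n)) :
    Prop where
  le : I ≤ coefsIn O
  mul_mem : ∀ P ∈ coefsIn O, ∀ Q ∈ I, P * Q ∈ I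
  comp_mem : ∀ Q ∈ I, ∀ d, comp d Q ∈ I

/-- `P ∈ I` is homogeneous, `m` occurs with coefficient one, and the other monomials of `P` differ
from `m` by elements of `𝓜`. -/
structure Leads (I : AddSubgroup (HDiff k n)) (𝓜 : AddSubmonoid ((Fin n → ℤ) × (Fin n → ℤ)))
    (P : HDiff k n) (m : Mon n) : Prop where
  mem : P ∈ I
  cf_eq_one : P.cf m = 1
  homog : IsHomog (deg m) P
  diff_mem : ∀ ν, P.cf ν ≠ 0 → diff ν m ∈ 𝓜

/-- The leading monomials of the homogeneous elements of `I`. -/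
def leadSet (ω : WeightSpace n) (I : AddSubgroup (HDiff k n)) : Set (Mon n) :=
  {m | ∃ P, Leads I (negMonoid ω) P m}

/-- A monomial of `A * P` is a contraction of some `e + ν`, so its difference from `e + m` is one
from a contraction plus `diff ν m`, both in `𝓜`. -/
theorem Leads.mul {O : Subring (MvPowerSeries (Fin n) k)} {I : AddSubgroup (HDiff k n)}
    (hI : IsHomIdeal O I) {ω : WeightSpace n} {𝓜 : AddSubmonoid ((Fin n → ℤ) × (Fin n → ℤ))}
    (h𝓜 : Adapted ω 𝓜) {P A : HDiff k n} {m e : Mon n} (h : Leads I 𝓜 P m) (hA : A ∈ coefsIn O)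
    (hAe : ∀ μ, A.cf μ ≠ 0 → μ = e) (h1 : (A * P).cf (e + m) = 1) : Leads I 𝓜 (A * P) (e + m) := by
  have key : ∀ κ, (A * P).cf κ ≠ 0 → ∃ ν, P.cf ν ≠ 0 ∧ Contracts (e + ν) κ := fun κ hκ => by
    obtain ⟨μ, ν, h2, h3, h4⟩ := exists_contracts_of_cf_mul_ne_zero hκ
    rw [hAe μ h2] at h4
    exact ⟨ν, h3, h4⟩
  refine ⟨hI.mul_mem _ hA _ h.mem, h1, fun κ hκ => ?_, fun κ hκ => ?_⟩
  · obtain ⟨ν, h3, h4⟩ := key κ hκ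
    rw [h4.deg_eq, deg_add, deg_add, h.homog ν h3]
  · obtain ⟨ν, h3, h4⟩ := key κ hκ
    rw [← diff_add_diff κ (e + ν), diff_add_left]
    exact 𝓜.add_mem (diff_mem_of_contracts h𝓜.latXD_mem h4) (h.diff_mem ν h3)

theorem cf_ofSeries_monomial_mul (α : Fin n →₀ ℕ) (a : k) (P : HDiff k n) (m : Mon n) :
    (ofSeries (MvPowerSeries.monomial α a) * P).cf ((α, 0) + m) = a * P.cf m := by
  rw [mul_def, op_ofSeries, opC_apply]
  simp only [cf, coef_smul, Prod.fst_add, Prod.snd_add, zero_add,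
    MvPowerSeries.coeff_add_monomial_mul]

theorem cf_ofSeries_monomial_ne_zero {α : Fin n →₀ ℕ} {a : k} {m : Mon n}
    (h : (ofSeries (MvPowerSeries.monomial α a) : HDiff k n).cf m ≠ 0) : m = (α, 0) := by
  classical
  rw [ofSeries, cf_mono] at h
  split_ifs at h with h1
  · rw [MvPowerSeries.coeff_monomial] at h
    split_ifs at h with h2
    · exact Prod.ext h2 h1.symm
    · exact absurd rfl h
  · exact absurd rfl h

/-- The exponents `e` that can be added form a monoid, so it suffices to multiply from the left by
`x_i`, `∂_i` and `h`. -/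
theorem Leads.exists_add {O : Subring (MvPowerSeries (Fin n) k)} (hO : Admissible O)
    {I : AddSubgroup (HDiff k n)}
    (hI : IsHomIdeal O I) {ω : WeightSpace n} {𝓜 : AddSubmonoid ((Fin n → ℤ) × (Fin n → ℤ))}
    (h𝓜 : Adapted ω 𝓜) {P : HDiff k n} {m : Mon n} (h : Leads I 𝓜 P m) (e : Mon n) :
    ∃ P', Leads I 𝓜 P' (e + m) := by
  let S : AddSubmonoid (Mon n) :=
    { carrier := {e | ∀ P m, Leads I 𝓜 P m → ∃ P', Leads I 𝓜 P' (e + m)}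
      zero_mem' := fun P m h => ⟨P, by rwa [zero_add]⟩
      add_mem' := fun {a b} ha hb P m h => by
        obtain ⟨P', h'⟩ := hb P m h
        obtain ⟨P'', h''⟩ := ha P' _ h'
        exact ⟨P'', by rwa [add_assoc]⟩ }
  have hone : (1 : MvPowerSeries (Fin n) k) ∈ O := O.one_mem
  have hx : ∀ i, ex i ∈ S := fun i P m h => by
    refine ⟨ofSeries (MvPowerSeries.monomial (Finsupp.single i 1) 1) * P, h.mul hI h𝓜
      (mono_mem_coefsIn _ _ (hO.monomial_mem _ _))
      (fun μ hμ => cf_ofSeries_monomial_ne_zero hμ) ?_⟩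
    have := cf_ofSeries_monomial_mul (Finsupp.single i 1) 1 P m
    rw [one_mul, h.cf_eq_one] at this
    exact this
  have hmono : ∀ (β : Fin n →₀ ℕ) (j : ℕ) μ, (mono β j 1 : HDiff k n).cf μ ≠ 0 → μ = (0, β, j) := by
    classical
    intro β j μ hμ
    rw [cf_mono] at hμ
    split_ifs at hμ with h1
    · rw [MvPowerSeries.coeff_one] at hμ
      split_ifs at hμ with h2
      · exact Prod.ext h2 h1.symm
      · exact absurd rfl hμ
    · exact absurd rfl hμ
  have hh : eh ∈ S := fun P m h => by
    refine ⟨hvar * P, h.mul hI h𝓜 (mono_mem_coefsIn _ _ hone) (fun μ hμ => hmono _ _ _ hμ) ?_⟩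
    rw [mul_def, op_hvar, cf_opH_add, h.cf_eq_one]
  have hd : ∀ i, ed i ∈ S := fun i P m h => by
    refine ⟨del i * P, h.mul hI h𝓜 (mono_mem_coefsIn _ _ hone) (fun μ hμ => hmono _ _ _ hμ) ?_⟩
    rw [mul_def, op_del, cf_opD]
    have e1 : ((ed i + m).1, (ed i + m).2.1 - Finsupp.single i 1, (ed i + m).2.2) = m := by
      refine Prod.ext (by simp [ed]) (Prod.ext ?_ (by simp [ed]))
      simp [ed]
    have e2 : Finsupp.single i 1 ≤ (ed i + m).2.1 := by simp [ed]
    rw [if_pos e2, e1, h.cf_eq_one, add_eq_left]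
    split_ifs with h2
    · rw [mul_eq_zero]
      left
      -- The derivative term of `∂_i P` could spoil the leading coefficient only through a monomial
      -- of `P` differing from `m` by `-latXD i`. As `latXD i` lies in `𝓜` and is negative on `ω`,
      -- its opposite is not in `𝓜`.
      by_contra h3
      have h4 := h.diff_mem _ h3
      have h5 : diff ((ed i + m).1 + Finsupp.single i 1, (ed i + m).2.1, (ed i + m).2.2 - 1) m =
          -latXD i := by
        refine Prod.ext (funext fun j => ?_) (funext fun j => ?_)
        · simp [diff, latXD, ed, Finsupp.single_apply, Pi.single_apply, eq_comm]
        · simp [diff, latXD, ed, Finsupp.single_apply, Pi.single_apply, eq_comm]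
      have h6 : latXD i ≠ 0 := fun h0 => by
        have := congrFun (congrArg Prod.fst h0) i
        simp [latXD] at this
      have h7 := h𝓜.neg _ (h𝓜.latXD_mem i) h6
      rw [h5] at h4
      have h8 := h𝓜.neg _ h4 (neg_ne_zero.2 h6)
      rw [ev_neg] at h8
      linarith
    · rfl
  have hα : ∀ α : Fin n →₀ ℕ, ((α, 0, 0) : Mon n) ∈ S := fun α => by
    induction α using Finsupp.induction_linear with
    | zero => exact S.zero_mem
    | add f g hf hg => simpa using S.add_mem hf hg
    | single i a => simpa [ex] using S.nsmul_mem (hx i) a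
  have hβ : ∀ α : Fin n →₀ ℕ, ((0, α, 0) : Mon n) ∈ S := fun α => by
    induction α using Finsupp.induction_linear with
    | zero => exact S.zero_mem
    | add f g hf hg => simpa using S.add_mem hf hg
    | single i a => simpa [ed] using S.nsmul_mem (hd i) a
  have hj : ∀ j : ℕ, ((0, 0, j) : Mon n) ∈ S := fun j => by
    simpa [eh] using S.nsmul_mem hh j
  have he : e = (e.1, 0, 0) + (0, e.2.1, 0) + (0, 0, e.2.2) := by simp
  rw [he]
  exact S.add_mem (S.add_mem (hα _) (hβ _)) (hj _) P m h

theorem isUpperSet_leadSet {O : Subring (MvPowerSeries (Fin n) k)} (hO : Admissible O)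
    {I : AddSubgroup (HDiff k n)} (hI : IsHomIdeal O I) {ω : WeightSpace n} (hω : Generic ω) :
    IsUpperSet (leadSet ω I) := by
  rintro m m' hm ⟨P, hP⟩
  obtain ⟨P', h'⟩ := hP.exists_add hO hI hω.adapted (m' - m)
  rw [tsub_add_cancel_of_le hm] at h'
  exact ⟨P', h'⟩

/-- Among the finitely many monomials of `P` of the degree of `ν` and at least its weight, one has
maximal weight. Genericity excludes ties, and the component of `P` of that degree, suitably
normalized, has it as leading monomial. -/
theorem exists_lead {O : Subring (MvPowerSeries (Fin n) k)} (hO : Admissible O)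
    {I : AddSubgroup (HDiff k n)} (hI : IsHomIdeal O I) {ω : WeightSpace n} (hω : Generic ω)
    {P : HDiff k n} (hP : P ∈ I) {ν : Mon n} (hν : P.cf ν ≠ 0) :
    ∃ m ∈ leadSet ω I, P.cf m ≠ 0 ∧ deg m = deg ν ∧ wt ω ν ≤ wt ω m := by
  have hfin : ({m : Mon n | deg m = deg ν ∧ wt ω ν ≤ wt ω m} ∩ {m | P.cf m ≠ 0}).Finite :=
    (finite_above hω.neg (deg ν) (wt ω ν)).inter_of_left _
  obtain ⟨m, ⟨⟨hd, hw⟩, hm⟩, hmax⟩ := Set.exists_max_image _ (wt ω) hfin ⟨ν, ⟨rfl, le_rfl⟩, hν⟩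
  have hm : P.cf m ≠ 0 := hm
  refine ⟨m, ⟨ofSeries (MvPowerSeries.monomial 0 (P.cf m)⁻¹) * comp (deg ν) P, ?_⟩, hm, hd, hw⟩
  have key : ∀ μ, (ofSeries (MvPowerSeries.monomial 0 (P.cf m)⁻¹) * comp (deg ν) P).cf μ =
      (P.cf m)⁻¹ * (comp (deg ν) P).cf μ := fun μ => by
    have := cf_ofSeries_monomial_mul 0 (P.cf m)⁻¹ (comp (deg ν) P) μ
    rwa [show ((0, 0) : Mon n) = 0 from rfl, zero_add] at this
  have hne : ∀ μ, (ofSeries (MvPowerSeries.monomial 0 (P.cf m)⁻¹) * comp (deg ν) P).cf μ ≠ 0 →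
      deg μ = deg ν ∧ P.cf μ ≠ 0 := fun μ hμ => by
    rw [key, cf_comp] at hμ
    have h1 := right_ne_zero_of_mul hμ
    split_ifs at h1 with h2
    · exact ⟨h2, h1⟩
    · exact absurd rfl h1
  refine ⟨hI.mul_mem _ (mono_mem_coefsIn _ _ (hO.monomial_mem _ _)) _ (hI.comp_mem _ hP _), ?_,
    fun μ hμ => ?_, fun μ hμ => ?_⟩
  · rw [key, cf_comp, if_pos hd, inv_mul_cancel₀ hm]
  · rw [(hne μ hμ).1, hd]
  · obtain ⟨h1, h2⟩ := hne μ hμ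
    by_cases h3 : wt ω μ < wt ω m
    · exact Or.inr (by rw [ev_diff]; linarith)
    · left
      have h4 := hmax μ ⟨⟨h1, hw.trans (not_lt.1 h3)⟩, h2⟩
      rw [hω.eq_of_wt_eq (h1.trans hd.symm) (le_antisymm h4 (not_lt.1 h3)), diff_self]

end HDiff

namespace HDiff

open Mon

variable {k : Type*} [Field k] {n : ℕ}

/-! ### Division -/

theorem exists_rec {ι κ : Type*} [AddCommMonoid κ] {r : ι → ι → Prop} (hr : WellFounded r)
    (s : ι → Finset ι) (hs : ∀ μ, ∀ ν ∈ s μ, r ν μ) (t : ι → ι → κ → κ) (F : ι → κ → κ) :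
    ∃ a : ι → κ, ∀ μ, a μ = F μ (∑ ν ∈ s μ, t μ ν (a ν)) := by
  refine ⟨hr.fix fun μ a => F μ (∑ ν ∈ (s μ).attach, t μ ν (a ν (hs μ ν ν.2))), fun μ => ?_⟩
  rw [hr.fix_eq, ← Finset.sum_attach (s μ)]

/-- Passing to a monomial of degree `d` and larger weight strictly decreases the finite number of
monomials of degree `d` that lie above. -/
theorem wellFounded_above {ω : WeightSpace n} (hω : ∀ i, ω.1 i < 0) (d : ℕ) :
    WellFounded fun ν μ : Mon n => deg ν = d ∧ wt ω μ < wt ω ν := by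
  refine Subrelation.wf (r := fun ν μ => {κ : Mon n | deg κ = d ∧ wt ω ν < wt ω κ}.ncard <
    {κ : Mon n | deg κ = d ∧ wt ω μ < wt ω κ}.ncard) ?_ (measure _).wf
  intro ν μ h
  refine Set.ncard_lt_ncard ⟨fun κ hκ => ⟨hκ.1, h.2.trans hκ.2⟩, fun h' => ?_⟩
    ((finite_above hω d (wt ω μ)).subset fun κ hκ => ⟨hκ.1, hκ.2.le⟩)
  exact lt_irrefl _ (h' ⟨h.1, h.2⟩).2

/-- The coefficient of `μ` in the multiple of `P (b ν)` by the power of `x` that leads from `b ν`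
to `ν`. -/
noncomputable def shiftCf (P : Mon n → HDiff k n) (b : Mon n → Mon n) (μ ν : Mon n) : k :=
  (MvPowerSeries.monomial (ν.1 - (b ν).1) (1 : k) • P (b ν)).cf μ

theorem shiftCf_eq (P : Mon n → HDiff k n) (b : Mon n → Mon n) (μ ν : Mon n) :
    shiftCf P b μ ν = if ν.1 - (b ν).1 ≤ μ.1 then
      (P (b ν)).cf (μ.1 - (ν.1 - (b ν).1), μ.2) else 0 := by
  simp only [shiftCf, cf, coef_smul, MvPowerSeries.coeff_monomial_mul, one_mul]

/-- Multiplication by a power of `x` is harmless for the weights of the terms. -/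
theorem exists_of_shiftCf_ne_zero {P : Mon n → HDiff k n} {b : Mon n → Mon n} {μ ν : Mon n}
    (h : shiftCf P b μ ν ≠ 0) (hb : ∃ δ, ν = (δ, 0) + b ν) :
    ∃ κ, (P (b ν)).cf κ ≠ 0 ∧ ∃ δ : Fin n →₀ ℕ, ν = (δ, 0) + b ν ∧ μ = (δ, 0) + κ := by
  rw [shiftCf_eq] at h
  split_ifs at h with h1
  · refine ⟨_, h, ν.1 - (b ν).1, ?_, ?_⟩
    · obtain ⟨δ, hδ⟩ := hb
      have : ν.1 - (b ν).1 = δ := by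
        have := congrArg Prod.fst hδ
        rw [this]
        simp
      rwa [this]
    · exact Prod.ext (by simp [add_tsub_cancel_of_le h1]) (by simp)
  · exact absurd rfl h

/-- The quotients of divisions with respect to weights `ω` with negative `u` stay in `O`. -/
def DivStable (O : Subring (MvPowerSeries (Fin n) k)) : Prop :=
  ∀ (ω : WeightSpace n) (d : ℕ) (P : Mon n → HDiff k n) (B : Finset (Mon n)) (f : HDiff k n)
    (b : Mon n → Mon n) (a : Mon n → k) (s : Mon n → Finset (Mon n)),
    (∀ i, ω.1 i < 0) →
    (∀ m ∈ B, P m ∈ coefsIn O ∧ ∀ ν, (P m).cf ν ≠ 0 → ν ≠ m → wt ω ν < wt ω m) →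
    f ∈ coefsIn O → IsHomog d f →
    (∀ μ, a μ ≠ 0 → deg μ = d ∧ b μ ∈ B ∧ ∃ δ, μ = (δ, 0) + b μ) →
    (∀ μ, ∀ ν ∈ s μ, wt ω μ < wt ω ν) →
    (∀ μ, a μ ≠ 0 → a μ = f.cf μ - ∑ ν ∈ s μ, shiftCf P b μ ν * a ν) →
    ∀ q, (fun α => a (α, q) : MvPowerSeries (Fin n) k) ∈ O

theorem Leads.wt_lt {I : AddSubgroup (HDiff k n)} {ω : WeightSpace n}
    {𝓜 : AddSubmonoid ((Fin n → ℤ) × (Fin n → ℤ))} (h𝓜 : Adapted ω 𝓜) {P : HDiff k n} {m : Mon n}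
    (h : Leads I 𝓜 P m) {ν : Mon n} (hν : P.cf ν ≠ 0) (hne : ν ≠ m) : wt ω ν < wt ω m := by
  have h1 := h𝓜.neg _ (h.diff_mem ν hν) fun h0 => hne (eq_of_diff_eq_zero h0 (h.homog ν hν))
  rw [ev_diff] at h1
  linarith

/-- A given degree allows finitely many `(β, j)`, and Dickson's lemma applies to the exponents of
`x` for each. Within one degree only multiples by powers of `x` are then needed, so division takes
place over the commutative ring of series. -/
theorem exists_base (E : Set (Mon n)) (d : ℕ) : ∃ B : Finset (Mon n), (∀ b ∈ B, b ∈ E) ∧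
    ∀ μ ∈ E, deg μ = d → ∃ b ∈ B, ∃ δ : Fin n →₀ ℕ, μ = (δ, 0) + b := by
  classical
  choose F hF using fun q : (Fin n →₀ ℕ) × ℕ => exists_finset_minimal {α | (α, q) ∈ E}
  have hfin : {q : (Fin n →₀ ℕ) × ℕ | q.1.degree + q.2 = d}.Finite := by
    refine (Set.finite_Iic ((Finsupp.equivFunOnFinite.symm fun _ => d, d) :
      (Fin n →₀ ℕ) × ℕ)).subset ?_
    rintro q hq
    have hq : q.1.degree + q.2 = d := hq
    refine ⟨fun i => ?_, by change q.2 ≤ d; omega⟩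
    have := Finsupp.le_degree i q.1
    change q.1 i ≤ d
    omega
  refine ⟨hfin.toFinset.biUnion fun q => (F q).image fun α => (α, q), fun b hb => ?_,
    fun μ hμ hd => ?_⟩
  · simp only [Finset.mem_biUnion, Finset.mem_image] at hb
    obtain ⟨q, -, α, hα, rfl⟩ := hb
    exact (hF q).1 hα
  · obtain ⟨α, hα, hle⟩ := (hF μ.2).2 μ.1 hμ
    refine ⟨(α, μ.2), ?_, μ.1 - α, Prod.ext (by simp [tsub_add_cancel_of_le hle]) (by simp)⟩
    simp only [Finset.mem_biUnion, Finset.mem_image]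
    exact ⟨μ.2, by simpa [deg] using hd, α, hα, rfl⟩

/-- Each `ν` is charged to the single divisor `b ν`, so a pair of a divisor `m` and a term `x^δ` of
its quotient corresponds to the monomial `ν = (δ, 0) + m` with `b ν = m`. -/
theorem sum_smul_cf_eq_sum_shiftCf (P : Mon n → HDiff k n) (B : Finset (Mon n))
    (b : Mon n → Mon n) (a : Mon n → k) (μ : Mon n) (A : Finset (Mon n))
    (ha : ∀ μ, a μ ≠ 0 → b μ ∈ B ∧ ∃ δ, μ = (δ, 0) + b μ)
    (hA : ∀ ν, a ν ≠ 0 → shiftCf P b μ ν ≠ 0 → ν ∈ A) (Q : Mon n → MvPowerSeries (Fin n) k)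
    [∀ m m' : Mon n, Decidable (m = m')]
    (hQ : ∀ m α, MvPowerSeries.coeff α (Q m) =
      if b ((α, 0) + m) = m then a ((α, 0) + m) else 0) :
    (∑ m ∈ B, Q m • P m).cf μ = ∑ ν ∈ A, shiftCf P b μ ν * a ν := by
  rw [cf_sum]
  simp only [cf_smul]
  rw [← Finset.sum_product' B (Finset.HasAntidiagonal.antidiagonal μ.1)
    fun (m : Mon n) (p : (Fin n →₀ ℕ) × (Fin n →₀ ℕ)) => MvPowerSeries.coeff p.1 (Q m) * (P m).cf (p.2, μ.2)]
  have hcf : ∀ (m : Mon n) (p : (Fin n →₀ ℕ) × (Fin n →₀ ℕ)), p.1 + p.2 = μ.1 →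
      MvPowerSeries.coeff p.1 (Q m) ≠ 0 → b ((p.1, 0) + m) = m ∧
      MvPowerSeries.coeff p.1 (Q m) = a ((p.1, 0) + m) ∧
      (P m).cf (p.2, μ.2) = shiftCf P b μ ((p.1, 0) + m) := fun m p hp h => by
    rw [hQ] at h ⊢
    split_ifs at h ⊢ with h1
    · refine ⟨h1, rfl, ?_⟩
      rw [shiftCf_eq, h1]
      have e : ((p.1, 0) + m : Mon n).1 - m.1 = p.1 := by simp
      rw [e, if_pos (hp ▸ le_self_add), ← hp, add_tsub_cancel_left]
    · exact absurd rfl h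
  refine Finset.sum_bij_ne_zero (fun z _ _ => (z.2.1, 0) + z.1) ?_ ?_ ?_ ?_
  · rintro ⟨m, p⟩ h1 h2
    rw [Finset.mem_product, Finset.HasAntidiagonal.mem_antidiagonal] at h1
    obtain ⟨h3, h4, h5⟩ := hcf m p h1.2 (left_ne_zero_of_mul h2)
    rw [h4, h5] at h2
    exact hA _ (left_ne_zero_of_mul h2) (right_ne_zero_of_mul h2)
  · rintro ⟨m, p⟩ h1 h2 ⟨m', p'⟩ h1' h2' h
    rw [Finset.mem_product, Finset.HasAntidiagonal.mem_antidiagonal] at h1 h1'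
    obtain ⟨h3, -, -⟩ := hcf m p h1.2 (left_ne_zero_of_mul h2)
    obtain ⟨h3', -, -⟩ := hcf m' p' h1'.2 (left_ne_zero_of_mul h2')
    have h : (p.1, 0) + m = (p'.1, 0) + m' := h
    have hm : m = m' := by rw [← h3, ← h3', h]
    subst hm
    have hp1 : p.1 = p'.1 := by simpa using congrArg Prod.fst h
    have hp2 : p.2 = p'.2 := by
      have := h1.2.trans h1'.2.symm
      rw [hp1] at this
      exact add_left_cancel this
    rw [Prod.ext hp1 hp2]
  · intro ν hν h
    have h1 := left_ne_zero_of_mul h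
    have h2 := right_ne_zero_of_mul h
    obtain ⟨hb, hδ⟩ := ha ν h2
    obtain ⟨κ, h3, δ, h4, h5⟩ := exists_of_shiftCf_ne_zero h1 hδ
    have h6 : MvPowerSeries.coeff δ (Q (b ν)) = a ν := by
      rw [hQ, ← h4, if_pos rfl]
    refine ⟨(b ν, (δ, κ.1)), ?_, ?_, h4.symm⟩
    · rw [Finset.mem_product, Finset.HasAntidiagonal.mem_antidiagonal]
      exact ⟨hb, by rw [h5]; rfl⟩
    · change MvPowerSeries.coeff δ (Q (b ν)) * (P (b ν)).cf (κ.1, μ.2) ≠ 0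
      have h7 : (κ.1, μ.2) = κ := by rw [h5]; simp
      rw [h6, h7]
      exact mul_ne_zero h2 h3
  · rintro ⟨m, p⟩ h1 h2
    rw [Finset.mem_product, Finset.HasAntidiagonal.mem_antidiagonal] at h1
    obtain ⟨h3, h4, h5⟩ := hcf m p h1.2 (left_ne_zero_of_mul h2)
    rw [h4, h5, mul_comm]

/-- Every homogeneous element agrees with an element of `I` on the leading monomials. -/
theorem exists_division {O : Subring (MvPowerSeries (Fin n) k)} (hO : Admissible O)
    (hdiv : DivStable O) {I : AddSubgroup (HDiff k n)} (hI : IsHomIdeal O I) {ω : WeightSpace n}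
    (hω : Generic ω) {𝓜 : AddSubmonoid ((Fin n → ℤ) × (Fin n → ℤ))} (h𝓜 : Adapted ω 𝓜)
    {E : Set (Mon n)} (hE : ∀ m ∈ E, ∃ P, Leads I 𝓜 P m) {f : HDiff k n} (hf : f ∈ coefsIn O)
    {d : ℕ} (hd : IsHomog d f) :
    ∃ q ∈ I, IsHomog d q ∧ (∀ m ∈ E, q.cf m = f.cf m) ∧
      ∀ ν, q.cf ν ≠ 0 → ∃ μ, f.cf μ ≠ 0 ∧ diff ν μ ∈ 𝓜 := by
  classical
  obtain ⟨B₀, hB₀, hB₀'⟩ := exists_base E d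
  have h0 : ∀ m, ∃ P : HDiff k n, m ∈ E → Leads I 𝓜 P m := fun m => by
    by_cases h : m ∈ E
    · obtain ⟨P, hP⟩ := hE m h; exact ⟨P, fun _ => hP⟩
    · exact ⟨0, fun h' => absurd h' h⟩
  choose P hP using h0
  have h1 : ∀ μ, ∃ b : Mon n, μ ∈ E → deg μ = d → b ∈ B₀ ∧ ∃ δ : Fin n →₀ ℕ, μ = (δ, 0) + b :=
    fun μ => by
    by_cases h : μ ∈ E ∧ deg μ = d
    · obtain ⟨b, hb⟩ := hB₀' μ h.1 h.2; exact ⟨b, fun _ _ => hb⟩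
    · exact ⟨0, fun h1 h2 => absurd ⟨h1, h2⟩ h⟩
  choose b hb using h1
  have hdegb : ∀ μ, μ ∈ E → deg μ = d → deg (b μ) = d := fun μ h1 h2 => by
    obtain ⟨-, δ, hδ⟩ := hb μ h1 h2
    rw [← h2, hδ, deg_add]
    simp [deg, ← hδ]
  let up : Mon n → Finset (Mon n) := fun μ => (finite_above hω.neg d (wt ω μ)).toFinset
  have hup : ∀ μ ν, ν ∈ up μ ↔ deg ν = d ∧ wt ω μ ≤ wt ω ν := fun μ ν => by simp [up]
  let A : Mon n → Finset (Mon n) := fun μ => (up μ).filter (· ∈ E)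
  let s : Mon n → Finset (Mon n) := fun μ => (A μ).filter fun ν => wt ω μ < wt ω ν
  have hA : ∀ μ ν, ν ∈ A μ ↔ (deg ν = d ∧ wt ω μ ≤ wt ω ν) ∧ ν ∈ E := fun μ ν => by
    rw [Finset.mem_filter, hup]
  have hs : ∀ μ ν, ν ∈ s μ ↔ ((deg ν = d ∧ wt ω μ ≤ wt ω ν) ∧ ν ∈ E) ∧ wt ω μ < wt ω ν :=
    fun μ ν => by rw [Finset.mem_filter, hA]
  -- `a μ` is what remains of the coefficient of `f` at `μ ∈ E` after the multiples chosen for the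
  -- monomials of larger weight are subtracted.
  obtain ⟨a, ha⟩ := exists_rec (wellFounded_above hω.neg d) s
    (fun μ ν hν => ⟨((hs μ ν).1 hν).1.1.1, ((hs μ ν).1 hν).2⟩)
    (fun μ ν c => shiftCf P b μ ν * c)
    (fun μ c => if μ ∈ E ∧ deg μ = d then f.cf μ - c else 0)
  have ha0 : ∀ μ, a μ ≠ 0 → μ ∈ E ∧ deg μ = d := fun μ h => by
    by_contra h'
    rw [ha, if_neg h'] at h
    exact h rfl
  have ha1 : ∀ μ, μ ∈ E → deg μ = d → a μ = f.cf μ - ∑ ν ∈ s μ, shiftCf P b μ ν * a ν :=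
    fun μ h h' => by
      conv_lhs => rw [ha, if_pos ⟨h, h'⟩]
  have hlead : ∀ ν, ν ∈ E → deg ν = d → Leads I 𝓜 (P (b ν)) (b ν) := fun ν h h' =>
    hP _ (hB₀ _ (hb ν h h').1)
  have hdiff : ∀ μ ν, ν ∈ E → deg ν = d → shiftCf P b μ ν ≠ 0 →
      deg μ = d ∧ diff μ ν ∈ 𝓜 ∧ (μ = ν ∨ wt ω μ < wt ω ν) := fun μ ν h h' ht => by
    obtain ⟨κ, h3, δ, h4, h5⟩ := exists_of_shiftCf_ne_zero ht (hb ν h h').2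
    have hl := hlead ν h h'
    have h6 : deg μ = d := by
      rw [← h', h4, h5, deg_add, deg_add, hl.homog κ h3]
    refine ⟨h6, ?_, ?_⟩
    · rw [h4, h5, diff_add_left]
      exact hl.diff_mem κ h3
    · by_cases h7 : κ = b ν
      · left; rw [h5, h7, ← h4]
      · right
        have h8 := hl.wt_lt h𝓜 h3 h7
        rw [h4, h5, wt_add, wt_add]
        linarith
  have hself : ∀ μ, μ ∈ E → deg μ = d → shiftCf P b μ μ = 1 := fun μ h h' => by
    obtain ⟨δ, hδ⟩ := (hb μ h h').2
    have e1 : μ.1 - (b μ).1 = δ := by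
      have := congrArg Prod.fst hδ
      rw [this]
      simp
    have e2 : (μ.1 - δ, μ.2) = b μ := by
      refine Prod.ext ?_ ?_
      · rw [congrArg Prod.fst hδ]
        simp
      · rw [congrArg Prod.snd hδ]
        simp
    rw [shiftCf_eq, e1, e2, (hlead μ h h').cf_eq_one, if_pos]
    rw [congrArg Prod.fst hδ]
    exact le_self_add
  have hser := hdiv ω d P B₀ f b a s hω.neg
    (fun m hm => ⟨hI.le (hP m (hB₀ m hm)).mem, fun ν hν hne => (hP m (hB₀ m hm)).wt_lt h𝓜 hν hne⟩)
    hf hd (fun μ hμ => ⟨(ha0 μ hμ).2, hb μ (ha0 μ hμ).1 (ha0 μ hμ).2⟩)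
    (fun μ ν hν => ((hs μ ν).1 hν).2) (fun μ hμ => ha1 μ (ha0 μ hμ).1 (ha0 μ hμ).2)
  -- The quotient belonging to `P m` collects the coefficients charged to `m`. It lies in `O` as a
  -- restriction of a shift of the series in `hser`.
  let Q : Mon n → MvPowerSeries (Fin n) k := fun m α =>
    if b ((α, 0) + m) = m then a ((α, 0) + m) else 0
  have hQO : ∀ m, Q m ∈ O := fun m => by
    have := hO.restr_mem _ (hser m.2) m.1 {α | b ((α, 0) + m) = m}
    have e : Q m = fun α => if b ((α, 0) + m) = m then a (α + m.1, m.2) else 0 :=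
      funext fun α => by
        have e : ((α, 0) + m : Mon n) = (α + m.1, m.2) := Prod.ext rfl (by simp)
        simp only [Q, e]
    rw [e]
    exact this
  have hq : ∀ μ, (∑ m ∈ B₀, Q m • P m).cf μ = ∑ ν ∈ A μ, shiftCf P b μ ν * a ν := fun μ =>
    sum_smul_cf_eq_sum_shiftCf P B₀ b a μ (A μ)
      (fun ν hν => hb ν (ha0 ν hν).1 (ha0 ν hν).2)
      (fun ν hν ht => by
        obtain ⟨h1, h2⟩ := ha0 ν hν
        obtain ⟨h3, -, h4⟩ := hdiff μ ν h1 h2 ht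
        rw [hA]
        refine ⟨⟨h2, ?_⟩, h1⟩
        rcases h4 with rfl | h4
        · exact le_rfl
        · exact h4.le) Q (fun m α => rfl)
  have hqE : ∀ μ, μ ∈ E → deg μ = d → (∑ m ∈ B₀, Q m • P m).cf μ = f.cf μ := fun μ h h' => by
    -- By genericity `μ` is the only leading monomial of its weight and degree. Its own multiple
    -- contributes `a μ`, so the recursion makes the coefficient equal to that of `f`.
    have e : A μ = insert μ (s μ) := by
      ext ν
      rw [Finset.mem_insert, hA, hs]
      constructor
      · rintro ⟨⟨h1, h2⟩, h3⟩
        rcases h2.lt_or_eq with h4 | h4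
        · exact Or.inr ⟨⟨⟨h1, h2⟩, h3⟩, h4⟩
        · exact Or.inl (hω.eq_of_wt_eq (h1.trans h'.symm) h4.symm)
      · rintro (rfl | h1)
        · exact ⟨⟨h', le_rfl⟩, h⟩
        · exact h1.1
    rw [hq, e, Finset.sum_insert (by rw [hs]; exact fun h1 => lt_irrefl _ h1.2), hself μ h h',
      one_mul, ha1 μ h h', sub_add_cancel]
  have hhom : IsHomog d (∑ m ∈ B₀, Q m • P m) := fun μ hμ => by
    rw [hq] at hμ
    obtain ⟨ν, hν, h1⟩ := Finset.exists_ne_zero_of_sum_ne_zero hμ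
    have h2 := (hA μ ν).1 hν
    exact (hdiff μ ν h2.2 h2.1.1 (left_ne_zero_of_mul h1)).1
  -- A nonzero `a μ` is caused by a monomial of `f` or by some higher `ν` with `a ν ≠ 0`; in the
  -- second case the differences along the way add up in `𝓜`.
  have hasupp : ∀ μ, a μ ≠ 0 → ∃ κ, f.cf κ ≠ 0 ∧ diff μ κ ∈ 𝓜 := fun μ => by
    induction μ using (wellFounded_above hω.neg d).induction with
    | _ μ ih =>
      intro hμ
      by_cases h1 : f.cf μ = 0
      · have h2 := ha1 μ (ha0 μ hμ).1 (ha0 μ hμ).2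
        rw [h1, zero_sub] at h2
        have h3 : ∑ ν ∈ s μ, shiftCf P b μ ν * a ν ≠ 0 := fun h3 => hμ (by rw [h2, h3, neg_zero])
        obtain ⟨ν, hν, h4⟩ := Finset.exists_ne_zero_of_sum_ne_zero h3
        have h5 := (hs μ ν).1 hν
        obtain ⟨κ, h6, h7⟩ := ih ν ⟨h5.1.1.1, h5.2⟩ (right_ne_zero_of_mul h4)
        refine ⟨κ, h6, ?_⟩
        rw [← diff_add_diff μ ν]
        exact 𝓜.add_mem (hdiff μ ν h5.1.2 h5.1.1.1 (left_ne_zero_of_mul h4)).2.1 h7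
      · exact ⟨μ, h1, by rw [diff_self]; exact 𝓜.zero_mem⟩
  refine ⟨∑ m ∈ B₀, Q m • P m, sum_mem fun m hm => ?_, hhom, fun m hm => ?_, fun μ hμ => ?_⟩
  · have e : Q m • P m = ofSeries (Q m) * P m := by rw [mul_def, op_ofSeries, opC_apply]
    rw [e]
    exact hI.mul_mem _ (mono_mem_coefsIn _ _ (hQO m)) _ (hP m (hB₀ m hm)).mem
  · by_cases h : deg m = d
    · exact hqE m hm h
    · have h2 : (∑ m ∈ B₀, Q m • P m).cf m = 0 := by
        by_contra h'
        exact h (hhom m h')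
      have h3 : f.cf m = 0 := by
        by_contra h'
        exact h (hd m h')
      rw [h2, h3]
  · rw [hq] at hμ
    obtain ⟨ν, hν, h1⟩ := Finset.exists_ne_zero_of_sum_ne_zero hμ
    have h2 := (hA μ ν).1 hν
    obtain ⟨κ, h3, h4⟩ := hasupp ν (right_ne_zero_of_mul h1)
    refine ⟨κ, h3, ?_⟩
    rw [← diff_add_diff μ ν]
    exact 𝓜.add_mem (hdiff μ ν h2.2 h2.1.1 (left_ne_zero_of_mul h1)).2.1 h4

end HDiff

namespace HDiff

open Mon

variable {k : Type*} [Field k] {n : ℕ}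

/-! ### Reduced elements -/

/-- `g ∈ I` is homogeneous, `m` occurs with coefficient one, and no other monomial of `E`
occurs. -/
structure IsReduced (I : AddSubgroup (HDiff k n)) (E : Set (Mon n)) (g : HDiff k n) (m : Mon n) :
    Prop where
  mem : g ∈ I
  cf_eq_one : g.cf m = 1
  homog : IsHomog (deg m) g
  cf_eq_zero : ∀ μ ∈ E, μ ≠ m → g.cf μ = 0

/-- A nonzero element of `I` contains one of the leading monomials, by `exists_lead`. This gives the
uniqueness of reduced elements. -/
theorem eq_zero_of_cf_leadSet {O : Subring (MvPowerSeries (Fin n) k)} (hO : Admissible O)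
    {I : AddSubgroup (HDiff k n)} (hI : IsHomIdeal O I) {ω : WeightSpace n} (hω : Generic ω)
    {f : HDiff k n} (hf : f ∈ I) (h : ∀ m ∈ leadSet ω I, f.cf m = 0) : f = 0 := by
  by_contra h0
  obtain ⟨ν, hν⟩ := exists_cf_ne_zero h0
  obtain ⟨m, hm, h1, -⟩ := exists_lead hO hI hω hf hν
  exact h1 (h m hm)

theorem IsReduced.eq {O : Subring (MvPowerSeries (Fin n) k)} (hO : Admissible O)
    {I : AddSubgroup (HDiff k n)} (hI : IsHomIdeal O I) {ω : WeightSpace n} (hω : Generic ω)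
    {g g' : HDiff k n} {m : Mon n} (h : IsReduced I (leadSet ω I) g m)
    (h' : IsReduced I (leadSet ω I) g' m) : g = g' := by
  refine sub_eq_zero.1 (eq_zero_of_cf_leadSet hO hI hω (I.sub_mem h.mem h'.mem) fun μ hμ => ?_)
  by_cases hm : μ = m
  · rw [cf_sub, hm, h.cf_eq_one, h'.cf_eq_one, sub_self]
  · rw [cf_sub, h.cf_eq_zero μ hμ hm, h'.cf_eq_zero μ hμ hm, sub_self]

/-- Divide the single monomial `m`: the result lies in `I` and agrees with `m` on `E`. The monoid
`𝓜` is left free, since smaller choices give finer control of the support. -/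
theorem exists_isReduced {O : Subring (MvPowerSeries (Fin n) k)} (hO : Admissible O)
    (hdiv : DivStable O) {I : AddSubgroup (HDiff k n)} (hI : IsHomIdeal O I) {ω : WeightSpace n}
    (hω : Generic ω) {𝓜 : AddSubmonoid ((Fin n → ℤ) × (Fin n → ℤ))} (h𝓜 : Adapted ω 𝓜)
    {E : Set (Mon n)} (hE : ∀ m ∈ E, ∃ P, Leads I 𝓜 P m) {m : Mon n} (hm : m ∈ E) :
    ∃ g, IsReduced I E g m ∧ ∀ ν, g.cf ν ≠ 0 → diff ν m ∈ 𝓜 := by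
  classical
  have hcf : ∀ μ, (mono m.2.1 m.2.2 (MvPowerSeries.monomial m.1 (1 : k))).cf μ =
      if μ = m then 1 else 0 := fun μ => by
    rw [cf_mono]
    by_cases h1 : m.2 = μ.2
    · rw [if_pos h1, MvPowerSeries.coeff_monomial]
      have : μ.1 = m.1 ↔ μ = m := ⟨fun h => Prod.ext h h1.symm, fun h => by rw [h]⟩
      simp only [this]
    · have h2 : μ ≠ m := fun h => h1 (by rw [h])
      have h3 : ¬(m.2.1, m.2.2) = μ.2 := h1
      rw [if_neg h3, if_neg h2]
  have hsupp : ∀ μ, (mono m.2.1 m.2.2 (MvPowerSeries.monomial m.1 (1 : k))).cf μ ≠ 0 → μ = m :=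
    fun μ hμ => by
      by_contra h
      rw [hcf, if_neg h] at hμ
      exact hμ rfl
  obtain ⟨q, hq, hhom, hcfq, hsq⟩ := exists_division hO hdiv hI hω h𝓜 hE
    (mono_mem_coefsIn m.2.1 m.2.2 (hO.monomial_mem m.1 1)) (d := deg m)
    (fun μ hμ => by rw [hsupp μ hμ])
  refine ⟨q, ⟨hq, ?_, hhom, fun μ hμ hne => ?_⟩, fun ν hν => ?_⟩
  · rw [hcfq m hm, hcf, if_pos rfl]
  · rw [hcfq μ hμ, hcf, if_neg hne]
  · obtain ⟨μ, h1, h2⟩ := hsq ν hν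
    rwa [hsupp μ h1] at h2

/-- A weight does not increase from `m` to the other monomials of the reduced element with
leading monomial `m`. -/
def InCell (E : Set (Mon n)) (g : Mon n → HDiff k n) (w : WeightSpace n) : Prop :=
  w ∈ Wloc n ∧ ∀ m ∈ E, ∀ ν, (g m).cf ν ≠ 0 → wt w ν ≤ wt w m

/-- The reduced elements of an ideal for a generic weight. -/
structure IsRedSystem (O : Subring (MvPowerSeries (Fin n) k)) (I : AddSubgroup (HDiff k n))
    (ω : WeightSpace n) (g : Mon n → HDiff k n) : Prop where
  adm : Admissible O
  div : DivStable O
  ideal : IsHomIdeal O I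
  gen : Generic ω
  red : ∀ m ∈ leadSet ω I, IsReduced I (leadSet ω I) (g m) m

open scoped Classical in
/-- The leading monomials of the degree of `ν` and of at least its weight. -/
noncomputable def leadsAbove (I : AddSubgroup (HDiff k n)) {ω : WeightSpace n} (hω : Generic ω)
    (ν : Mon n) : Finset (Mon n) :=
  (finite_above hω.neg (deg ν) (wt ω ν)).toFinset.filter (· ∈ leadSet ω I)

theorem mem_leadsAbove {I : AddSubgroup (HDiff k n)} {ω : WeightSpace n} {hω : Generic ω}
    {ν μ : Mon n} :
    μ ∈ leadsAbove I hω ν ↔ (deg μ = deg ν ∧ wt ω ν ≤ wt ω μ) ∧ μ ∈ leadSet ω I := by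
  simp [leadsAbove]

/-! ### Initial ideals on the cell of a reduced system -/

namespace IsRedSystem

variable {O : Subring (MvPowerSeries (Fin n) k)} {I : AddSubgroup (HDiff k n)}
  {ω : WeightSpace n} {g : Mon n → HDiff k n}

/-- Any generic weight with the same leading monomials lies in the cell. -/
theorem wt_le (h : IsRedSystem O I ω g) {ω' : WeightSpace n} (hω' : Generic ω')
    (he : leadSet ω' I = leadSet ω I) {m : Mon n} (hm : m ∈ leadSet ω I) {ν : Mon n}
    (hν : (g m).cf ν ≠ 0) : wt ω' ν ≤ wt ω' m := by
  obtain ⟨m', hm', h1, -, h2⟩ := exists_lead h.adm h.ideal hω' (h.red m hm).mem hν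
  -- The only monomial of `g m` in the common set of leading monomials is `m`, so it is also the
  -- leading monomial for `ω'`.
  have : m' = m := by
    by_contra hne
    exact h1 ((h.red m hm).cf_eq_zero m' (he ▸ hm') hne)
  rwa [this] at h2

theorem leads (h : IsRedSystem O I ω g) {m : Mon n} (hm : m ∈ leadSet ω I) :
    Leads I (negMonoid ω) (g m) m where
  mem := (h.red m hm).mem
  cf_eq_one := (h.red m hm).cf_eq_one
  homog := (h.red m hm).homog
  diff_mem ν hν := by
    rcases (h.wt_le h.gen rfl hm hν).lt_or_eq with h1 | h1
    · exact Or.inr (by rw [ev_diff]; linarith)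
    · left
      rw [h.gen.eq_of_wt_eq ((h.red m hm).homog ν hν) h1, diff_self]

/-- An element of `I` is determined by its coefficients at the leading monomials. -/
theorem cf_eq_sum (h : IsRedSystem O I ω g) {f : HDiff k n} (hf : f ∈ I) (ν : Mon n) :
    f.cf ν = ∑ μ ∈ leadsAbove I h.gen ν, f.cf μ * (g μ).cf ν := by
  classical
  have key : ∀ μ, (ofSeries (MvPowerSeries.monomial 0 (f.cf μ)) * g μ) ∈ I ∨
      μ ∉ leadSet ω I := fun μ => by
    by_cases hμ : μ ∈ leadSet ω I
    · exact Or.inl (h.ideal.mul_mem _ (mono_mem_coefsIn _ _ (h.adm.monomial_mem _ _)) _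
        (h.red μ hμ).mem)
    · exact Or.inr hμ
  have hcf : ∀ μ κ, (ofSeries (MvPowerSeries.monomial 0 (f.cf μ)) * g μ).cf κ =
      f.cf μ * (g μ).cf κ := fun μ κ => by
    have := cf_ofSeries_monomial_mul 0 (f.cf μ) (g μ) κ
    rwa [show ((0, 0) : Mon n) = 0 from rfl, zero_add] at this
  have hmem : f - ∑ μ ∈ leadsAbove I h.gen ν,
      ofSeries (MvPowerSeries.monomial 0 (f.cf μ)) * g μ ∈ I :=
    I.sub_mem hf (sum_mem fun μ hμ => (key μ).resolve_right fun h' => h' (mem_leadsAbove.1 hμ).2)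
  by_contra hne
  have hne' : (f - ∑ μ ∈ leadsAbove I h.gen ν,
      ofSeries (MvPowerSeries.monomial 0 (f.cf μ)) * g μ).cf ν ≠ 0 := by
    rw [cf_sub, cf_sum, sub_ne_zero]
    simpa only [hcf] using hne
  -- A nonzero coefficient at `ν` would produce a leading monomial `m` above `ν`. But there only `g
  -- m` contributes to the sum, and it cancels `f.cf m`.
  obtain ⟨m, hm, h1, h2, h3⟩ := exists_lead h.adm h.ideal h.gen hmem hne'
  have hm' : m ∈ leadsAbove I h.gen ν := mem_leadsAbove.2 ⟨⟨h2, h3⟩, hm⟩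
  apply h1
  rw [cf_sub, cf_sum, sub_eq_zero]
  simp only [hcf]
  rw [Finset.sum_eq_single m]
  · rw [(h.red m hm).cf_eq_one, mul_one]
  · intro μ hμ hne
    rw [(h.red μ (mem_leadsAbove.1 hμ).2).cf_eq_zero m hm hne.symm, mul_zero]
  · exact fun h' => absurd hm' h'

open scoped Classical in
/-- The coefficients of `S` are determined by those at the leading monomials, through the initial
forms of the reduced elements. -/
def InitialRel (h : IsRedSystem O I ω g) (w : WeightSpace n) (S : HDiff k n) : Prop :=
  ∀ ν, S.cf ν = ∑ μ ∈ leadsAbove I h.gen ν, S.cf μ * if wt w ν = wt w μ then (g μ).cf ν else 0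

theorem InitialRel.add {h : IsRedSystem O I ω g} {w : WeightSpace n} {S T : HDiff k n}
    (hS : h.InitialRel w S) (hT : h.InitialRel w T) : h.InitialRel w (S + T) := fun ν => by
  rw [cf_add, hS ν, hT ν, ← Finset.sum_add_distrib]
  exact Finset.sum_congr rfl fun μ _ => by rw [cf_add, add_mul]

theorem InitialRel.neg {h : IsRedSystem O I ω g} {w : WeightSpace n} {S : HDiff k n}
    (hS : h.InitialRel w S) : h.InitialRel w (-S) := fun ν => by
  rw [cf_neg, hS ν, ← Finset.sum_neg_distrib]
  exact Finset.sum_congr rfl fun μ _ => by rw [cf_neg, neg_mul]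

/-- Take the part of weight `c` in `cf_eq_sum`. A term with `wt w ν = c` satisfies `c ≤ wt w μ` by
the cell condition and `wt w μ ≤ c` by the order of `P`, so only the initial forms of the `g μ`
contribute. -/
theorem initialRel_part (h : IsRedSystem O I ω g) {w : WeightSpace n}
    (hw : InCell (leadSet ω I) g w) {P : HDiff k n} (hP : P ∈ I) {c : ℝ} (hc : OrdLE w c P) :
    h.InitialRel w (part w c P) := fun ν => by
  classical
  rw [cf_part]
  split_ifs with h1
  · rw [h.cf_eq_sum hP ν]
    refine Finset.sum_congr rfl fun μ hμ => ?_
    by_cases h2 : P.cf μ = 0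
    · simp [cf_part, h2]
    by_cases h3 : (g μ).cf ν = 0
    · simp [h3]
    have h4 := hw.2 μ (mem_leadsAbove.1 hμ).2 ν h3
    have h5 := ordLE_iff.1 hc μ h2
    have h6 : wt w μ = c := le_antisymm h5 (h1 ▸ h4)
    rw [cf_part, if_pos h6, if_pos (h1.trans h6.symm)]
  · symm
    refine Finset.sum_eq_zero fun μ _ => ?_
    rw [cf_part]
    by_cases h2 : wt w μ = c
    · rw [if_neg (c := wt w ν = wt w μ) (by rwa [h2]), mul_zero]
    · rw [if_neg h2, zero_mul]

/-- The relation links monomials of equal degree and equal weight only, so it passes to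
bihomogeneous components. -/
theorem InitialRel.restr {h : IsRedSystem O I ω g} {w : WeightSpace n} {S : HDiff k n}
    (hS : h.InitialRel w S) (c : ℝ) (d : ℕ) : h.InitialRel w (comp d (part w c S)) := fun ν => by
  classical
  rw [cf_comp, cf_part]
  have key : ∀ μ ∈ leadsAbove I h.gen ν, (comp d (part w c S)).cf μ *
      (if wt w ν = wt w μ then (g μ).cf ν else 0) =
      if deg ν = d ∧ wt w ν = c then S.cf μ * (if wt w ν = wt w μ then (g μ).cf ν else 0)
      else 0 := fun μ hμ => by
    rw [cf_comp, cf_part, (mem_leadsAbove.1 hμ).1.1]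
    by_cases h1 : wt w ν = wt w μ
    · by_cases h2 : deg ν = d <;> by_cases h3 : wt w μ = c <;> simp [h1, h2, h3]
    · simp [h1]
  rw [Finset.sum_congr rfl key]
  by_cases h1 : deg ν = d ∧ wt w ν = c
  · simp only [h1.1, h1.2, and_self, if_true]
    have := hS ν
    rw [h1.2] at this
    exact this
  · simp only [if_neg h1, Finset.sum_const_zero]
    by_cases h2 : deg ν = d
    · have h3 : wt w ν ≠ c := fun h3 => h1 ⟨h2, h3⟩
      simp [h3]
    · simp [h2]

theorem InitialRel.eq {h : IsRedSystem O I ω g} {w : WeightSpace n} {S T : HDiff k n}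
    (hS : h.InitialRel w S) (hT : h.InitialRel w T) (he : ∀ m ∈ leadSet ω I, S.cf m = T.cf m) :
    S = T :=
  ext_cf fun ν => by
    rw [hS ν, hT ν]
    exact Finset.sum_congr rfl fun μ hμ => by rw [he μ (mem_leadsAbove.1 hμ).2]

/-- Divide `T` while confining differences to functionals that are also nonpositive on `w`, which
the cell condition permits. The result `q ∈ I` has order at most `c` and agrees with `T` on the
leading monomials, so its part of weight `c` obeys the same relation with the same data and equals
`T`. -/
theorem mem_gr_of_homog (h : IsRedSystem O I ω g) {w : WeightSpace n}
    (hw : InCell (leadSet ω I) g w) {T : HDiff k n} (hT : T ∈ coefsIn O) (hr : h.InitialRel w T)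
    {c : ℝ} {d : ℕ} (hc : ∀ m, T.cf m ≠ 0 → wt w m = c) (hd : IsHomog d T) :
    T ∈ gr w (I : Set (HDiff k n)) := by
  classical
  let N : AddSubmonoid ((Fin n → ℤ) × (Fin n → ℤ)) :=
    { carrier := {a | ev w a ≤ 0}
      zero_mem' := (ev_zero w).le
      add_mem' := fun {a b} ha hb => by
        have ha : ev w a ≤ 0 := ha
        have hb : ev w b ≤ 0 := hb
        change ev w (a + b) ≤ 0
        rw [ev_add]
        linarith }
  have hN : ∀ a, a ∈ N ↔ ev w a ≤ 0 := fun a => Iff.rfl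
  have had := h.gen.adapted
  have h𝓜 : Adapted ω (negMonoid ω ⊓ N) :=
    ⟨fun a ha => had.neg a ha.1, fun i => ⟨had.latX_mem i, by
      change ev w _ ≤ 0
      rw [ev_latX]; exact (hw.1 i).1⟩, fun i => ⟨had.latXD_mem i, by
      change ev w _ ≤ 0
      rw [ev_latXD]; linarith [(hw.1 i).2]⟩⟩
  obtain ⟨q, hq, -, hqE, hqs⟩ := exists_division h.adm h.div h.ideal h.gen h𝓜
    (E := leadSet ω I) (fun m hm => ⟨g m, (h.leads hm).mem, (h.leads hm).cf_eq_one,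
      (h.leads hm).homog, fun ν hν => ⟨(h.leads hm).diff_mem ν hν, by
        change ev w _ ≤ 0
        rw [ev_diff]; linarith [hw.2 m hm ν hν]⟩⟩) hT hd
  have hord : OrdLE w c q := ordLE_iff.2 fun ν hν => by
    obtain ⟨μ, h1, h2⟩ := hqs ν hν
    have h3 : ev w (diff ν μ) ≤ 0 := h2.2
    rw [ev_diff, hc μ h1] at h3
    linarith
  have e : T = part w c q := by
    refine hr.eq (h.initialRel_part hw hq hord) fun m hm => ?_
    rw [cf_part]
    split_ifs with h1
    · exact (hqE m hm).symm
    · by_contra h2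
      exact h1 (hc m h2)
  rw [e]
  exact part_mem_gr hq hord

/-- The right-hand side depends on `w` only through the `i` with `u_i ≠ 0` and the equalities of
weights inside the `g m`; this is what makes initial ideals comparable. -/
theorem mem_gr_iff (h : IsRedSystem O I ω g) {w : WeightSpace n}
    (hw : InCell (leadSet ω I) g w) {S : HDiff k n} :
    S ∈ gr w (I : Set (HDiff k n)) ↔ S ∈ coefsIn O ∧ FinWeight w S ∧ h.InitialRel w S := by
  constructor
  · intro hS
    refine ⟨?_, finWeight_of_mem_gr hS, ?_⟩
    · refine (AddSubgroup.closure_le _).2 ?_ hS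
      rintro _ ⟨P, hP, c, -, rfl⟩
      exact h.adm.part_mem_coefsIn (h.ideal.le hP) w c
    · induction hS using AddSubgroup.closure_induction with
      | mem S hS => obtain ⟨P, hP, c, hc, rfl⟩ := hS; exact h.initialRel_part hw hP hc
      | zero => intro ν; simp
      | add S T _ _ h1 h2 => exact h1.add h2
      | neg S _ h1 => exact h1.neg
  · rintro ⟨hS, hfin, hr⟩
    refine hfin.mem_of_part_mem fun c => ?_
    have e : ∑ d ∈ (finite_deg (part w c S)).toFinset, comp d (part w c S) = part w c S :=
      sum_restr_fiber deg _ fun m hm => by simpa using ⟨_, _, _, hm, rfl⟩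
    rw [← e]
    refine sum_mem fun d _ => h.mem_gr_of_homog hw
      (h.adm.restr_mem_coefsIn (h.adm.part_mem_coefsIn hS w c) _) (hr.restr c d)
      (c := c) (fun m hm => ?_) (isHomog_comp d _)
    classical
    rw [cf_comp, cf_part] at hm
    by_contra h1
    simp [h1] at hm

/-- Within the cell, the initial ideal is determined by the pattern of equal weights in the
reduced elements, and it determines the cell and the pattern. -/
theorem gr_eq_iff (h : IsRedSystem O I ω g) {w w' : WeightSpace n}
    (hw : InCell (leadSet ω I) g w) (hw' : w' ∈ Wloc n) (hs : SameStratum w w') :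
    gr w (I : Set (HDiff k n)) = gr w' (I : Set (HDiff k n)) ↔
      InCell (leadSet ω I) g w' ∧ ∀ m ∈ leadSet ω I, ∀ ν, (g m).cf ν ≠ 0 →
        (wt w ν = wt w m ↔ wt w' ν = wt w' m) := by
  classical
  constructor
  · intro he
    have hcell : InCell (leadSet ω I) g w' := by
      refine ⟨hw', fun m hm ν hν => ?_⟩
      by_contra! hlt
      -- If some monomial of `g m` were heavier than `m` for `w'`, the initial form of `g m` for
      -- `w'` would contain no leading monomial and yet be nonzero, contradicting the relation for
      -- `w`. The maximal weight is attained because powers of `x` do not increase weights, so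
      -- finitely many monomials compete.
      obtain ⟨B, hB, hB'⟩ := exists_base {ν | (g m).cf ν ≠ 0} (deg m)
      have hg := (h.red m hm).homog
      have hBne : B.Nonempty := by
        obtain ⟨b, hb, -⟩ := hB' ν hν (hg ν hν)
        exact ⟨b, hb⟩
      obtain ⟨b, hb, hmax⟩ := B.exists_max_image (wt w') hBne
      have hord : OrdLE w' (wt w' b) (g m) := ordLE_iff.2 fun κ hκ => by
        obtain ⟨b', hb', δ, rfl⟩ := hB' κ hκ (hg κ hκ)
        rw [wt_add]
        have h1 : wt w' ((δ, 0) : Mon n) ≤ 0 := by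
          simpa [wt, weight] using weight_nonpos hw' δ
        linarith [hmax b' hb']
      have h1 := part_mem_gr (A := (I : Set (HDiff k n))) (h.red m hm).mem hord
      rw [← he, h.mem_gr_iff hw] at h1
      have h2 := h1.2.2 b
      rw [cf_part, if_pos rfl] at h2
      have h3 : (g m).cf b ≠ 0 := hB b hb
      rw [h2] at h3
      obtain ⟨μ, hμ, h4⟩ := Finset.exists_ne_zero_of_sum_ne_zero h3
      have h5 := left_ne_zero_of_mul h4
      rw [cf_part] at h5
      split_ifs at h5 with h6
      · have h7 : μ = m := by
          by_contra hne
          exact h5 ((h.red m hm).cf_eq_zero μ (mem_leadsAbove.1 hμ).2 hne)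
        rw [h7] at h6
        have h8 := ordLE_iff.1 hord ν hν
        linarith
      · exact h5 rfl
    refine ⟨hcell, fun m hm ν hν => ?_⟩
    -- Compare the initial form of `g m` for `v` with the relation for `v'`: its only leading
    -- monomial is `m`, so its coefficient at `ν` vanishes unless `ν` and `m` have equal weight for
    -- `v'`.
    have key : ∀ v v' : WeightSpace n, InCell (leadSet ω I) g v → InCell (leadSet ω I) g v' →
        gr v (I : Set (HDiff k n)) = gr v' (I : Set (HDiff k n)) → wt v ν = wt v m →
        wt v' ν = wt v' m := by
      intro v v' hv hv' hvv h0
      by_contra h1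
      have hord : OrdLE v (wt v m) (g m) := ordLE_iff.2 fun κ hκ => hv.2 m hm κ hκ
      have h2 := part_mem_gr (A := (I : Set (HDiff k n))) (h.red m hm).mem hord
      rw [hvv, h.mem_gr_iff hv'] at h2
      have h3 := h2.2.2 ν
      rw [cf_part, if_pos h0] at h3
      obtain ⟨μ, hμ, h4⟩ := Finset.exists_ne_zero_of_sum_ne_zero (h3 ▸ hν)
      have h5 := left_ne_zero_of_mul h4
      rw [cf_part] at h5
      split_ifs at h5
      · have h7 : μ = m := by
          by_contra hne
          exact h5 ((h.red m hm).cf_eq_zero μ (mem_leadsAbove.1 hμ).2 hne)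
        rw [h7, if_neg h1, mul_zero] at h4
        exact h4 rfl
      · exact h5 rfl
    exact ⟨key w w' hw hcell he, key w' w hcell hw he.symm⟩
  · rintro ⟨hcell, hpat⟩
    ext S
    rw [h.mem_gr_iff hw, h.mem_gr_iff hcell, finWeight_iff hw.1, finWeight_iff hw']
    simp only [ne_eq, (hs _).1]
    refine and_congr_right fun _ => and_congr_right fun _ => ?_
    refine forall_congr' fun ν => ?_
    have : ∀ μ ∈ leadsAbove I h.gen ν, S.cf μ * (if wt w ν = wt w μ then (g μ).cf ν else 0) =
        S.cf μ * if wt w' ν = wt w' μ then (g μ).cf ν else 0 := fun μ hμ => by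
      by_cases h1 : (g μ).cf ν = 0
      · simp [h1]
      · simp only [hpat μ (mem_leadsAbove.1 hμ).2 ν h1]
    rw [Finset.sum_congr rfl this]

end IsRedSystem

end HDiff

namespace HDiff

open Mon

variable {k : Type*} [Field k] {n : ℕ}

/-! ### The cells are rational cones -/

theorem ev_nonpos_of_mem_closure {Λ : Set ((Fin n → ℤ) × (Fin n → ℤ))} {w : WeightSpace n}
    (hw : ∀ a ∈ Λ, ev w a ≤ 0) {a : (Fin n → ℤ) × (Fin n → ℤ)} (ha : a ∈ AddSubmonoid.closure Λ) :
    ev w a ≤ 0 := by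
  induction ha using AddSubmonoid.closure_induction with
  | mem a ha => exact hw a ha
  | zero => exact (ev_zero w).le
  | add a b _ _ h1 h2 => rw [ev_add]; linarith

/-- A sum of nonpositive numbers vanishes only if every summand does, so the vanishing pattern on
the generators determines it on the monoid. -/
theorem ev_eq_zero_iff_of_mem_closure {Λ : Set ((Fin n → ℤ) × (Fin n → ℤ))} {w w' : WeightSpace n}
    (hw : ∀ a ∈ Λ, ev w a ≤ 0) (hw' : ∀ a ∈ Λ, ev w' a ≤ 0)
    (h : ∀ a ∈ Λ, ev w a = 0 ↔ ev w' a = 0) {a : (Fin n → ℤ) × (Fin n → ℤ)}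
    (ha : a ∈ AddSubmonoid.closure Λ) : ev w a = 0 ↔ ev w' a = 0 := by
  induction ha using AddSubmonoid.closure_induction with
  | mem a ha => exact h a ha
  | zero => simp [ev_zero]
  | add a b ha hb h1 h2 =>
    have h3 := ev_nonpos_of_mem_closure hw ha
    have h4 := ev_nonpos_of_mem_closure hw hb
    have h5 := ev_nonpos_of_mem_closure hw' ha
    have h6 := ev_nonpos_of_mem_closure hw' hb
    rw [ev_add, ev_add]
    constructor
    · intro h0
      rw [h1.1 (by linarith), h2.1 (by linarith), add_zero]
    · intro h0
      rw [h1.2 (by linarith), h2.2 (by linarith), add_zero]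

theorem sameStratum_iff (w w' : WeightSpace n) : SameStratum w w' ↔
    ∀ i, (ev w (latX i) = 0 ↔ ev w' (latX i) = 0) ∧ (ev w (latXD i) = 0 ↔ ev w' (latXD i) = 0) := by
  simp only [SameStratum, ev_latX, ev_latXD, neg_eq_zero]

theorem mem_Wloc_iff (w : WeightSpace n) :
    w ∈ Wloc n ↔ ∀ i, ev w (latX i) ≤ 0 ∧ ev w (latXD i) ≤ 0 := by
  simp only [ev_latX, ev_latXD, neg_nonpos]
  rfl

/-- Let `𝓜` be generated by the functionals of `Wloc` and by finitely many differences, taken from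
the `g m` with `m` a minimal leading monomial. Multiples of these `g m` lead at every monomial of
`leadSet ω I` with differences in `𝓜`. So division can be carried out inside `𝓜`, and all
inequalities and equalities of the cell follow from those of the generators. -/
theorem IsRedSystem.exists_finset {O : Subring (MvPowerSeries (Fin n) k)}
    {I : AddSubgroup (HDiff k n)} {ω : WeightSpace n} {g : Mon n → HDiff k n}
    (h : IsRedSystem O I ω g) : ∃ Λ : Finset ((Fin n → ℤ) × (Fin n → ℤ)),
      (∀ w, (∀ a ∈ Λ, ev w a ≤ 0) ↔ InCell (leadSet ω I) g w) ∧
      ∀ w w', InCell (leadSet ω I) g w → InCell (leadSet ω I) g w' →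
        ((∀ a ∈ Λ, ev w a = 0 ↔ ev w' a = 0) ↔ SameStratum w w' ∧
          ∀ m ∈ leadSet ω I, ∀ ν, (g m).cf ν ≠ 0 → (wt w ν = wt w m ↔ wt w' ν = wt w' m)) := by
  classical
  obtain ⟨F, hF, hF'⟩ := exists_finset_minimal (leadSet ω I)
  choose B hB hB' using fun m : Mon n => exists_base {ν | (g m).cf ν ≠ 0} (deg m)
  let Λ : Finset ((Fin n → ℤ) × (Fin n → ℤ)) := Finset.univ.image latX ∪ Finset.univ.image latXD ∪
    F.biUnion fun m => (B m).image fun ν => diff ν m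
  have hX : ∀ i, latX i ∈ Λ := fun i => by simp [Λ]
  have hXD : ∀ i, latXD i ∈ Λ := fun i => by simp [Λ]
  have hdiff : ∀ m ∈ F, ∀ ν ∈ B m, diff ν m ∈ Λ := fun m hm ν hν => by
    simp only [Λ, Finset.mem_union, Finset.mem_biUnion, Finset.mem_image]
    exact Or.inr ⟨m, hm, ν, hν, rfl⟩
  have hcases : ∀ a ∈ Λ, (∃ i, a = latX i) ∨ (∃ i, a = latXD i) ∨
      ∃ m ∈ leadSet ω I, ∃ ν, (g m).cf ν ≠ 0 ∧ a = diff ν m := fun a ha => by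
    simp only [Λ, Finset.mem_union, Finset.mem_biUnion, Finset.mem_image] at ha
    rcases ha with (⟨i, -, rfl⟩ | ⟨i, -, rfl⟩) | ⟨m, hm, ν, hν, rfl⟩
    · exact Or.inl ⟨i, rfl⟩
    · exact Or.inr (Or.inl ⟨i, rfl⟩)
    · exact Or.inr (Or.inr ⟨m, hF hm, ν, hB m ν hν, rfl⟩)
  clear_value Λ
  obtain ⟨𝓜, h𝓜def⟩ : ∃ 𝓜, 𝓜 = AddSubmonoid.closure {a | a ∈ Λ} := ⟨_, rfl⟩
  have hΛ𝓜 : ∀ a ∈ Λ, a ∈ 𝓜 := fun a ha => by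
    rw [h𝓜def]; exact AddSubmonoid.subset_closure ha
  have had := h.gen.adapted
  have h𝓜 : Adapted ω 𝓜 := by
    refine ⟨fun a ha => had.neg a ?_, fun i => hΛ𝓜 _ (hX i), fun i => hΛ𝓜 _ (hXD i)⟩
    rw [h𝓜def] at ha
    refine (AddSubmonoid.closure_le (S := negMonoid ω)).2 (fun b hb => ?_) ha
    rcases hcases b hb with ⟨i, rfl⟩ | ⟨i, rfl⟩ | ⟨m, hm, ν, hν, rfl⟩
    · exact had.latX_mem i
    · exact had.latXD_mem i
    · exact (h.leads hm).diff_mem ν hν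
  have hleadF : ∀ m ∈ F, Leads I 𝓜 (g m) m := fun m hm => by
    have hl := h.leads (hF hm)
    refine ⟨hl.mem, hl.cf_eq_one, hl.homog, fun ν hν => ?_⟩
    obtain ⟨b, hb, δ, rfl⟩ := hB' m ν hν (hl.homog ν hν)
    rw [← diff_add_diff _ b]
    refine 𝓜.add_mem ?_ (hΛ𝓜 _ (hdiff m hm b hb))
    have := sum_latX_mem h𝓜.latX_mem δ
    convert this using 1
    refine Prod.ext (funext fun i => ?_) (funext fun i => ?_)
    · simp [diff]
    · simp [diff]
  have hlead : ∀ m ∈ leadSet ω I, ∃ P, Leads I 𝓜 P m := fun m hm => by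
    obtain ⟨m₀, hm₀, hle⟩ := hF' m hm
    have := (hleadF m₀ hm₀).exists_add h.adm h.ideal h𝓜 (m - m₀)
    rwa [tsub_add_cancel_of_le hle] at this
  have hgen : ∀ m ∈ leadSet ω I, ∀ ν, (g m).cf ν ≠ 0 → diff ν m ∈ 𝓜 := fun m hm ν hν => by
    -- Division inside `𝓜` produces a reduced element with differences in `𝓜`; by uniqueness it is
    -- `g m`.
    obtain ⟨g', h1, h2⟩ := exists_isReduced h.adm h.div h.ideal h.gen h𝓜 hlead hm
    rw [(h.red m hm).eq h.adm h.ideal h.gen h1] at hν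
    exact h2 ν hν
  have hcell : ∀ w, (∀ a ∈ Λ, ev w a ≤ 0) ↔ InCell (leadSet ω I) g w := fun w => by
    constructor
    · intro hw
      refine ⟨(mem_Wloc_iff w).2 fun i => ⟨hw _ (hX i), hw _ (hXD i)⟩, fun m hm ν hν => ?_⟩
      have := ev_nonpos_of_mem_closure hw (h𝓜def ▸ hgen m hm ν hν)
      rw [ev_diff] at this
      linarith
    · intro hw a ha
      rcases hcases a ha with ⟨i, rfl⟩ | ⟨i, rfl⟩ | ⟨m, hm, ν, hν, rfl⟩
      · exact ((mem_Wloc_iff w).1 hw.1 i).1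
      · exact ((mem_Wloc_iff w).1 hw.1 i).2
      · rw [ev_diff]
        linarith [hw.2 m hm ν hν]
  refine ⟨Λ, hcell, fun w w' hw hw' => ⟨fun hp => ⟨?_, fun m hm ν hν => ?_⟩, fun hp a ha => ?_⟩⟩
  · exact (sameStratum_iff w w').2 fun i => ⟨hp _ (hX i), hp _ (hXD i)⟩
  · have := ev_eq_zero_iff_of_mem_closure ((hcell w).2 hw) ((hcell w').2 hw') hp
      (h𝓜def ▸ hgen m hm ν hν)
    rwa [ev_diff, ev_diff, sub_eq_zero, sub_eq_zero] at this
  · rcases hcases a ha with ⟨i, rfl⟩ | ⟨i, rfl⟩ | ⟨m, hm, ν, hν, rfl⟩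
    · exact ((sameStratum_iff w w').1 hp.1 i).1
    · exact ((sameStratum_iff w w').1 hp.1 i).2
    · rw [ev_diff, ev_diff, sub_eq_zero, sub_eq_zero]
      exact hp.2 m hm ν hν

theorem exists_isRedSystem {O : Subring (MvPowerSeries (Fin n) k)} (hO : Admissible O)
    (hdiv : DivStable O) {I : AddSubgroup (HDiff k n)} (hI : IsHomIdeal O I) {ω : WeightSpace n}
    (hω : Generic ω) : ∃ g, IsRedSystem O I ω g := by
  have : ∀ m, ∃ g, m ∈ leadSet ω I → IsReduced I (leadSet ω I) g m := fun m => by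
    by_cases hm : m ∈ leadSet ω I
    · obtain ⟨g, hg, -⟩ := exists_isReduced hO hdiv hI hω hω.adapted (fun m hm => hm) hm
      exact ⟨g, fun _ => hg⟩
    · exact ⟨0, fun h => absurd h hm⟩
  choose g hg using this
  exact ⟨g, hO, hdiv, hI, hω, hg⟩

/-- The Gröbner cones that meet the closed cell of a set of leading monomials. -/
theorem exists_cell {O : Subring (MvPowerSeries (Fin n) k)} (hO : Admissible O)
    (hdiv : DivStable O) {I : AddSubgroup (HDiff k n)} (hI : IsHomIdeal O I) {ω : WeightSpace n}
    (hω : Generic ω) : ∃ Λ : Finset ((Fin n → ℤ) × (Fin n → ℤ)),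
      (∀ ω', Generic ω' → leadSet ω' I = leadSet ω I → ∀ a ∈ Λ, ev ω' a ≤ 0) ∧
      (∀ w, (∀ a ∈ Λ, ev w a ≤ 0) → w ∈ Wloc n ∧
        groebnerCone (coefsIn O : Set (HDiff k n)) (I : Set (HDiff k n)) w =
          {w' | (∀ a ∈ Λ, ev w' a ≤ 0) ∧ ∀ a ∈ Λ, ev w a = 0 ↔ ev w' a = 0}) := by
  obtain ⟨g, h⟩ := exists_isRedSystem hO hdiv hI hω
  obtain ⟨Λ, h1, h2⟩ := h.exists_finset
  refine ⟨Λ, fun ω' hω' he => (h1 ω').2 ⟨hω'.mem_Wloc, fun m hm ν hν => h.wt_le hω' he hm hν⟩,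
    fun w hw => ?_⟩
  have hw := (h1 w).1 hw
  refine ⟨hw.1, ?_⟩
  ext w'
  change (w' ∈ Wloc n ∧ SameGr _ w w' ∧ _) ↔ ((∀ a ∈ Λ, ev w' a ≤ 0) ∧ _)
  rw [h1 w']
  constructor
  · rintro ⟨hw', hs, he⟩
    have hs := (hO.sameGr_iff hw.1 hw').1 hs
    obtain ⟨h3, h4⟩ := (h.gr_eq_iff hw hw' hs).1 he
    exact ⟨h3, (h2 w w' hw h3).2 ⟨hs, h4⟩⟩
  · rintro ⟨hw', hp⟩
    obtain ⟨h3, h4⟩ := (h2 w w' hw hw').1 hp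
    exact ⟨hw'.1, (hO.sameGr_iff hw.1 hw'.1).2 h3, (h.gr_eq_iff hw hw'.1 h3).2 ⟨hw', h4⟩⟩

/-! ### Finiteness -/

/-- Noetherian induction on an upper set `J` contained in the leading sets considered. If one of
them is larger than `J`, take its reduced element `g m` at some `m ∉ J`; none of its monomials lies
in `J`. For every other weight the leading monomial of `g m` is one of finitely many `b`, and each
`b` strictly enlarges `J`. -/
theorem finite_leadSets {O : Subring (MvPowerSeries (Fin n) k)} (hO : Admissible O)
    (hdiv : DivStable O) {I : AddSubgroup (HDiff k n)} (hI : IsHomIdeal O I) :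
    {E | ∃ ω, Generic ω ∧ E = leadSet ω I}.Finite := by
  suffices h : ∀ J : UpperSet (Mon n),
      {E | (∃ ω, Generic ω ∧ E = leadSet ω I) ∧ (J : Set (Mon n)) ⊆ E}.Finite by
    refine (h ⊤).subset fun E hE => ⟨hE, ?_⟩
    simp
  intro J
  induction J using (wellFounded_upperSet_lt (Mon n)).induction with
  | _ J ih =>
    by_cases hJ : ∀ E, (∃ ω, Generic ω ∧ E = leadSet ω I) → (J : Set (Mon n)) ⊆ E → E = J
    · exact (Set.finite_singleton (J : Set (Mon n))).subset fun E hE => hJ E hE.1 hE.2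
    push Not at hJ
    obtain ⟨E, ⟨ω, hω, rfl⟩, hJE, hne⟩ := hJ
    obtain ⟨m, hm, hmJ⟩ := Set.exists_of_ssubset (hJE.ssubset_of_ne (Ne.symm hne))
    obtain ⟨g, hg⟩ := exists_isRedSystem hO hdiv hI hω
    have hred := hg.red m hm
    have hsupp : ∀ ν, (g m).cf ν ≠ 0 → ν ∉ (J : Set (Mon n)) := fun ν hν hνJ => by
      by_cases h : ν = m
      · exact hmJ (h ▸ hνJ)
      · exact hν (hred.cf_eq_zero ν (hJE hνJ) h)
    obtain ⟨B, hB, hB'⟩ := exists_base {ν | (g m).cf ν ≠ 0} (deg m)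
    have hBne : B.Nonempty := by
      obtain ⟨b, hb, -⟩ := hB' m (by
        change (g m).cf m ≠ 0
        rw [hred.cf_eq_one]; exact one_ne_zero) rfl
      exact ⟨b, hb⟩
    have hlt : ∀ b ∈ B, (J : Set (Mon n)) ⊂ ((J ⊓ UpperSet.Ici b : UpperSet (Mon n)) : Set (Mon n)) := by
      intro b hb
      rw [UpperSet.coe_inf, UpperSet.coe_Ici]
      refine ⟨Set.subset_union_left, fun h => hsupp b (hB b hb) (h (Or.inr ?_))⟩
      exact Set.mem_Ici.2 le_rfl
    refine (B.finite_toSet.biUnion fun b hb => ih _ (hlt b hb)).subset ?_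
    rintro _ ⟨⟨ω', hω', rfl⟩, hJE'⟩
    -- The leading monomial of `g m` for `ω'` is the heaviest base monomial, because multiplication
    -- by powers of `x` does not raise weights.
    obtain ⟨b, hb, hmax⟩ := B.exists_max_image (wt ω') hBne
    obtain ⟨m', hm', h1, h2, h3⟩ := exists_lead hO hI hω' hred.mem (hB b hb)
    obtain ⟨b', hb', δ, hδ⟩ := hB' m' h1 (hred.homog m' h1)
    have h4 : wt ω' ((δ, 0) : Mon n) ≤ 0 := by
      simpa [wt, weight] using weight_nonpos hω'.mem_Wloc δ
    have h5 : m' = b := by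
      refine hω'.eq_of_wt_eq h2 (le_antisymm ?_ h3)
      rw [hδ, wt_add]
      linarith [hmax b' hb']
    refine Set.mem_biUnion hb ⟨⟨ω', hω', rfl⟩, ?_⟩
    rw [UpperSet.coe_inf, UpperSet.coe_Ici]
    refine Set.union_subset hJE' fun μ hμ => isUpperSet_leadSet hO hI hω' (Set.mem_Ici.1 hμ) (h5 ▸ hm')

/-! ### Generic weights are dense -/

/-- The functional with the given integral coefficients. -/
noncomputable def evL (a : (Fin n → ℤ) × (Fin n → ℤ)) : WeightSpace n →ₗ[ℝ] ℝ where
  toFun w := ev w a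
  map_add' w w' := by
    simp only [ev, Prod.fst_add, Prod.snd_add, Pi.add_apply, mul_add, Finset.sum_add_distrib]
    ring
  map_smul' c w := by
    simp only [ev, Prod.smul_fst, Prod.smul_snd, Pi.smul_apply, smul_eq_mul, RingHom.id_apply,
      mul_add, Finset.mul_sum]
    congr 1 <;> exact Finset.sum_congr rfl fun i _ => by ring

@[simp] theorem evL_apply (a : (Fin n → ℤ) × (Fin n → ℤ)) (w : WeightSpace n) :
    evL a w = ev w a := rfl

theorem exists_ev_ne_zero {a : (Fin n → ℤ) × (Fin n → ℤ)} (ha : a ≠ 0) : ∃ w, ev w a ≠ 0 := by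
  by_contra! h
  refine ha (Prod.ext (funext fun i => ?_) (funext fun i => ?_))
  · simpa [ev, Pi.single_apply] using h (Pi.single i 1, 0)
  · simpa [ev, Pi.single_apply] using h (0, Pi.single i 1)

/-- Baire's theorem, applied to the complements of countably many hyperplanes. -/
theorem dense_ev_ne_zero :
    Dense (⋂ a : {a : (Fin n → ℤ) × (Fin n → ℤ) // a ≠ 0}, {w : WeightSpace n | ev w a ≠ 0}) := by
  refine dense_iInter_of_isOpen (fun a => ?_) fun a => ?_
  · exact isOpen_ne_fun (evL a.1).continuous_of_finiteDimensional continuous_const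
  · have e : {w : WeightSpace n | ev w a ≠ 0} =
        ((LinearMap.ker (evL a.1) : Submodule ℝ (WeightSpace n)) : Set (WeightSpace n))ᶜ := by
      ext w; simp
    rw [e, ← interior_eq_empty_iff_dense_compl]
    by_contra h
    have h1 := Submodule.eq_top_of_nonempty_interior' _ (Set.nonempty_iff_ne_empty.2 h)
    obtain ⟨w, hw⟩ := exists_ev_ne_zero a.2
    have h2 : w ∈ LinearMap.ker (evL a.1) := h1 ▸ Submodule.mem_top
    exact hw h2

theorem Wloc_subset_closure_generic : Wloc n ⊆ closure {ω | Generic ω} := by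
  let U : Set (WeightSpace n) := ⋂ i, {w | w.1 i < 0 ∧ 0 < w.1 i + w.2 i}
  have hU : IsOpen U := isOpen_iInter_of_finite fun i =>
    (isOpen_lt (f := fun w : WeightSpace n => w.1 i) (by fun_prop) continuous_const).and
      (isOpen_lt (g := fun w : WeightSpace n => w.1 i + w.2 i) continuous_const (by fun_prop))
  have h1 : U ∩ (⋂ a : {a : (Fin n → ℤ) × (Fin n → ℤ) // a ≠ 0}, {w : WeightSpace n | ev w a ≠ 0})
      ⊆ {ω | Generic ω} := by
    rintro ω ⟨hω, hω'⟩
    have hω := Set.mem_iInter.1 hω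
    have hω' := Set.mem_iInter.1 hω'
    refine ⟨fun i => (hω i).1, fun i => (hω i).2, fun a ha => ?_⟩
    by_contra h0
    exact hω' ⟨a, h0⟩ ha
  have h2 : U ⊆ closure {ω | Generic ω} :=
    (dense_ev_ne_zero.open_subset_closure_inter hU).trans (closure_mono h1)
  intro w hw
  -- The direction `(-1, 2)` points into the interior: it lowers `u_i` and raises `u_i + v_i`, each
  -- at rate one.
  have ht : Filter.Tendsto (fun t : ℝ => w + t • ((fun _ => -1, fun _ => 2) : WeightSpace n))
      (nhdsWithin 0 (Set.Ioi 0)) (nhds w) := by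
    have : ContinuousAt (fun t : ℝ => w + t • ((fun _ => -1, fun _ => 2) : WeightSpace n)) 0 := by
      fun_prop
    have h3 := this.tendsto
    simp only [zero_smul, add_zero] at h3
    exact h3.mono_left nhdsWithin_le_nhds
  refine isClosed_closure.mem_of_tendsto ht ?_
  filter_upwards [self_mem_nhdsWithin] with t h0
  have h0 : 0 < t := h0
  refine h2 (Set.mem_iInter.2 fun i => ?_)
  have h3 := hw i
  constructor
  · simp only [Prod.fst_add, Prod.smul_fst, Pi.add_apply, Pi.smul_apply, smul_eq_mul]
    linarith
  · simp only [Prod.fst_add, Prod.smul_fst, Pi.add_apply, Pi.smul_apply, smul_eq_mul,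
      Prod.snd_add, Prod.smul_snd]
    linarith

/-! ### The fan -/

theorem isClosed_halfspaceCone_image (Λ : Finset ((Fin n → ℤ) × (Fin n → ℤ))) :
    IsClosed {w : WeightSpace n | ∀ a ∈ Λ, ev w a ≤ 0} := by
  have : {w : WeightSpace n | ∀ a ∈ Λ, ev w a ≤ 0} = ⋂ a ∈ Λ, {w | ev w a ≤ 0} := by
    ext w; simp
  rw [this]
  exact isClosed_biInter fun a _ =>
    isClosed_le (evL a).continuous_of_finiteDimensional continuous_const

/-- The cells are indexed by the finitely many sets of leading monomials. The closure of the Gröbner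
cone of `w` is the face through `w` of every cell containing `w`, which is the compatibility needed
for gluing. -/
theorem fan_of_admissible {O : Subring (MvPowerSeries (Fin n) k)} (hO : Admissible O)
    (hdiv : DivStable O) {I : AddSubgroup (HDiff k n)} (hI : IsHomIdeal O I) :
    (IsPolyhedralFan (closedGroebnerFan (coefsIn O : Set (HDiff k n)) (I : Set (HDiff k n))) ∧
      ∀ C ∈ closedGroebnerFan (coefsIn O : Set (HDiff k n)) (I : Set (HDiff k n)),
        IsRationalCone C) ∧
    ∀ L : Submodule ℝ (WeightSpace n),
      IsPolyhedralFan (restrictFan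
        (closedGroebnerFan (coefsIn O : Set (HDiff k n)) (I : Set (HDiff k n))) L) ∧
      ⋃₀ restrictFan (closedGroebnerFan (coefsIn O : Set (HDiff k n)) (I : Set (HDiff k n))) L =
        Wloc n ∩ L := by
  classical
  have h0 : ∀ E : Set (Mon n), ∃ Λ : Finset ((Fin n → ℤ) × (Fin n → ℤ)),
      (∃ ω, Generic ω ∧ E = leadSet ω I) →
      (∀ ω', Generic ω' → leadSet ω' I = E → ∀ a ∈ Λ, ev ω' a ≤ 0) ∧
      (∀ w, (∀ a ∈ Λ, ev w a ≤ 0) → w ∈ Wloc n ∧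
        groebnerCone (coefsIn O : Set (HDiff k n)) (I : Set (HDiff k n)) w =
          {w' | (∀ a ∈ Λ, ev w' a ≤ 0) ∧ ∀ a ∈ Λ, ev w a = 0 ↔ ev w' a = 0}) := fun E => by
    by_cases hE : ∃ ω, Generic ω ∧ E = leadSet ω I
    · obtain ⟨ω, hω, rfl⟩ := hE
      obtain ⟨Λ, hΛ⟩ := exists_cell hO hdiv hI hω
      exact ⟨Λ, fun _ => hΛ⟩
    · exact ⟨∅, fun h => absurd h hE⟩
  choose Λ hΛ using h0
  let S : Set (Set (Mon n)) := {E | ∃ ω, Generic ω ∧ E = leadSet ω I}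
  have hS : S.Finite := finite_leadSets hO hdiv hI
  let 𝓛 : Set (Finset (WeightSpace n →ₗ[ℝ] ℝ)) := (fun E => (Λ E).image evL) '' S
  have hmem : ∀ E (w : WeightSpace n), w ∈ halfspaceCone ((Λ E).image evL) ↔
      ∀ a ∈ Λ E, ev w a ≤ 0 := fun E w => by
    simp only [halfspaceCone, Set.mem_ofPred_eq, Finset.forall_mem_image, evL_apply]
  have hcone : ∀ E ∈ S, ∀ w ∈ halfspaceCone ((Λ E).image evL),
      closure (groebnerCone (coefsIn O : Set (HDiff k n)) (I : Set (HDiff k n)) w) =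
        coneFaceOf ((Λ E).image evL) w := fun E hE w hw => by
    rw [← closure_openFaceOf hw, (((hΛ E hE).2 w) ((hmem E w).1 hw)).2]
    congr 1
    ext w'
    simp only [openFaceOf, Set.mem_ofPred_eq, Finset.forall_mem_image, evL_apply]
  have hcover : ∀ w ∈ Wloc n, ∃ E ∈ S, w ∈ halfspaceCone ((Λ E).image evL) := by
    have hcl : IsClosed (⋃ E ∈ S, {w : WeightSpace n | ∀ a ∈ Λ E, ev w a ≤ 0}) :=
      hS.isClosed_biUnion fun E _ => isClosed_halfspaceCone_image (Λ E)
    have hsub : {ω : WeightSpace n | Generic ω} ⊆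
        ⋃ E ∈ S, {w : WeightSpace n | ∀ a ∈ Λ E, ev w a ≤ 0} := fun ω hω =>
      Set.mem_biUnion (x := leadSet ω I) ⟨ω, hω, rfl⟩ ((hΛ _ ⟨ω, hω, rfl⟩).1 ω hω rfl)
    intro w hw
    have := closure_minimal hsub hcl (Wloc_subset_closure_generic hw)
    simp only [Set.mem_iUnion] at this
    obtain ⟨E, hE, h⟩ := this
    exact ⟨E, hE, (hmem E w).2 h⟩
  have hfan : closedGroebnerFan (coefsIn O : Set (HDiff k n)) (I : Set (HDiff k n)) =
      {C | ∃ Λ' ∈ 𝓛, ∃ w ∈ halfspaceCone Λ', C = coneFaceOf Λ' w} := by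
    ext C
    constructor
    · rintro ⟨w, hw, rfl⟩
      obtain ⟨E, hE, h⟩ := hcover w hw
      exact ⟨_, ⟨E, hE, rfl⟩, w, h, hcone E hE w h⟩
    · rintro ⟨_, ⟨E, hE, rfl⟩, w, hw, rfl⟩
      exact ⟨w, ((hΛ E hE).2 w ((hmem E w).1 hw)).1, (hcone E hE w hw).symm⟩
  have hres : ∀ L : Submodule ℝ (WeightSpace n),
      restrictFan (closedGroebnerFan (coefsIn O : Set (HDiff k n)) (I : Set (HDiff k n))) L =
        {C | ∃ Λ' ∈ 𝓛, ∃ w ∈ halfspaceCone Λ', C = coneFaceOf Λ' w ∩ L} := fun L => by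
    rw [hfan]
    ext C
    constructor
    · rintro ⟨_, ⟨Λ', h1, w, h2, rfl⟩, rfl⟩
      exact ⟨Λ', h1, w, h2, rfl⟩
    · rintro ⟨Λ', h1, w, h2, rfl⟩
      exact ⟨_, ⟨Λ', h1, w, h2, rfl⟩, rfl⟩
  have hpoly : ∀ L : Submodule ℝ (WeightSpace n), IsPolyhedralFan (restrictFan
      (closedGroebnerFan (coefsIn O : Set (HDiff k n)) (I : Set (HDiff k n))) L) := fun L => by
    rw [hres]
    refine isPolyhedralFan_coneFaceOf 𝓛 (hS.image _) L ?_
    rintro _ ⟨E, hE, rfl⟩ _ ⟨E', hE', rfl⟩ w hw hw'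
    -- Both faces are the closure of one and the same Gröbner cone.
    rw [← hcone E hE w hw, hcone E' hE' w hw']
  refine ⟨⟨?_, ?_⟩, fun L => ⟨hpoly L, ?_⟩⟩
  · have e : restrictFan (closedGroebnerFan (coefsIn O : Set (HDiff k n)) (I : Set (HDiff k n)))
        (⊤ : Submodule ℝ (WeightSpace n)) =
        closedGroebnerFan (coefsIn O : Set (HDiff k n)) (I : Set (HDiff k n)) := by
      simp [restrictFan]
    rw [← e]
    exact hpoly ⊤
  · rw [hfan]
    rintro _ ⟨_, ⟨E, -, rfl⟩, w, -, rfl⟩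
    refine ⟨Λ E ∪ ((Λ E).filter fun a => ev w a = 0).image fun a => -a, ?_⟩
    ext x
    change _ ↔ ∀ a ∈ _, ev x a ≤ 0
    simp only [coneFaceOf, Set.mem_ofPred_eq, Finset.forall_mem_image, evL_apply]
    simp only [Finset.mem_union, Finset.mem_image, Finset.mem_filter]
    constructor
    · rintro ⟨h1, h2⟩ a (ha | ⟨a, ⟨ha, ha'⟩, rfl⟩)
      · exact h1 ha
      · rw [ev_neg, h2 ha ha', neg_zero]
    · intro h
      refine ⟨fun a ha => h a (Or.inl ha), fun a ha ha' => ?_⟩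
      have h1 := h a (Or.inl ha)
      have h2 := h (-a) (Or.inr ⟨a, ⟨ha, ha'⟩, rfl⟩)
      rw [ev_neg] at h2
      linarith
  · rw [hres]
    ext w
    constructor
    · rintro ⟨_, ⟨_, ⟨E, hE, rfl⟩, v, -, rfl⟩, hw⟩
      exact ⟨((hΛ E hE).2 w ((hmem E w).1 hw.1.1)).1, hw.2⟩
    · rintro ⟨hw, hL⟩
      obtain ⟨E, hE, h⟩ := hcover w hw
      exact ⟨_, ⟨_, ⟨E, hE, rfl⟩, w, h, rfl⟩, mem_coneFaceOf_self h, hL⟩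

end HDiff

namespace HDiff

open Mon Filter

/-! ### Formal power series -/

theorem admissible_top {k : Type*} [Field k] {n : ℕ} :
    Admissible (⊤ : Subring (MvPowerSeries (Fin n) k)) where
  monomial_mem _ _ := trivial
  restr_mem _ _ _ _ _ := trivial
  geom_mem i := by
    classical
    refine ⟨fun α => if ∃ a : ℕ, α = Finsupp.single i a then 1 else 0, trivial, fun α => ?_⟩
    change (if ∃ a : ℕ, α = Finsupp.single i a then (1 : k) else 0) ≠ 0 ↔ _
    simp

theorem divStable_top {k : Type*} [Field k] {n : ℕ} :
    DivStable (⊤ : Subring (MvPowerSeries (Fin n) k)) :=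
  fun _ _ _ _ _ _ _ _ _ _ _ _ _ _ _ _ => trivial

/-! ### Convergent power series -/

variable {n : ℕ}

variable (n) in
/-- The ring of convergent power series. -/
def convergent : Subring (MvPowerSeries (Fin n) ℂ) where
  carrier := {c | IsConvergent c}
  mul_mem' := fun hc hd => hc.mul hd
  one_mem' := isConvergent_one
  add_mem' := fun hc hd => hc.add hd
  zero_mem' := isConvergent_zero
  neg_mem' := fun hc => hc.neg

theorem admissible_convergent : Admissible (convergent n) where
  monomial_mem β a := by
    classical
    refine ⟨1, one_pos, summable_of_ne_finset_zero (s := {β}) fun α hα => ?_⟩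
    have : α ≠ β := by simpa using hα
    simp [MvPowerSeries.coeff_monomial, this]
  restr_mem f hf δ T _ := by
    obtain ⟨r, hr, h⟩ := hf
    refine ⟨r, hr, Summable.of_nonneg_of_le (fun α => by positivity) (fun α => ?_)
      ((h.comp_injective (add_left_injective δ)).mul_left (r ^ δ.degree)⁻¹)⟩
    change ‖if α ∈ T then MvPowerSeries.coeff (α + δ) f else 0‖ * r ^ α.degree ≤ _
    simp only [Function.comp_apply, map_add, pow_add]
    have e : (r ^ δ.degree)⁻¹ * (‖MvPowerSeries.coeff (α + δ) f‖ * (r ^ α.degree * r ^ δ.degree)) =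
        ‖MvPowerSeries.coeff (α + δ) f‖ * r ^ α.degree := by
      have : r ^ δ.degree ≠ 0 := by positivity
      field_simp
    rw [e]
    gcongr
    split_ifs
    · exact le_rfl
    · simp
  geom_mem i := by
    classical
    refine ⟨fun α => if ∃ a : ℕ, α = Finsupp.single i a then 1 else 0, ?_, fun α => ?_⟩
    · refine ⟨1 / 2, by norm_num, ?_⟩
      have hinj : Function.Injective fun a : ℕ => (Finsupp.single i a : Fin n →₀ ℕ) :=
        Finsupp.single_injective i
      rw [← hinj.summable_iff]
      · refine Summable.congr (summable_geometric_of_lt_one (r := (1 / 2 : ℝ)) (by norm_num)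
          (by norm_num)) fun a => ?_
        change _ = ‖if ∃ b : ℕ, Finsupp.single i a = Finsupp.single i b then (1 : ℂ) else 0‖ *
          (1 / 2 : ℝ) ^ (Finsupp.single i a).degree
        rw [if_pos ⟨a, rfl⟩, Finsupp.degree_single]
        simp
      · intro α hα
        change ‖if ∃ b : ℕ, α = Finsupp.single i b then (1 : ℂ) else 0‖ * _ = 0
        rw [if_neg fun ⟨a, ha⟩ => hα ⟨a, ha.symm⟩]
        simp
    · change (if ∃ a : ℕ, α = Finsupp.single i a then (1 : ℂ) else 0) ≠ 0 ↔ _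
      simp

theorem cast_degree (α : Fin n →₀ ℕ) : ((α.degree : ℕ) : ℝ) = ∑ i, (α i : ℝ) := by
  rw [Finsupp.degree_eq_sum, Nat.cast_sum]

/-- For `s` large one has `exp (s u_i) ≤ r` for all `i`, so the norm weighted by `exp (s ω)` is
controlled by absolute convergence on a polydisc of radius `r`. -/
theorem exp_wt_le {ω : WeightSpace n} (hω : ∀ i, ω.1 i < 0) {r : ℝ} (hr : 0 < r) {s : ℝ}
    (hs : ∑ i, |Real.log r / ω.1 i| ≤ s) (m : Mon n) :
    Real.exp (s * wt ω m) ≤ Real.exp (s * ∑ i, ω.2 i * (m.2.1 i : ℝ)) * r ^ m.1.degree := by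
  have h1 : r ^ m.1.degree = Real.exp (∑ i, Real.log r * (m.1 i : ℝ)) := by
    rw [← Finset.mul_sum, ← cast_degree, mul_comm, Real.exp_nat_mul, Real.exp_log hr]
  rw [h1, ← Real.exp_add, wt, weight, mul_add, add_comm, Finset.mul_sum _ (fun i => ω.1 i * _)]
  refine Real.exp_le_exp.2 (add_le_add le_rfl (Finset.sum_le_sum fun i _ => ?_))
  have h2 : |Real.log r / ω.1 i| ≤ s := le_trans
    (Finset.single_le_sum (f := fun i => |Real.log r / ω.1 i|) (fun i _ => abs_nonneg _)
      (Finset.mem_univ i)) hs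
  have h3 : s * ω.1 i ≤ Real.log r := by
    have h4 : -(Real.log r / -ω.1 i) ≤ s := by
      rw [div_neg, neg_neg]
      exact (le_abs_self _).trans h2
    have h5 : 0 < -ω.1 i := by linarith [hω i]
    rw [← neg_div, div_le_iff₀ h5] at h4
    linarith
  rw [← mul_assoc]
  exact mul_le_mul_of_nonneg_right h3 (Nat.cast_nonneg _)

theorem eventually_summable {ω : WeightSpace n} (hω : ∀ i, ω.1 i < 0) {P : HDiff ℂ n}
    (hP : P ∈ coefsIn (convergent n)) :
    ∀ᶠ s : ℝ in atTop, Summable fun m => ‖P.cf m‖ * Real.exp (s * wt ω m) := by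
  have hP : IsAnalytic P := hP
  refine hP.induction (p := fun P => ∀ᶠ s : ℝ in atTop,
    Summable fun m => ‖P.cf m‖ * Real.exp (s * wt ω m)) ?_ (fun β j c hc => ?_)
    (fun P Q hP hQ => ?_)
  · simp
  · obtain ⟨r, hr, h⟩ := hc
    filter_upwards [eventually_ge_atTop (∑ i, |Real.log r / ω.1 i|)] with s hs
    have hinj : Function.Injective fun α : Fin n →₀ ℕ => ((α, β, j) : Mon n) := fun α α' h =>
      congrArg Prod.fst h
    rw [← hinj.summable_iff]
    · refine Summable.of_nonneg_of_le
        (fun α => mul_nonneg (norm_nonneg _) (Real.exp_pos _).le) (fun α => ?_)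
        (h.mul_left (Real.exp (s * ∑ i, ω.2 i * (β i : ℝ))))
      simp only [Function.comp_apply, cf_mono, if_true]
      have := exp_wt_le hω hr hs (α, β, j)
      calc _ ≤ ‖MvPowerSeries.coeff α c‖ *
            (Real.exp (s * ∑ i, ω.2 i * (β i : ℝ)) * r ^ α.degree) := by gcongr
        _ = _ := by ring
    · intro m hm
      rw [cf_mono, if_neg fun h => hm ⟨m.1, by rw [h]⟩, norm_zero, zero_mul]
  · filter_upwards [hP, hQ] with s h1 h2
    refine Summable.of_nonneg_of_le (fun m => by positivity) (fun m => ?_) (h1.add h2)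
    rw [← add_mul, cf_add]
    gcongr
    exact norm_add_le _ _

/-- The norm of the tail of `P` relative to `m`, in the weighted `ℓ¹` norm with parameter `s`. -/
theorem eventually_tail_le {ω : WeightSpace n} (hω : ∀ i, ω.1 i < 0) {P : HDiff ℂ n}
    (hP : P ∈ coefsIn (convergent n)) {m : Mon n}
    (hm : ∀ ν, P.cf ν ≠ 0 → ν ≠ m → wt ω ν < wt ω m) :
    ∀ᶠ s : ℝ in atTop, ∀ T : Finset (Mon n), m ∉ T →
      ∑ ν ∈ T, ‖P.cf ν‖ * Real.exp (s * (wt ω ν - wt ω m)) ≤ 1 / 2 := by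
  classical
  obtain ⟨s₀, hs₀⟩ := (eventually_summable hω hP).exists
  let F : ℝ → Mon n → ℝ := fun s ν =>
    if ν = m then 0 else ‖P.cf ν‖ * Real.exp (s * (wt ω ν - wt ω m))
  have hF0 : ∀ s ν, 0 ≤ F s ν := fun s ν => by
    simp only [F]
    split_ifs
    · exact le_rfl
    · positivity
  have hbound : Summable fun ν => ‖P.cf ν‖ * Real.exp (s₀ * (wt ω ν - wt ω m)) := by
    refine (hs₀.mul_right (Real.exp (-(s₀ * wt ω m)))).congr fun ν => ?_
    rw [mul_assoc, ← Real.exp_add]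
    ring_nf
  have hle : ∀ s, s₀ ≤ s → ∀ ν, F s ν ≤ ‖P.cf ν‖ * Real.exp (s₀ * (wt ω ν - wt ω m)) :=
    fun s hs ν => by
    simp only [F]
    split_ifs with h
    · positivity
    · by_cases h0 : P.cf ν = 0
      · simp [h0]
      · have := hm ν h0 h
        gcongr ?_ * Real.exp ?_
        nlinarith
  -- Every exponent in the tail is a negative multiple of `s`, so each term tends to `0`; the values
  -- at `s₀` dominate.
  have hlim : Tendsto (fun s => ∑' ν, F s ν) atTop (nhds (∑' _ : Mon n, (0 : ℝ))) := by
    refine tendsto_tsum_of_dominated_convergence hbound (fun ν => ?_) ?_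
    · simp only [F]
      by_cases h : ν = m
      · simp [h]
      by_cases h0 : P.cf ν = 0
      · simp [h0]
      · simp only [if_neg h]
        have h1 := hm ν h0 h
        have h2 : Tendsto (fun s : ℝ => s * (wt ω ν - wt ω m)) atTop atBot :=
          tendsto_id.atTop_mul_const_of_neg (by linarith)
        simpa using (Real.tendsto_exp_atBot.comp h2).const_mul ‖P.cf ν‖
    · filter_upwards [eventually_ge_atTop s₀] with s hs ν
      rw [Real.norm_of_nonneg (hF0 s ν)]
      exact hle s hs ν
  rw [tsum_zero] at hlim
  filter_upwards [hlim.eventually_le_const (show (0 : ℝ) < 1 / 2 by norm_num),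
    eventually_ge_atTop s₀] with s h1 h2 T hT
  have hsum : Summable (F s) := Summable.of_nonneg_of_le (hF0 s) (hle s h2) hbound
  refine le_trans (le_trans (le_of_eq ?_) (hsum.sum_le_tsum T fun ν _ => hF0 s ν)) h1
  refine Finset.sum_congr rfl fun ν hν => ?_
  have : ν ≠ m := fun h => hT (h ▸ hν)
  simp only [F, if_neg this]

/-- Multiplication by `x^δ` shifts all weights by the same amount, so the norm of the tail relative
to the leading monomial is unchanged. -/
theorem sum_shiftCf_le {ω : WeightSpace n} {P : Mon n → HDiff ℂ n} {b : Mon n → Mon n} {ν : Mon n}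
    (hb : ∃ δ, ν = (δ, 0) + b ν) {s C : ℝ}
    (h : ∀ T : Finset (Mon n), b ν ∉ T →
      ∑ κ ∈ T, ‖(P (b ν)).cf κ‖ * Real.exp (s * (wt ω κ - wt ω (b ν))) ≤ C)
    (T : Finset (Mon n)) (hT : ν ∉ T) :
    ∑ μ ∈ T, ‖shiftCf P b μ ν‖ * Real.exp (s * (wt ω μ - wt ω ν)) ≤ C := by
  classical
  obtain ⟨δ, hδ⟩ := hb
  let T' := T.filter fun μ => shiftCf P b μ ν ≠ 0
  let t : Mon n → Mon n := fun μ => (μ.1 - δ, μ.2)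
  have key : ∀ μ ∈ T', μ = (δ, 0) + t μ ∧ shiftCf P b μ ν = (P (b ν)).cf (t μ) := fun μ hμ => by
    have h1 := (Finset.mem_filter.1 hμ).2
    have e : ν.1 - (b ν).1 = δ := by
      have := congrArg Prod.fst hδ
      rw [this]
      simp
    rw [shiftCf_eq, e] at h1 ⊢
    split_ifs at h1 ⊢ with h2
    · exact ⟨Prod.ext (by simp [t, add_tsub_cancel_of_le h2]) (by simp [t]), rfl⟩
    · exact absurd rfl h1
  have hinj : Set.InjOn t T' := fun μ hμ μ' hμ' he => by
    rw [(key μ hμ).1, (key μ' hμ').1, he]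
  have hnot : b ν ∉ T'.image t := fun hmem => by
    obtain ⟨μ, hμ, he⟩ := Finset.mem_image.1 hmem
    have h1 := (key μ hμ).1
    rw [he, ← hδ] at h1
    exact hT (h1 ▸ (Finset.mem_filter.1 hμ).1)
  refine le_trans (le_of_eq ?_) (h (T'.image t) hnot)
  have hsum : ∑ μ ∈ T, ‖shiftCf P b μ ν‖ * Real.exp (s * (wt ω μ - wt ω ν)) =
      ∑ μ ∈ T', ‖shiftCf P b μ ν‖ * Real.exp (s * (wt ω μ - wt ω ν)) :=
    (Finset.sum_filter_of_ne (p := fun μ => shiftCf P b μ ν ≠ 0)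
      fun μ _ h h' => h (by simp [h'])).symm
  rw [Finset.sum_image hinj, hsum]
  refine Finset.sum_congr rfl fun μ hμ => ?_
  obtain ⟨h1, h2⟩ := key μ hμ
  have h3 := congrArg (wt ω) h1
  have h4 := congrArg (wt ω) hδ
  rw [wt_add] at h3 h4
  rw [h2, show wt ω μ - wt ω ν = wt ω (t μ) - wt ω (b ν) by linarith]

/-- With tails of relative norm at most `1/2`, the recursion gives `‖a‖ ≤ ‖f‖ + ‖a‖ / 2` in the
weighted norm, hence `‖a‖ ≤ 2 ‖f‖`. To avoid subtracting infinite quantities, this is done on finite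
truncations. -/
theorem divStable_convergent : DivStable (convergent n) := by
  classical
  intro ω d P B f b a s hω hB hf hd ha hs hrec q
  have hev := (eventually_summable hω hf).and ((Filter.eventually_all_finset B).2 fun m hm =>
    eventually_tail_le hω (hB m hm).1 (hB m hm).2)
  -- One `σ` serves `f` and all of the finitely many divisors.
  obtain ⟨σ, ⟨hσf, hσB⟩, hσ0⟩ := (hev.and (eventually_ge_atTop (0 : ℝ))).exists
  let e : Mon n → ℝ := fun μ => Real.exp (σ * wt ω μ)
  have he : ∀ μ, 0 < e μ := fun μ => Real.exp_pos _
  let C := ∑' μ, ‖f.cf μ‖ * e μ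
  have hT : ∀ c : ℝ, ∑ μ ∈ (finite_above hω d c).toFinset, ‖a μ‖ * e μ ≤ 2 * C := by
    intro c
    -- The truncation is closed upwards in degree `d`, and the recursion at `μ` refers only to
    -- heavier monomials. So the nonzero `a ν` entering the equation for `a μ`, `μ ∈ T`, are indexed
    -- by `T`.
    set T := (finite_above hω d c).toFinset with hTdef
    have hmemT : ∀ μ, μ ∈ T ↔ deg μ = d ∧ c ≤ wt ω μ := fun μ => by simp [hTdef]
    have h1 : ∀ μ ∈ T, ‖a μ‖ * e μ ≤ ‖f.cf μ‖ * e μ +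
        ∑ ν ∈ T, if μ = ν then 0 else ‖a ν‖ * e ν *
          (‖shiftCf P b μ ν‖ * Real.exp (σ * (wt ω μ - wt ω ν))) := fun μ hμ => by
      have hnn : ∀ ν ∈ T, 0 ≤ if μ = ν then 0 else ‖a ν‖ * e ν *
          (‖shiftCf P b μ ν‖ * Real.exp (σ * (wt ω μ - wt ω ν))) := fun ν _ => by
        split_ifs
        · exact le_rfl
        · have := he ν
          positivity
      by_cases h0 : a μ = 0
      · rw [h0, norm_zero, zero_mul]
        have := he μ
        exact add_nonneg (by positivity) (Finset.sum_nonneg hnn)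
      · have h2 : ‖a μ‖ ≤ ‖f.cf μ‖ + ∑ ν ∈ s μ, ‖shiftCf P b μ ν * a ν‖ := by
          rw [hrec μ h0]
          exact (norm_sub_le _ _).trans (by gcongr; exact norm_sum_le _ _)
        have h3 : (∑ ν ∈ s μ, ‖shiftCf P b μ ν * a ν‖) * e μ ≤
            ∑ ν ∈ T, if μ = ν then 0 else ‖a ν‖ * e ν *
              (‖shiftCf P b μ ν‖ * Real.exp (σ * (wt ω μ - wt ω ν))) := by
          rw [Finset.sum_mul]
          calc ∑ ν ∈ s μ, ‖shiftCf P b μ ν * a ν‖ * e μ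
              = ∑ ν ∈ (s μ).filter (fun ν => a ν ≠ 0), ‖shiftCf P b μ ν * a ν‖ * e μ := by
                rw [Finset.sum_filter_of_ne]
                intro ν _ h h'
                exact h (by simp [h'])
            _ = ∑ ν ∈ (s μ).filter (fun ν => a ν ≠ 0), if μ = ν then 0 else ‖a ν‖ * e ν *
                  (‖shiftCf P b μ ν‖ * Real.exp (σ * (wt ω μ - wt ω ν))) := by
                refine Finset.sum_congr rfl fun ν hν => ?_
                have h4 := hs μ ν (Finset.mem_filter.1 hν).1
                have h5 : μ ≠ ν := by rintro rfl; exact lt_irrefl _ h4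
                have h6 : e μ = e ν * Real.exp (σ * (wt ω μ - wt ω ν)) := by
                  simp only [e]
                  rw [← Real.exp_add]
                  ring_nf
                rw [if_neg h5, norm_mul, h6]
                ring
            _ ≤ _ := by
                refine Finset.sum_le_sum_of_subset_of_nonneg (fun ν hν => ?_)
                  fun ν hν _ => hnn ν hν
                obtain ⟨h4, h5⟩ := Finset.mem_filter.1 hν
                exact (hmemT ν).2 ⟨(ha ν h5).1, ((hmemT μ).1 hμ).2.trans (hs μ ν h4).le⟩
        calc ‖a μ‖ * e μ ≤ (‖f.cf μ‖ + ∑ ν ∈ s μ, ‖shiftCf P b μ ν * a ν‖) * e μ :=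
              mul_le_mul_of_nonneg_right h2 (he μ).le
          _ ≤ _ := by rw [add_mul]; gcongr
    have h2 : ∑ μ ∈ T, ‖f.cf μ‖ * e μ ≤ C :=
      hσf.sum_le_tsum T fun μ _ => mul_nonneg (norm_nonneg _) (he μ).le
    have h3 : ∑ μ ∈ T, ∑ ν ∈ T, (if μ = ν then 0 else ‖a ν‖ * e ν *
          (‖shiftCf P b μ ν‖ * Real.exp (σ * (wt ω μ - wt ω ν)))) ≤
        ∑ ν ∈ T, ‖a ν‖ * e ν * (1 / 2) := by
      -- Summing over `μ` first turns the inner sum into the relative tail of the divisor `P (b ν)`.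
      rw [Finset.sum_comm]
      refine Finset.sum_le_sum fun ν _ => ?_
      by_cases h0 : a ν = 0
      · simp [h0]
      · obtain ⟨-, hb1, hb2⟩ := ha ν h0
        have h4 := sum_shiftCf_le hb2 (hσB _ hb1) (T.erase ν) (Finset.notMem_erase ν T)
        calc _ = ∑ μ ∈ T.erase ν, ‖a ν‖ * e ν *
              (‖shiftCf P b μ ν‖ * Real.exp (σ * (wt ω μ - wt ω ν))) := by
              rw [← Finset.filter_ne', Finset.sum_filter]
              refine Finset.sum_congr rfl fun μ _ => ?_
              by_cases h : μ = ν <;> simp [h]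
          _ ≤ _ := by
              rw [← Finset.mul_sum]
              have := he ν
              gcongr
    have h4 := Finset.sum_le_sum h1
    rw [Finset.sum_add_distrib] at h4
    rw [← Finset.sum_mul] at h3
    linarith
  have hsum : Summable fun μ => ‖a μ‖ * e μ := by
    refine summable_of_sum_le (c := 2 * C) (fun μ => mul_nonneg (norm_nonneg _) (he μ).le)
      fun u => ?_
    obtain ⟨c, hc⟩ := (u.image (wt ω)).finite_toSet.bddBelow
    refine le_trans ?_ (hT c)
    have h1 : ∑ μ ∈ u, ‖a μ‖ * e μ = ∑ μ ∈ u.filter (fun μ => a μ ≠ 0), ‖a μ‖ * e μ := by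
      rw [Finset.sum_filter_of_ne]
      intro ν _ h h'
      exact h (by simp [h'])
    rw [h1]
    refine Finset.sum_le_sum_of_subset_of_nonneg (fun μ hμ => ?_)
      fun μ _ _ => mul_nonneg (norm_nonneg _) (he μ).le
    obtain ⟨h2, h3⟩ := Finset.mem_filter.1 hμ
    rw [Set.Finite.mem_toFinset]
    exact ⟨(ha μ h3).1, hc (Finset.mem_coe.2 (Finset.mem_image_of_mem _ h2))⟩
  -- With this radius `r`, `r ^ |α| ≤ exp (σ u·α)`, because `u_i ≥ -∑ |u_j|` and `σ ≥ 0`.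
  refine ⟨Real.exp (-(σ * ∑ i, |ω.1 i|)), Real.exp_pos _, ?_⟩
  have hinj : Function.Injective fun α : Fin n →₀ ℕ => ((α, q) : Mon n) := fun α α' h =>
    congrArg Prod.fst h
  refine Summable.of_nonneg_of_le (fun α => by positivity) (fun α => ?_)
    ((hsum.comp_injective hinj).mul_right (Real.exp (-(σ * ∑ i, ω.2 i * (q.1 i : ℝ)))))
  change ‖a (α, q)‖ * _ ≤ ‖a (α, q)‖ * Real.exp (σ * wt ω (α, q)) * _
  rw [mul_assoc, ← Real.exp_add, ← Real.exp_nat_mul, cast_degree]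
  gcongr
  have h1 : ∀ i, -(∑ i, |ω.1 i|) * (α i : ℝ) ≤ ω.1 i * α i := fun i => by
    have h2 : |ω.1 i| ≤ ∑ i, |ω.1 i| :=
      Finset.single_le_sum (f := fun i => |ω.1 i|) (fun i _ => abs_nonneg _) (Finset.mem_univ i)
    have h3 := neg_abs_le (ω.1 i)
    gcongr
    linarith
  have h2 := Finset.sum_le_sum fun i (_ : i ∈ Finset.univ) => h1 i
  rw [← Finset.mul_sum] at h2
  rw [wt, weight]
  nlinarith

/-! ### Homogeneous left ideals as subgroups of the formal ring -/

theorem isHomIdeal_of_isHomogeneousIdeal {k : Type*} [Field k] {n : ℕ}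
    {O : Subring (MvPowerSeries (Fin n) k)} (hO : Admissible O) {R : Type*} [Ring R]
    (φ : R →+* HDiff k n) (hφ : Function.Injective φ) (hR : ∀ P, P ∈ coefsIn O ↔ ∃ r, φ r = P)
    {I : Ideal R} (hI : IsHomogeneousIdeal φ I) :
    IsHomIdeal O (I.toAddSubgroup.map (φ : R →+ HDiff k n)) := by
  have hmap : ∀ r, φ r ∈ I.toAddSubgroup.map (φ : R →+ HDiff k n) ↔ r ∈ I := fun r => by
    constructor
    · rintro ⟨s, hs, h⟩
      rw [← hφ h]
      exact hs
    · exact fun h => ⟨r, h, rfl⟩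
  refine ⟨?_, ?_, ?_⟩
  · rintro _ ⟨r, -, rfl⟩
    exact (hR _).2 ⟨r, rfl⟩
  · rintro P hP _ ⟨r, hr, rfl⟩
    obtain ⟨s, rfl⟩ := (hR P).1 hP
    exact ⟨s * r, I.mul_mem_left s hr, map_mul φ s r⟩
  · rintro _ ⟨r, hr, rfl⟩ d
    change r ∈ I at hr
    change comp d (φ r) ∈ _
    obtain ⟨G, hG, rfl⟩ := hI
    induction hr using Submodule.closure_induction with
    | zero => rw [map_zero, map_zero]; exact zero_mem _
    | add r s _ _ h1 h2 => rw [map_add, map_add]; exact add_mem h1 h2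
    | smul_mem a g hg =>
      obtain ⟨e, he⟩ := (hG g hg).isHomog
      -- A component of `a * g` with `g` homogeneous is a component of `a` times `g`, and components
      -- of `a` stay in the ring.
      rw [smul_eq_mul, map_mul, comp_mul _ _ he]
      split_ifs
      · obtain ⟨s, hs⟩ := (hR (comp (d - e) (φ a))).1
          (hO.restr_mem_coefsIn ((hR _).2 ⟨a, rfl⟩) _)
        rw [← hs, ← map_mul, hmap]
        exact Ideal.mul_mem_left _ s (Ideal.subset_span hg)
      · exact zero_mem _

end HDiff

/-! ### The formal and the convergent case -/

theorem mainTheorem2 :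
    (∀ (k : Type*) [Field k] (n : ℕ) (I : Ideal (HDiff k n)), IsHomogeneousIdeal id I →
      (IsPolyhedralFan (closedGroebnerFan Set.univ (I : Set (HDiff k n))) ∧
        ∀ C ∈ closedGroebnerFan Set.univ (I : Set (HDiff k n)), IsRationalCone C) ∧
      ∀ L : Submodule ℝ (WeightSpace n),
        IsPolyhedralFan (restrictFan (closedGroebnerFan Set.univ (I : Set (HDiff k n))) L) ∧
        ⋃₀ restrictFan (closedGroebnerFan Set.univ (I : Set (HDiff k n))) L = Wloc n ∩ L) ∧
    (∀ (n : ℕ) (I : Ideal (HDiff.analytic n)), IsHomogeneousIdeal Subtype.val I →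
      (IsPolyhedralFan (closedGroebnerFan (HDiff.analytic n : Set (HDiff ℂ n))
          (Subtype.val '' (I : Set (HDiff.analytic n)))) ∧
        ∀ C ∈ closedGroebnerFan (HDiff.analytic n : Set (HDiff ℂ n))
          (Subtype.val '' (I : Set (HDiff.analytic n))), IsRationalCone C) ∧
      ∀ L : Submodule ℝ (WeightSpace n),
        IsPolyhedralFan (restrictFan (closedGroebnerFan (HDiff.analytic n : Set (HDiff ℂ n))
          (Subtype.val '' (I : Set (HDiff.analytic n)))) L) ∧
        ⋃₀ restrictFan (closedGroebnerFan (HDiff.analytic n : Set (HDiff ℂ n))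
          (Subtype.val '' (I : Set (HDiff.analytic n)))) L = Wloc n ∩ L) := by
  refine ⟨fun k _ n I hI => ?_, fun n I hI => ?_⟩
  · have h := HDiff.isHomIdeal_of_isHomogeneousIdeal HDiff.admissible_top
      (RingHom.id (HDiff k n)) Function.injective_id
      (fun P => ⟨fun _ => ⟨P, rfl⟩, fun _ _ _ => trivial⟩) hI
    have hR : (HDiff.coefsIn (⊤ : Subring (MvPowerSeries (Fin n) k)) : Set (HDiff k n)) =
        Set.univ := Set.eq_univ_of_forall fun _ _ _ => trivial
    have hI' : ((I.toAddSubgroup.map (RingHom.id (HDiff k n) : HDiff k n →+ HDiff k n) :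
        AddSubgroup (HDiff k n)) : Set (HDiff k n)) = I := Set.image_id _
    have := HDiff.fan_of_admissible HDiff.admissible_top HDiff.divStable_top h
    rwa [hR, hI'] at this
  · have h := HDiff.isHomIdeal_of_isHomogeneousIdeal HDiff.admissible_convergent
      (HDiff.analytic n).subtype Subtype.val_injective
      (fun P => ⟨fun h => ⟨⟨P, h⟩, rfl⟩, fun ⟨r, h⟩ => h ▸ r.2⟩) hI
    have hR : (HDiff.coefsIn (HDiff.convergent n) : Set (HDiff ℂ n)) = HDiff.analytic n := rfl
    have hI' : ((I.toAddSubgroup.map ((HDiff.analytic n).subtype : HDiff.analytic n →+ HDiff ℂ n) :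
        AddSubgroup (HDiff ℂ n)) : Set (HDiff ℂ n)) =
        Subtype.val '' (I : Set (HDiff.analytic n)) := AddSubgroup.coe_map _ _
    have := HDiff.fan_of_admissible HDiff.admissible_convergent HDiff.divStable_convergent h
    rwa [hR, hI'] at this
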